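/- **Setting.** Let $\mathbf G$ be a second countable locally compact (Hausdorff) group, $\rho$ a Borel probability measure on $\mathbf G$, and $N:\mathbf G\to[1,+\infty[$ a measurable submultiplicative function. Let $(\mathbf X,d)$ be a compact metric space with a continuous action of $\mathbf G$ and an action by isometries of a finite group $\mathbf H$ commuting with that of $\mathbf G$. Equip $\mathbf X/\mathbf H$ with the quotient metric $d(\pi_{\mathbf H}x,\pi_{\mathbf H}y)=\min_{h\in\mathbf H}d(x,hy)$, and assume that there is $d_0>0$ such that $d(\pi_{\mathbf H}x,\pi_{\mathbf H}y)=d(x,y)$ whenever $d(x,y)\le d_0$ (this is automatic if $\mathbf H$ acts freely). Let $\mathbf A$ be a finite $\mathbf G$-set on which the random walk defined by $\rho$ is irreducible and aperiodic, and $\pi_{\mathbf A}:\mathbf X/\mathbf H\to\mathbf A$ a continuous $\mathbf G$-equivariant map (we also write $\pi_{\mathbf A}$ for its composition with $\mathbf X\to\mathbf X/\mathbf H$). Let $\gamma_0,M>0$. Assume that $d(gx,gy)\le M N(g)^M d(x,y)$ for all $g\in\mathbf G$, $x,y\in\mathbf X$, and that $\mathbf X/\mathbf H$ is $(\rho,\gamma_0,M,N)$-contracted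 over $\mathbf A$: the same inequality holds on $\mathbf X/\mathbf H$, $\int_{\mathbf G} N(g)^{M\gamma_0}\,d\rho(g)<\infty$, and for some $n_0\ge1$ $$\sup_{x\ne y,\ \pi_{\mathbf A}(x)=\pi_{\mathbf A}(y)}\int_{\mathbf G}\frac{d(gx,gy)^{\gamma_0}}{d(x,y)^{\gamma_0}}\,d\rho^{*n_0}(g)<1\qquad(x,y\in\mathbf X/\mathbf H).$$ Let $\sigma:\mathbf G\times\mathbf X/\mathbf H\to\mathbb R$ be a continuous cocycle, i.e. $\sigma(g_2g_1,x)=\sigma(g_2,g_1x)+\sigma(g_1,x)$, such that for some constant $C$, $|\sigma(g,x)-\sigma(g,y)|\le C N(g)^M d(x,y)$ whenever $\pi_{\mathbf A}(x)=\pi_{\mathbf A}(y)$, and $e^{|\sigma(g,x)|}\le C N(g)^M$ for all $g,x$. We also regard $\sigma$ as a cocycle on $\mathbf X$. Let $\nu$ be the $\rho$-stationary probability measure on $\mathbf X/\mathbf H$ and assume that $\sigma_\rho:=\int\!\!\int\sigma(g,x)\,d\nu(x)\,d\rho(g)>0$. For $0<\gamma\le 1$ let $\mathcal C^{0,\gamma}(\mathbf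 X)$ be the space of complex $\gamma$-Hölder functions with norm $\|f\|_\infty+\sup_{x\ne y}|f(x)-f(y)|/d(x,y)^\gamma$. For $z\in i\mathbb R$ put $P(z)f(x)=\int_{\mathbf G}e^{-z\sigma(g,x)}f(gx)\,d\rho(g)$ and $P=P(0)$. Assume that there is $\gamma_1\in\,]0,1]$ such that for all $\gamma\in\,]0,\gamma_1]$ and $t_0>0$ there are $C_0,L\in\mathbb R$ such that, for all real $t$ with $|t|\ge t_0$, $P(it)$ is bounded on $\mathcal C^{0,\gamma}(\mathbf X)$, $I-P(it)$ is invertible there, and $\|(I-P(it))^{-1}\|_{\mathcal C^{0,\gamma}(\mathbf X)}\le C_0|t|^L$. On functions on $\mathbf X\times\mathbb R$ put $Pf(x,t)=\int_{\mathbf G}f(gx,t+\sigma(g,x))\,d\rho(g)$. Let $\mathcal E^{\gamma,k}(\mathbf X\times\mathbb R)$ be the set of $f\in\mathcal C^k(\mathbb R,\mathcal C^0(\mathbf X))$ such that for each $0\le m\le k$ the derivative $f^{(m)}=\partial_t^mf$ satisfies $$\sup_{x,t}e^{\gamma|t|}|f^{(m)}(x,t)|+\sup_{t}\ \sup_{x\neq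 x',\ \pi_{\mathbf A}(x)=\pi_{\mathbf A}(x')}e^{\gamma|t|}\frac{|f^{(m)}(x,t)-f^{(m)}(x',t)|}{d(x,x')^\gamma}<\infty ,$$ and let $\widehat f(x,\xi)=\int_{\mathbb R}e^{-i\xi t}f(x,t)\,dt$. **Statement.** There is a unique continuous projector $N_0$ of $\mathcal C^0(\mathbf X)$ onto the space of $P$-invariant functions that commutes with $P$. For every small enough $\gamma>0$: * there is a function $U$, with values in the bounded operators on $\mathcal C^{0,\gamma}(\mathbf X)$, which is analytic on a neighbourhood of $i\mathbb R$ and satisfies $$U(z)=(I-P(z))^{-1}-\frac1{\sigma_\rho z}N_0\qquad(z\in i\mathbb R\setminus\{0\});$$ * there is $K\in\mathbb N$ such that for every $f\in\mathcal E^{\gamma,K}(\mathbf X\times\mathbb R)$ one has $\widehat f(\cdot,\xi)\in\mathcal C^{0,\gamma}(\mathbf X)$ for all $\xi\in\mathbb R$, and for all $x\in\mathbf X$, $t\in\mathbb R$, $$\sum_{n=0}^{+\infty}P^nf(x,t)=\frac1{\sigma_\rho}\Pi_0f(x,t)+\frac1{2\pi}\int_{\mathbb R}e^{i\xi t}\,\bigl(U(-i\xi)\widehat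 f(\cdot,\xi)\bigr)(x)\,d\xi ,$$ where $\Pi_0f(x,t)=\int_t^{+\infty}(N_0f(\cdot,u))(x)\,du$, and where the series and both integrals converge absolutely. -/

import Mathlib

open MeasureTheory Filter Topology
open scoped NNReal

namespace Renewal

/-! ### The quotient of a metric space by a finite group of isometries -/

/-- The space `X / H` of orbits of `H` in `X`. -/
def OrbitSpace (H X : Type*) [Group H] [MulAction H X] : Type _ :=
  MulAction.orbitRel.Quotient H X

namespace OrbitSpace

/-- The projection `X → X / H`. -/
def mk (H : Type*) {X : Type*} [Group H] [MulAction H X] (x : X) : OrbitSpace H X :=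
  Quotient.mk (MulAction.orbitRel H X) x

theorem mk_surjective (H : Type*) {X : Type*} [Group H] [MulAction H X] :
    Function.Surjective (mk H : X → OrbitSpace H X) :=
  Quotient.mk_surjective

theorem mk_smul (H : Type*) {X : Type*} [Group H] [MulAction H X] (h : H) (x : X) :
    mk H (h • x) = mk H x :=
  Quotient.sound (s := MulAction.orbitRel H X) ⟨h, rfl⟩

/-- If the actions of `G` and `H` commute, then `G` acts on `X / H` by `g • [x] = [g • x]`. -/
instance instMulAction (G H X : Type*) [Group G] [Group H] [MulAction G X] [MulAction H X]
    [SMulCommClass G H X] : MulAction G (OrbitSpace H X) where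
  smul g := Quotient.map (fun x => g • x) (by
    rintro x y ⟨h, rfl⟩
    exact ⟨h, (smul_comm g h y).symm⟩)
  one_smul := by
    intro q
    obtain ⟨x, rfl⟩ := mk_surjective H q
    exact congrArg (mk H) (one_smul G x)
  mul_smul := by
    intro g g' q
    obtain ⟨x, rfl⟩ := mk_surjective H q
    exact congrArg (mk H) (mul_smul g g' x)

theorem smul_mk {G H X : Type*} [Group G] [Group H] [MulAction G X] [MulAction H X]
    [SMulCommClass G H X] (g : G) (x : X) : g • mk H x = mk H (g • x) := rfl

theorem iInf_dist_smul_smul {H X : Type*} [Group H] [MetricSpace X] [MulAction H X]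
    [IsIsometricSMul H X] (k l : H) (x y : X) :
    ⨅ h : H, dist (k • x) (h • l • y) = ⨅ h : H, dist x (h • y) := by
  refine Equiv.iInf_congr ((Equiv.mulLeft k⁻¹).trans (Equiv.mulRight l)) fun h => ?_
  simp only [Equiv.trans_apply, Equiv.coe_mulLeft, Equiv.coe_mulRight]
  rw [← dist_smul k x, smul_smul, smul_smul, ← mul_assoc, ← mul_assoc, mul_inv_cancel, one_mul]

/-- The distance `d([x], [y]) = inf_h d(x, h y)` on `X / H`. -/
noncomputable instance instDist (H X : Type*) [Group H] [MetricSpace X] [MulAction H X]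
    [IsIsometricSMul H X] : Dist (OrbitSpace H X) where
  dist := Quotient.lift₂ (fun x y : X => ⨅ h : H, dist x (h • y)) (by
    rintro _ _ x y ⟨k, rfl⟩ ⟨l, rfl⟩
    exact iInf_dist_smul_smul k l x y)

theorem dist_mk {H X : Type*} [Group H] [MetricSpace X] [MulAction H X]
    [IsIsometricSMul H X] (x y : X) : dist (mk H x) (mk H y) = ⨅ h : H, dist x (h • y) := rfl

theorem bddBelow_dist {H X : Type*} [Group H] [MetricSpace X] [MulAction H X] (x y : X) :
    BddBelow (Set.range fun h : H => dist x (h • y)) :=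
  ⟨0, by rintro _ ⟨h, rfl⟩; exact dist_nonneg⟩

theorem dist_mk_le {H X : Type*} [Group H] [MetricSpace X] [MulAction H X]
    [IsIsometricSMul H X] (x y : X) (h : H) : dist (mk H x) (mk H y) ≤ dist x (h • y) :=
  ciInf_le (bddBelow_dist x y) h

theorem exists_dist_mk_eq {H X : Type*} [Group H] [Finite H] [MetricSpace X] [MulAction H X]
    [IsIsometricSMul H X] (x y : X) : ∃ h : H, dist x (h • y) = dist (mk H x) (mk H y) :=
  exists_eq_ciInf_of_finite

/-- The quotient metric on `X / H`. -/
noncomputable instance instMetricSpace (H X : Type*) [Group H] [Finite H] [MetricSpace X]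
    [MulAction H X] [IsIsometricSMul H X] : MetricSpace (OrbitSpace H X) where
  dist_self := by
    intro p
    obtain ⟨x, rfl⟩ := mk_surjective H p
    obtain ⟨h, hh⟩ := exists_dist_mk_eq (H := H) x x
    have h1 := dist_mk_le x x (1 : H)
    rw [one_smul, dist_self] at h1
    exact le_antisymm h1 (hh ▸ dist_nonneg)
  dist_comm := by
    have key : ∀ x y : X, dist (mk H x) (mk H y) ≤ dist (mk H y) (mk H x) := by
      intro x y
      obtain ⟨h, hh⟩ := exists_dist_mk_eq (H := H) y x
      rw [← hh, ← dist_smul h⁻¹ y, inv_smul_smul, dist_comm (h⁻¹ • y)]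
      exact dist_mk_le x y h⁻¹
    intro p q
    obtain ⟨x, rfl⟩ := mk_surjective H p
    obtain ⟨y, rfl⟩ := mk_surjective H q
    exact le_antisymm (key x y) (key y x)
  dist_triangle := by
    intro p q r
    obtain ⟨x, rfl⟩ := mk_surjective H p
    obtain ⟨y, rfl⟩ := mk_surjective H q
    obtain ⟨z, rfl⟩ := mk_surjective H r
    obtain ⟨h, hh⟩ := exists_dist_mk_eq (H := H) x y
    obtain ⟨k, hk⟩ := exists_dist_mk_eq (H := H) y z
    rw [← hh, ← hk, ← dist_smul h y, smul_smul]
    exact (dist_mk_le x z (h * k)).trans (dist_triangle _ _ _)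
  eq_of_dist_eq_zero := by
    intro p q
    obtain ⟨x, rfl⟩ := mk_surjective H p
    obtain ⟨y, rfl⟩ := mk_surjective H q
    intro hxy
    obtain ⟨h, hh⟩ := exists_dist_mk_eq (H := H) x y
    rw [hxy] at hh
    rw [dist_eq_zero.1 hh, mk_smul]

noncomputable instance instMeasurableSpace (H X : Type*) [Group H] [Finite H] [MetricSpace X]
    [MulAction H X] [IsIsometricSMul H X] : MeasurableSpace (OrbitSpace H X) :=
  borel _

instance instBorelSpace (H X : Type*) [Group H] [Finite H] [MetricSpace X]
    [MulAction H X] [IsIsometricSMul H X] : BorelSpace (OrbitSpace H X) :=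
  ⟨rfl⟩

theorem continuous_mk (H X : Type*) [Group H] [Finite H] [MetricSpace X]
    [MulAction H X] [IsIsometricSMul H X] : Continuous (mk H : X → OrbitSpace H X) :=
  (LipschitzWith.of_dist_le_mul (K := 1) fun x y => by
    have h := dist_mk_le x y (1 : H)
    rw [one_smul] at h
    simpa using h).continuous

end OrbitSpace

/-! ### Random walks on `G`-spaces -/

/-- The convolution power `ρ^{*n}`. -/
noncomputable def convPow {G : Type*} [Group G] [MeasurableSpace G] (ρ : Measure G) :
    ℕ → Measure G
  | 0 => Measure.dirac 1
  | n + 1 => ρ.mconv (convPow ρ n)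

/-- The random walk defined by `ρ` on the finite `G`-set `A` is irreducible. -/
def IsIrreducibleWalk {G : Type*} [Group G] [MeasurableSpace G] (ρ : Measure G)
    (A : Type*) [MulAction G A] : Prop :=
  ∀ a b : A, ∃ n : ℕ, 0 < convPow ρ n {g | g • a = b}

/-- The random walk defined by `ρ` on `A` is aperiodic: for each `a`, the possible return times
to `a` have no common divisor besides `1`. -/
def IsAperiodicWalk {G : Type*} [Group G] [MeasurableSpace G] (ρ : Measure G)
    (A : Type*) [MulAction G A] : Prop :=
  ∀ a : A, ∀ d : ℕ, (∀ n : ℕ, 1 ≤ n → 0 < convPow ρ n {g | g • a = a} → d ∣ n) → d = 1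

/-- `Y` is `(ρ, γ, M, N)`-contracted over `A`, where `p : Y → A` is the projection. -/
structure IsContracted {G Y A : Type*} [Group G] [MeasurableSpace G] [MetricSpace Y]
    [MulAction G Y] (ρ : Measure G) (γ M : ℝ) (N : G → ℝ) (p : Y → A) : Prop where
  dist_smul_le : ∀ (g : G) (x y : Y), dist (g • x) (g • y) ≤ M * N g ^ M * dist x y
  moment : Integrable (fun g => N g ^ (M * γ)) ρ
  contraction : ∃ n₀ : ℕ, 1 ≤ n₀ ∧ ∃ r : ℝ, r < 1 ∧ ∀ x y : Y, x ≠ y → p x = p y →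
    ∫ g, dist (g • x) (g • y) ^ γ / dist x y ^ γ ∂(convPow ρ n₀) ≤ r

/-- `ν` is invariant under the Markov operator `φ ↦ (y ↦ ∫ φ (g y) dρ(g))` on `Y`. -/
def IsStationary {G Y : Type*} [Group G] [MeasurableSpace G] [TopologicalSpace Y]
    [MeasurableSpace Y] [MulAction G Y] (ρ : Measure G) (ν : Measure Y) : Prop :=
  ∀ φ : C(Y, ℝ), ∫ y, ∫ g, φ (g • y) ∂ρ ∂ν = ∫ y, φ y ∂ν

/-- Continuous real-valued cocycles on `G × Y`. -/
structure Cocycle (G Y : Type*) [Group G] [TopologicalSpace G] [TopologicalSpace Y]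
    [MulAction G Y] where
  toFun : G → Y → ℝ
  continuous_toFun : Continuous fun q : G × Y => toFun q.1 q.2
  map_mul : ∀ (g₂ g₁ : G) (y : Y), toFun (g₂ * g₁) y = toFun g₂ (g₁ • y) + toFun g₁ y

/-- The class `𝒵_N^M(Y)` of cocycles `σ` such that `σ_Lip(g) / N(g)^M` and
`exp(σ_sup(g)) / N(g)^M` are bounded on `G`. -/
def Cocycle.IsControlled {G Y A : Type*} [Group G] [TopologicalSpace G] [MetricSpace Y]
    [MulAction G Y] (σ : Cocycle G Y) (M : ℝ) (N : G → ℝ) (p : Y → A) : Prop :=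
  (∃ C : ℝ, ∀ (g : G) (x y : Y), p x = p y →
    |σ.toFun g x - σ.toFun g y| ≤ C * N g ^ M * dist x y) ∧
  (∃ C : ℝ, ∀ (g : G) (x : Y), Real.exp |σ.toFun g x| ≤ C * N g ^ M)

/-- The mean `σ_ρ = ∫∫ σ(g, y) dν(y) dρ(g)`. -/
noncomputable def Cocycle.mean {G Y : Type*} [Group G] [TopologicalSpace G] [MeasurableSpace G]
    [TopologicalSpace Y] [MeasurableSpace Y] [MulAction G Y] (σ : Cocycle G Y)
    (ρ : Measure G) (ν : Measure Y) : ℝ :=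
  ∫ g, ∫ y, σ.toFun g y ∂ν ∂ρ

/-- A cocycle on `X / H`, seen as a cocycle on `X`. -/
def Cocycle.lift {G H X : Type*} [Group G] [TopologicalSpace G] [Group H] [Finite H]
    [MetricSpace X] [MulAction G X] [MulAction H X] [SMulCommClass G H X] [IsIsometricSMul H X]
    (σ : Cocycle G (OrbitSpace H X)) : Cocycle G X where
  toFun g x := σ.toFun g (OrbitSpace.mk H x)
  continuous_toFun := σ.continuous_toFun.comp
    (continuous_fst.prodMk ((OrbitSpace.continuous_mk H X).comp continuous_snd))
  map_mul g₂ g₁ x := σ.map_mul g₂ g₁ (OrbitSpace.mk H x)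

/-! ### The operators `P(it)` -/

section Operators

theorem norm_cexp_mul (s : ℝ) (w : ℂ) : ‖Complex.exp (-(Complex.I * s)) * w‖ = ‖w‖ := by
  rw [norm_mul, Complex.norm_exp]
  simp

theorem continuous_integrand {G X : Type*} [Group G] [TopologicalSpace G] [MetricSpace X]
    [MulAction G X] [ContinuousSMul G X] (σ : Cocycle G X) (t : ℝ) (f : C(X, ℂ)) :
    Continuous fun q : G × X =>
      Complex.exp (-(Complex.I * ((t * σ.toFun q.1 q.2 : ℝ) : ℂ))) * f (q.1 • q.2) := by
  have h := σ.continuous_toFun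
  have h' : Continuous fun q : G × X => q.1 • q.2 := continuous_smul
  fun_prop

variable {G X : Type*} [Group G] [TopologicalSpace G] [SecondCountableTopology G]
  [MeasurableSpace G] [BorelSpace G] [MetricSpace X] [CompactSpace X] [MulAction G X]
  [ContinuousSMul G X]

theorem integrable_integrand (ρ : Measure G) [IsProbabilityMeasure ρ] (σ : Cocycle G X) (t : ℝ)
    (f : C(X, ℂ)) (x : X) :
    Integrable (fun g =>
      Complex.exp (-(Complex.I * ((t * σ.toFun g x : ℝ) : ℂ))) * f (g • x)) ρ := by
  refine Integrable.of_bound (C := ‖f‖)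
    ((continuous_integrand σ t f).comp (Continuous.prodMk_left x)).aestronglyMeasurable ?_
  exact Eventually.of_forall fun g => (norm_cexp_mul _ _).trans_le (f.norm_coe_le_norm _)

/-- The operator `P(it) f (x) = ∫ exp(-i t σ(g, x)) f(g x) dρ(g)` on `C(X, ℂ)`. -/
noncomputable def perturbedOp (ρ : Measure G) [IsProbabilityMeasure ρ] (σ : Cocycle G X)
    (t : ℝ) : C(X, ℂ) →L[ℂ] C(X, ℂ) :=
  LinearMap.mkContinuous
    { toFun := fun f =>
        { toFun := fun x =>
            ∫ g, Complex.exp (-(Complex.I * ((t * σ.toFun g x : ℝ) : ℂ))) * f (g • x) ∂ρ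
          continuous_toFun := by
            refine continuous_of_dominated (bound := fun _ => ‖f‖)
              (fun x => (integrable_integrand ρ σ t f x).aestronglyMeasurable)
              (fun x => Eventually.of_forall fun g =>
                (norm_cexp_mul _ _).trans_le (f.norm_coe_le_norm _))
              (integrable_const _)
              (Eventually.of_forall fun g =>
                (continuous_integrand σ t f).comp (Continuous.prodMk_right g)) }
      map_add' := fun f f' => by
        ext x
        simp only [ContinuousMap.coe_mk, ContinuousMap.add_apply, mul_add]
        exact integral_add (integrable_integrand ρ σ t f x) (integrable_integrand ρ σ t f' x)
      map_smul' := fun c f => by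
        ext x
        simp only [ContinuousMap.coe_mk, ContinuousMap.smul_apply, RingHom.id_apply, smul_eq_mul,
          mul_left_comm _ c]
        exact integral_const_mul c _ }
    1 (fun f => by
      rw [one_mul]
      refine (ContinuousMap.norm_le _ (norm_nonneg f)).2 fun x => ?_
      refine (norm_integral_le_of_norm_le_const (C := ‖f‖) (Eventually.of_forall fun g =>
        (norm_cexp_mul _ _).trans_le (f.norm_coe_le_norm _))).trans ?_
      simp)

theorem perturbedOp_apply (ρ : Measure G) [IsProbabilityMeasure ρ] (σ : Cocycle G X)
    (t : ℝ) (f : C(X, ℂ)) (x : X) :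
    perturbedOp ρ σ t f x =
      ∫ g, Complex.exp (-(Complex.I * ((t * σ.toFun g x : ℝ) : ℂ))) * f (g • x) ∂ρ := rfl

end Operators

/-- `N₀` is the projector of `C(X, ℂ)` onto the space of functions that are invariant under `P`
(the projector that commutes with `P`, that is, `N₀ P = P N₀`). -/
structure IsInvariantProjector {X : Type*} [TopologicalSpace X] [CompactSpace X]
    (P N₀ : C(X, ℂ) →L[ℂ] C(X, ℂ)) : Prop where
  idempotent : N₀ * N₀ = N₀
  range_eq : ∀ f : C(X, ℂ), f ∈ Set.range N₀ ↔ P f = f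
  commute : N₀ * P = P * N₀

/-- The Markov operator `P f (x, t) = ∫ f (g x, t + σ(g, x)) dρ(g)` on functions on `X × ℝ`. -/
noncomputable def walkOp {G X : Type*} [Group G] [TopologicalSpace G] [MeasurableSpace G]
    [TopologicalSpace X] [MulAction G X] (ρ : Measure G) (σ : Cocycle G X) (f : X × ℝ → ℂ) :
    X × ℝ → ℂ :=
  fun q => ∫ g, f (g • q.1, q.2 + σ.toFun g q.1) ∂ρ

/-! ### Hölder spaces -/

/-- Hölder continuous functions, as a subspace of `C(X, ℂ)`. -/
def holderSubmodule (X : Type*) [MetricSpace X] (γ : ℝ≥0) : Submodule ℂ C(X, ℂ) where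
  carrier := {f | MemHolder γ f}
  add_mem' hf hg := MemHolder.add hf hg
  zero_mem' := memHolder_zero
  smul_mem' _ _ hf := MemHolder.smul hf

/-- The space `C^{0,γ}(X)`. -/
def HolderSpace (X : Type*) [MetricSpace X] (γ : ℝ≥0) : Type _ :=
  ↥(holderSubmodule X γ)

namespace HolderSpace

variable {X : Type*} [MetricSpace X] {γ : ℝ≥0}

noncomputable instance : AddCommGroup (HolderSpace X γ) :=
  inferInstanceAs (AddCommGroup ↥(holderSubmodule X γ))

noncomputable instance : Module ℂ (HolderSpace X γ) :=
  inferInstanceAs (Module ℂ ↥(holderSubmodule X γ))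

/-- The continuous function underlying an element of `C^{0,γ}(X)`. -/
def toC (f : HolderSpace X γ) : C(X, ℂ) := Subtype.val f

theorem memHolder (f : HolderSpace X γ) : MemHolder γ f.toC := Subtype.property f

variable [CompactSpace X]

/-- The norm `‖f‖_γ = ‖f‖_∞ + m_γ(f)`. -/
noncomputable instance : Norm (HolderSpace X γ) :=
  ⟨fun f => ‖f.toC‖ + nnHolderNorm γ f.toC⟩

theorem norm_def (f : HolderSpace X γ) : ‖f‖ = ‖f.toC‖ + nnHolderNorm γ f.toC := rfl

theorem core : NormedSpace.Core ℂ (HolderSpace X γ) where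
  norm_nonneg f := add_nonneg (norm_nonneg _) (NNReal.coe_nonneg _)
  norm_smul c f := by
    have h1 : (c • f).toC = c • f.toC := rfl
    have h2 := f.memHolder.nnHolderNorm_smul c
    rw [norm_def, norm_def, h1, norm_smul, ContinuousMap.coe_smul, h2]
    push_cast
    ring
  norm_triangle f g := by
    have h1 : (f + g).toC = f.toC + g.toC := rfl
    have h2 := NNReal.coe_le_coe.2 (f.memHolder.nnHolderNorm_add_le g.memHolder)
    rw [NNReal.coe_add] at h2
    rw [norm_def, norm_def, norm_def, h1, ContinuousMap.coe_add]
    linarith [norm_add_le f.toC g.toC]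
  norm_eq_zero_iff f := by
    rw [norm_def]
    constructor
    · intro h
      have h1 : ‖f.toC‖ = 0 := le_antisymm
        (by linarith [NNReal.coe_nonneg (nnHolderNorm γ f.toC)]) (norm_nonneg _)
      exact Subtype.ext (norm_eq_zero.1 h1)
    · rintro rfl
      have h1 : (0 : HolderSpace X γ).toC = 0 := rfl
      simp [h1]

noncomputable instance : NormedAddCommGroup (HolderSpace X γ) :=
  NormedAddCommGroup.ofCore core

noncomputable instance : NormedSpace ℂ (HolderSpace X γ) :=
  NormedSpace.ofCore core

end HolderSpace

/-- `S` is the inverse of `I - P(it)` in the algebra of bounded operators on `C^{0,γ}(X)`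
(in particular, `P(it)` acts as a bounded operator `T` on this space). -/
def IsResolvent {G X : Type*} [Group G] [TopologicalSpace G] [SecondCountableTopology G]
    [MeasurableSpace G] [BorelSpace G] [MetricSpace X] [CompactSpace X] [MulAction G X]
    [ContinuousSMul G X] (ρ : Measure G) [IsProbabilityMeasure ρ] (σ : Cocycle G X) (t : ℝ)
    {γ : ℝ≥0} (S : HolderSpace X γ →L[ℂ] HolderSpace X γ) : Prop :=
  ∃ T : HolderSpace X γ →L[ℂ] HolderSpace X γ,
    (∀ f, (T f).toC = perturbedOp ρ σ t f.toC) ∧ (1 - T) * S = 1 ∧ S * (1 - T) = 1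

/-- The operator-valued function `U` is analytic at each point of the imaginary axis, and
`U(z) = (I - P(z))⁻¹ - (m z)⁻¹ N₀` for each nonzero point `z = it` of this axis; this determines
`U` on the imaginary axis. -/
def IsRegularPart {G X : Type*} [Group G] [TopologicalSpace G] [SecondCountableTopology G]
    [MeasurableSpace G] [BorelSpace G] [MetricSpace X] [CompactSpace X] [MulAction G X]
    [ContinuousSMul G X] (ρ : Measure G) [IsProbabilityMeasure ρ] (σ : Cocycle G X) (m : ℝ)
    (N₀ : C(X, ℂ) →L[ℂ] C(X, ℂ)) {γ : ℝ≥0}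
    (U : ℂ → HolderSpace X γ →L[ℂ] HolderSpace X γ) : Prop :=
  AnalyticOnNhd ℂ U {z | z.re = 0} ∧
  ∀ t : ℝ, t ≠ 0 → ∃ S : HolderSpace X γ →L[ℂ] HolderSpace X γ, IsResolvent ρ σ t S ∧
    ∀ f, (U (Complex.I * t) f).toC = (S f).toC - ((m : ℂ) * (Complex.I * t))⁻¹ • N₀ f.toC

/-- The space `ℰ^{γ,k}(X × ℝ)`: functions `F ∈ C^k(ℝ, C(X, ℂ))`, with `F t x` the value at
`(x, t)`, whose `t`-derivatives of order at most `k` have finite norm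
`sup e^{γ|t|} |f(x,t)| + sup e^{γ|t|} |f(x,t) - f(x',t)| / d(x,x')^γ`, where the second supremum
is over pairs of points in the same fibre of `p : X → A`. -/
def MemE {X A : Type*} [MetricSpace X] [CompactSpace X] (p : X → A) (γ : ℝ) (k : ℕ)
    (F : ℝ → C(X, ℂ)) : Prop :=
  ContDiff ℝ k F ∧ ∀ m : ℕ, m ≤ k → ∃ C : ℝ,
    (∀ (t : ℝ) (x : X), Real.exp (γ * |t|) * ‖iteratedDeriv m F t x‖ ≤ C) ∧
    ∀ (t : ℝ) (x x' : X), p x = p x' →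
      Real.exp (γ * |t|) * ‖iteratedDeriv m F t x - iteratedDeriv m F t x'‖ ≤ C * dist x x' ^ γ

end Renewal

namespace Renewal

namespace HolderSpace

section General

variable {X : Type*} [MetricSpace X] {γ : ℝ≥0}

theorem ext_toC {f g : HolderSpace X γ} (h : f.toC = g.toC) : f = g := Subtype.ext h

@[simp] theorem toC_add (f g : HolderSpace X γ) : (f + g).toC = f.toC + g.toC := rfl
@[simp] theorem toC_sub (f g : HolderSpace X γ) : (f - g).toC = f.toC - g.toC := rfl
@[simp] theorem toC_neg (f : HolderSpace X γ) : (-f).toC = -f.toC := rfl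
@[simp] theorem toC_smul (c : ℂ) (f : HolderSpace X γ) : (c • f).toC = c • f.toC := rfl

theorem norm_sub_le_nnHolderNorm (f : HolderSpace X γ) (x y : X) :
    ‖f.toC x - f.toC y‖ ≤ nnHolderNorm γ f.toC * dist x y ^ (γ : ℝ) := by
  rw [← dist_eq_norm]
  exact f.memHolder.holderWith.dist_le x y

theorem holderWith_of_norm_sub_le {f : X → ℂ} {b : ℝ≥0}
    (h : ∀ x y, ‖f x - f y‖ ≤ b * dist x y ^ (γ : ℝ)) : HolderWith b γ f := by
  intro x y
  have := h x y
  rw [edist_dist, edist_dist, dist_eq_norm]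
  rw [ENNReal.ofReal_rpow_of_nonneg dist_nonneg γ.coe_nonneg, ← ENNReal.ofReal_coe_nnreal,
    ← ENNReal.ofReal_mul b.coe_nonneg]
  exact ENNReal.ofReal_le_ofReal this

theorem exists_toC_eq (f : C(X, ℂ)) (b : ℝ)
    (h : ∀ x y, ‖f x - f y‖ ≤ b * dist x y ^ (γ : ℝ)) :
    ∃ F : HolderSpace X γ, F.toC = f := by
  refine ⟨⟨f, HolderWith.memHolder (C := b.toNNReal) (holderWith_of_norm_sub_le fun x y => ?_)⟩, rfl⟩
  refine (h x y).trans ?_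
  gcongr
  exact Real.le_coe_toNNReal b

theorem nnHolderNorm_le (F : HolderSpace X γ) {b : ℝ} (hb : 0 ≤ b)
    (h : ∀ x y, ‖F.toC x - F.toC y‖ ≤ b * dist x y ^ (γ : ℝ)) :
    (nnHolderNorm γ F.toC : ℝ) ≤ b := by
  lift b to ℝ≥0 using hb
  exact NNReal.coe_le_coe.2 (holderWith_of_norm_sub_le h).nnholderNorm_le

end General

variable {X : Type*} [MetricSpace X] [CompactSpace X] {γ : ℝ≥0}

theorem nnHolderNorm_le_norm (f : HolderSpace X γ) : (nnHolderNorm γ f.toC : ℝ) ≤ ‖f‖ := by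
  rw [norm_def]
  linarith [norm_nonneg f.toC]

theorem norm_toC_le (f : HolderSpace X γ) : ‖f.toC‖ ≤ ‖f‖ := by
  rw [norm_def]
  linarith [(nnHolderNorm γ f.toC).coe_nonneg]

theorem norm_apply_le (f : HolderSpace X γ) (x : X) : ‖f.toC x‖ ≤ ‖f‖ :=
  (f.toC.norm_coe_le_norm x).trans f.norm_toC_le

theorem norm_sub_le_norm (f : HolderSpace X γ) (x y : X) :
    ‖f.toC x - f.toC y‖ ≤ ‖f‖ * dist x y ^ (γ : ℝ) :=
  (f.norm_sub_le_nnHolderNorm x y).trans (by gcongr; exact f.nnHolderNorm_le_norm)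

theorem norm_le_add {F : HolderSpace X γ} {a b : ℝ} (ha : 0 ≤ a) (hb : 0 ≤ b)
    (h1 : ∀ x, ‖F.toC x‖ ≤ a) (h2 : ∀ x y, ‖F.toC x - F.toC y‖ ≤ b * dist x y ^ (γ : ℝ)) :
    ‖F‖ ≤ a + b := by
  rw [norm_def]
  exact add_le_add ((ContinuousMap.norm_le _ ha).2 h1) (nnHolderNorm_le F hb h2)

/-- The inclusion of `C^{0,γ}(X)` in `C(X)`. -/
noncomputable def toCL : HolderSpace X γ →L[ℂ] C(X, ℂ) :=
  LinearMap.mkContinuous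
    { toFun := toC
      map_add' := fun _ _ => rfl
      map_smul' := fun _ _ => rfl } 1 (fun f => (norm_toC_le f).trans_eq (one_mul _).symm)

@[simp] theorem toCL_apply (f : HolderSpace X γ) : toCL f = f.toC := rfl

theorem toCL_injective : Function.Injective (toCL : HolderSpace X γ →L[ℂ] C(X, ℂ)) :=
  fun _ _ h => ext_toC h

/-- Closed balls of `C^{0,γ}(X)` are closed under uniform limits. -/
theorem exists_toC_eq_of_tendsto {ι : Type*} {l : Filter ι} [l.NeBot]
    {f : ι → HolderSpace X γ} {R : ℝ} (hf : ∀ i, ‖f i‖ ≤ R) {g : C(X, ℂ)}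
    (hg : Tendsto (fun i => (f i).toC) l (𝓝 g)) :
    ∃ F : HolderSpace X γ, F.toC = g := by
  refine exists_toC_eq g R fun x y => ?_
  have hx : ∀ x, Tendsto (fun i => (f i).toC x) l (𝓝 (g x)) := fun x =>
    ((continuous_eval_const x).tendsto g).comp hg
  refine le_of_tendsto ((hx x).sub (hx y)).norm (Eventually.of_forall fun i => ?_)
  refine ((f i).norm_sub_le_norm x y).trans ?_
  gcongr
  exact hf i

theorem norm_le_of_tendsto {ι : Type*} {l : Filter ι} [l.NeBot]
    {f : ι → HolderSpace X γ} {R : ℝ} (hf : ∀ᶠ i in l, ‖f i‖ ≤ R) {g : HolderSpace X γ}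
    (hg : Tendsto (fun i => (f i).toC) l (𝓝 g.toC)) : ‖g‖ ≤ 2 * R := by
  have hR : 0 ≤ R := by
    obtain ⟨i, hi⟩ := hf.exists
    exact (norm_nonneg _).trans hi
  have hx : ∀ x, Tendsto (fun i => (f i).toC x) l (𝓝 (g.toC x)) := fun x =>
    ((continuous_eval_const x).tendsto _).comp hg
  rw [two_mul]
  refine norm_le_add hR hR (fun x => ?_) fun x y => ?_
  · exact le_of_tendsto (hx x).norm (hf.mono fun i hi => ((f i).norm_apply_le x).trans hi)
  · refine le_of_tendsto ((hx x).sub (hx y)).norm (hf.mono fun i hi => ?_)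
    refine ((f i).norm_sub_le_norm x y).trans ?_
    gcongr

instance : CompleteSpace (HolderSpace X γ) := by
  refine Metric.complete_of_cauchySeq_tendsto fun u hu => ?_
  have hu' : CauchySeq fun i => (u i).toC :=
    (toCL : HolderSpace X γ →L[ℂ] C(X, ℂ)).uniformContinuous.comp_cauchySeq hu
  obtain ⟨g, hg⟩ := cauchySeq_tendsto_of_complete hu'
  obtain ⟨R, hR⟩ := hu.norm_bddAbove
  obtain ⟨F, rfl⟩ := exists_toC_eq_of_tendsto (fun i => hR ⟨i, rfl⟩) hg
  refine ⟨F, Metric.tendsto_atTop.2 fun ε hε => ?_⟩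
  obtain ⟨n₀, hn₀⟩ := Metric.cauchySeq_iff.1 hu (ε / 3) (by positivity)
  refine ⟨n₀, fun n hn => ?_⟩
  rw [dist_eq_norm]
  have h1 : ∀ᶠ k in atTop, ‖u n - u k‖ ≤ ε / 3 := by
    filter_upwards [eventually_ge_atTop n₀] with k hk
    rw [← dist_eq_norm]
    exact (hn₀ n hn k hk).le
  have := norm_le_of_tendsto (g := u n - F) h1 (hg.const_sub (u n).toC)
  linarith

/-- Bounded sequences of `C^{0,γ}(X)` have uniformly convergent subsequences. -/
theorem exists_subseq_tendsto (hγ : 0 < γ) {f : ℕ → HolderSpace X γ} {R : ℝ}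
    (hf : ∀ i, ‖f i‖ ≤ R) :
    ∃ (F : HolderSpace X γ) (φ : ℕ → ℕ), StrictMono φ ∧
      Tendsto (fun i => (f (φ i)).toC) atTop (𝓝 F.toC) := by
  let A : Set (BoundedContinuousFunction X ℂ) :=
    Set.range fun i => BoundedContinuousFunction.mkOfCompact (f i).toC
  have hA : IsCompact (closure A) := by
    refine BoundedContinuousFunction.arzela_ascoli (Metric.closedBall (0 : ℂ) R)
      (isCompact_closedBall _ _) A ?_ ?_
    · rintro _ x ⟨i, rfl⟩
      simpa using ((f i).norm_apply_le x).trans (hf i)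
    · have hR : 0 ≤ R := (norm_nonneg _).trans (hf 0)
      refine Metric.equicontinuous_of_continuity_modulus (fun s => R * s ^ (γ : ℝ)) ?_ _ ?_
      · have : Continuous fun s : ℝ => R * s ^ (γ : ℝ) :=
          continuous_const.mul (Real.continuous_rpow_const γ.coe_nonneg)
        have h := this.tendsto 0
        rwa [Real.zero_rpow (by exact_mod_cast hγ.ne'), mul_zero] at h
      · rintro x y ⟨_, i, rfl⟩
        have := (f i).norm_sub_le_norm x y
        rw [dist_eq_norm]
        refine this.trans ?_
        gcongr
        exact hf i
  obtain ⟨g, -, φ, hφ, hlim⟩ := hA.tendsto_subseq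
    (x := fun i => BoundedContinuousFunction.mkOfCompact (f i).toC)
    (fun i => subset_closure ⟨i, rfl⟩)
  have hlim' : Tendsto (fun i => (f (φ i)).toC) atTop (𝓝 g.toContinuousMap) :=
    ((ContinuousMap.isometryEquivBoundedOfCompact X ℂ).symm.continuous.tendsto g).comp hlim
  obtain ⟨F, hF⟩ := exists_toC_eq_of_tendsto (fun i => hf (φ i)) hlim'
  exact ⟨F, φ, hφ, hF ▸ hlim'⟩

theorem exists_toC_eq_of_dist (hγ : γ ≤ 1) (x₀ : X) :
    ∃ F : HolderSpace X γ, ∀ x, F.toC x = (dist x x₀ : ℝ) := by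
  have hc : Continuous fun x : X => ((dist x x₀ : ℝ) : ℂ) := by fun_prop
  have h : MemHolder 1 (fun x : X => ((dist x x₀ : ℝ) : ℂ)) := by
    refine HolderWith.memHolder (C := 1) (holderWith_of_norm_sub_le fun x y => ?_)
    rw [← Complex.ofReal_sub, Complex.norm_real, Real.norm_eq_abs]
    simpa using abs_dist_sub_le x y x₀
  exact ⟨⟨⟨_, hc⟩, h.of_le hγ⟩, fun x => rfl⟩

/-- A product of Hölder functions is Hölder. -/
theorem exists_toC_eq_mul (f g : HolderSpace X γ) : ∃ F : HolderSpace X γ, F.toC = f.toC * g.toC := by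
  refine exists_toC_eq _ (‖f‖ * ‖g‖ + ‖g‖ * ‖f‖) fun x y => ?_
  have : (f.toC * g.toC) x - (f.toC * g.toC) y =
    f.toC x * (g.toC x - g.toC y) + g.toC y * (f.toC x - f.toC y) := by
    simp only [ContinuousMap.mul_apply]; ring
  rw [this]
  refine (norm_add_le _ _).trans ?_
  rw [norm_mul, norm_mul, add_mul, mul_assoc, mul_assoc]
  gcongr
  exacts [f.norm_apply_le x, g.norm_sub_le_norm x y, g.norm_apply_le y, f.norm_sub_le_norm x y]

theorem exists_toC_eq_const (c : ℂ) : ∃ F : HolderSpace X γ, F.toC = ContinuousMap.const X c :=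
  exists_toC_eq _ 0 fun x y => by simp

theorem denseRange_toCL (hγ : γ ≤ 1) :
    DenseRange (toCL : HolderSpace X γ →L[ℂ] C(X, ℂ)) := by
  let S : StarSubalgebra ℂ C(X, ℂ) :=
    { carrier := Set.range (toCL : HolderSpace X γ →L[ℂ] C(X, ℂ))
      mul_mem' := by
        rintro _ _ ⟨f, rfl⟩ ⟨g, rfl⟩
        exact exists_toC_eq_mul f g
      add_mem' := by
        rintro _ _ ⟨f, rfl⟩ ⟨g, rfl⟩
        exact ⟨f + g, rfl⟩
      algebraMap_mem' := fun c => exists_toC_eq_const c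
      star_mem' := by
        rintro _ ⟨f, rfl⟩
        refine exists_toC_eq _ ‖f‖ fun x y => ?_
        simp only [ContinuousMap.star_apply, toCL_apply, ← star_sub, norm_star]
        exact f.norm_sub_le_norm x y }
  have hS : S.topologicalClosure = ⊤ := by
    refine ContinuousMap.starSubalgebra_topologicalClosure_eq_top_of_separatesPoints S ?_
    intro x y hxy
    obtain ⟨F, hF⟩ := exists_toC_eq_of_dist (γ := γ) hγ x
    refine ⟨F.toC, ⟨F.toC, ⟨F, rfl⟩, rfl⟩, ?_⟩
    rw [hF, hF]
    simpa [eq_comm] using hxy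
  intro f
  have : f ∈ S.topologicalClosure := by rw [hS]; trivial
  exact this

end HolderSpace

/-! ### Cesàro means and the mean ergodic theorem -/

section Cesaro

variable {E : Type*} [NormedAddCommGroup E] [NormedSpace ℂ E]

/-- The Cesàro means `(1 + P + ⋯ + P^{k-1}) / k`. -/
noncomputable def cesaro (P : E →L[ℂ] E) (k : ℕ) : E →L[ℂ] E :=
  (k : ℂ)⁻¹ • ∑ i ∈ Finset.range k, P ^ i

theorem cesaro_apply (P : E →L[ℂ] E) (k : ℕ) (f : E) :
    cesaro P k f = (k : ℂ)⁻¹ • ∑ i ∈ Finset.range k, (P ^ i) f := by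
  simp [cesaro]

theorem commute_cesaro {P Q : E →L[ℂ] E} (h : Commute Q P) (k : ℕ) : Commute Q (cesaro P k) :=
  (Commute.sum_right _ _ _ fun i _ => h.pow_right i).smul_right _

theorem one_sub_mul_cesaro (P : E →L[ℂ] E) (k : ℕ) :
    (1 - P) * cesaro P k = (k : ℂ)⁻¹ • (1 - P ^ k) := by
  rw [cesaro, mul_smul_comm, mul_neg_geom_sum]

theorem norm_cesaro_le {P : E →L[ℂ] E} {C : ℝ} (hC : ∀ i f, ‖(P ^ i) f‖ ≤ C * ‖f‖) (k : ℕ) (f : E) :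
    ‖cesaro P k f‖ ≤ C * ‖f‖ := by
  have h0 : 0 ≤ C * ‖f‖ := (norm_nonneg _).trans (hC 0 f)
  rw [cesaro_apply, norm_smul, norm_inv, Complex.norm_natCast]
  rcases Nat.eq_zero_or_pos k with rfl | hk
  · simpa using h0
  have hk' : (0 : ℝ) < k := by exact_mod_cast hk
  rw [inv_mul_le_iff₀ hk']
  refine (norm_sum_le _ _).trans ((Finset.sum_le_sum fun i _ => hC i f).trans ?_)
  simp

theorem exists_one_sub_cesaro_eq (P : E →L[ℂ] E) {k : ℕ} (hk : k ≠ 0) :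
    ∃ S : E →L[ℂ] E, 1 - cesaro P k = (1 - P) * S ∧ ∀ Q, Commute Q P → Commute Q S := by
  refine ⟨(k : ℂ)⁻¹ • ∑ i ∈ Finset.range k, ∑ l ∈ Finset.range i, P ^ l, ?_, fun Q hQ => ?_⟩
  · have hk' : (k : ℂ) ≠ 0 := by exact_mod_cast hk
    rw [mul_smul_comm, Finset.mul_sum]
    simp only [mul_neg_geom_sum]
    rw [Finset.sum_sub_distrib, smul_sub, cesaro]
    congr 1
    simp [← Nat.cast_smul_eq_nsmul ℂ, smul_smul, hk']
  · exact (Commute.sum_right _ _ _ fun i _ => Commute.sum_right _ _ _ fun l _ =>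
      hQ.pow_right l).smul_right _

theorem cesaro_apply_of_fixed {P : E →L[ℂ] E} {f : E} (hf : P f = f) {k : ℕ} (hk : k ≠ 0) :
    cesaro P k f = f := by
  have h : ∀ i, (P ^ i) f = f := fun i => by
    induction i with
    | zero => simp
    | succ i ih => rw [pow_succ, mul_apply_eq_comp, hf, ih]
  have hk' : (k : ℂ) ≠ 0 := by exact_mod_cast hk
  simp [cesaro_apply, h, ← Nat.cast_smul_eq_nsmul ℂ, smul_smul, hk']

theorem tendsto_one_sub_mul_cesaro {P : E →L[ℂ] E} {C : ℝ} (hC : ∀ i f, ‖(P ^ i) f‖ ≤ C * ‖f‖)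
    (f : E) : Tendsto (fun k => (1 - P) (cesaro P k f)) atTop (𝓝 0) := by
  have h : ∀ k : ℕ, ‖(1 - P) (cesaro P k f)‖ ≤ (k : ℝ)⁻¹ * (‖f‖ + C * ‖f‖) := fun k => by
    have := DFunLike.congr_fun (one_sub_mul_cesaro P k) f
    rw [mul_apply_eq_comp] at this
    rw [this, smul_apply, norm_smul, norm_inv, Complex.norm_natCast]
    gcongr
    refine (norm_sub_le _ _).trans ?_
    gcongr
    · rfl
    · exact hC k f
  refine squeeze_zero_norm h ?_
  simpa using tendsto_inv_atTop_nhds_zero_nat.mul_const (‖f‖ + C * ‖f‖)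

theorem tendsto_cesaro_of_mem_closure {P : E →L[ℂ] E} {C : ℝ}
    (hC : ∀ i f, ‖(P ^ i) f‖ ≤ C * ‖f‖) {f : E} (hf : f ∈ closure (Set.range (1 - P : E →L[ℂ] E))) :
    Tendsto (fun k => cesaro P k f) atTop (𝓝 0) := by
  rw [Metric.tendsto_atTop]
  intro ε hε
  have hC0 : 0 ≤ |C| := abs_nonneg C
  obtain ⟨_, ⟨g, rfl⟩, hg⟩ := Metric.mem_closure_iff.1 hf (ε / 2 / (|C| + 1)) (by positivity)
  obtain ⟨n, hn⟩ := Metric.tendsto_atTop.1 (tendsto_one_sub_mul_cesaro hC g) (ε / 2) (by positivity)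
  refine ⟨n, fun k hk => ?_⟩
  have h1 := hn k hk
  rw [dist_zero_right] at h1 ⊢
  have hcomm : cesaro P k ((1 - P) g) = (1 - P) (cesaro P k g) := by
    have := commute_cesaro (Q := 1 - P) ((Commute.one_left P).sub_left (Commute.refl P)) k
    exact (DFunLike.congr_fun this.eq g).symm
  have h2 : ‖cesaro P k (f - (1 - P) g)‖ ≤ ε / 2 := by
    refine (norm_cesaro_le hC k _).trans ?_
    rw [dist_eq_norm] at hg
    rw [lt_div_iff₀ (by positivity)] at hg
    nlinarith [le_abs_self C, norm_nonneg (f - (1 - P) g)]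
  have : cesaro P k f = cesaro P k (f - (1 - P) g) + (1 - P) (cesaro P k g) := by
    rw [map_sub, hcomm]; abel
  rw [this]
  exact (norm_add_le _ _).trans_lt (by linarith)

/-- `N` is the strong limit of the Cesàro means of `P`. -/
def IsErgodicLimit (P N : E →L[ℂ] E) : Prop :=
  ∀ f, Tendsto (fun k => cesaro P k f) atTop (𝓝 (N f))

namespace IsErgodicLimit

variable {P N : E →L[ℂ] E}

theorem apply_eq_self (h : IsErgodicLimit P N) {f : E} (hf : P f = f) : N f = f := by
  refine tendsto_nhds_unique (h f) (tendsto_const_nhds.congr' ?_)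
  filter_upwards [eventually_ne_atTop 0] with k hk
  rw [cesaro_apply_of_fixed hf hk]

theorem mul_left_eq (h : IsErgodicLimit P N) (hP : ∀ i f, ‖(P ^ i) f‖ ≤ 1 * ‖f‖) : P * N = N := by
  ext f
  have h1 : Tendsto (fun k => (1 - P) (cesaro P k f)) atTop (𝓝 ((1 - P) (N f))) :=
    ((1 - P).continuous.tendsto _).comp (h f)
  have h2 := tendsto_nhds_unique h1 (tendsto_one_sub_mul_cesaro hP f)
  exact (sub_eq_zero.1 h2).symm

theorem mul_right_eq (h : IsErgodicLimit P N) (hP : ∀ i f, ‖(P ^ i) f‖ ≤ 1 * ‖f‖) : N * P = N := by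
  ext f
  have h1 : Tendsto (fun k => cesaro P k ((1 - P) f)) atTop (𝓝 0) :=
    tendsto_cesaro_of_mem_closure hP (subset_closure ⟨f, rfl⟩)
  have h2 := tendsto_nhds_unique h1 (h ((1 - P) f))
  have h3 : N ((1 - P) f) = N f - N (P f) := by simp
  rw [h3] at h2
  exact (sub_eq_zero.1 h2.symm).symm

theorem mul_self (h : IsErgodicLimit P N) (hP : ∀ i f, ‖(P ^ i) f‖ ≤ 1 * ‖f‖) : N * N = N := by
  ext f
  exact h.apply_eq_self (DFunLike.congr_fun (h.mul_left_eq hP) f)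

theorem apply_eq_self_iff (h : IsErgodicLimit P N) (hP : ∀ i f, ‖(P ^ i) f‖ ≤ 1 * ‖f‖) {f : E} :
    f ∈ Set.range N ↔ P f = f := by
  refine ⟨?_, fun hf => ⟨f, h.apply_eq_self hf⟩⟩
  rintro ⟨g, rfl⟩
  exact DFunLike.congr_fun (h.mul_left_eq hP) g

/-- Closed subspaces that are stable under `P` are stable under the ergodic limit. -/
theorem mem_of_stable (h : IsErgodicLimit P N) (S : Submodule ℂ E) (hS : IsClosed (S : Set E))
    (hPS : ∀ f ∈ S, P f ∈ S) {f : E} (hf : f ∈ S) : N f ∈ S := by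
  refine hS.mem_of_tendsto (h f) (Eventually.of_forall fun k => ?_)
  have hi : ∀ i, (P ^ i) f ∈ S := fun i => by
    induction i with
    | zero => simpa
    | succ i ih =>
      rw [pow_succ']
      exact hPS _ ih
  rw [cesaro_apply]
  exact S.smul_mem _ (S.sum_mem fun i _ => hi i)

/-- Any projector onto the fixed space of `P` that commutes with `P` is the ergodic limit. -/
theorem eq_of_projector (h : IsErgodicLimit P N) (hP : ∀ i f, ‖(P ^ i) f‖ ≤ 1 * ‖f‖)
    {N' : E →L[ℂ] E} (h1 : N' * N' = N') (h2 : ∀ f, f ∈ Set.range N' ↔ P f = f)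
    (h3 : N' * P = P * N') : N' = N := by
  have hPN' : P * N' = N' := by
    ext f
    exact (h2 (N' f)).1 ⟨f, rfl⟩
  ext f
  have h4 : ∀ i, N' ((P ^ i) f) = N' f := fun i => by
    induction i with
    | zero => simp
    | succ i ih =>
      rw [pow_succ', mul_apply_eq_comp]
      have := DFunLike.congr_fun (h3.trans hPN') ((P ^ i) f)
      exact this.trans ih
  have h5 : ∀ k : ℕ, k ≠ 0 → N' (cesaro P k f) = N' f := fun k hk => by
    have hk' : (k : ℂ) ≠ 0 := by exact_mod_cast hk
    simp only [cesaro_apply, map_smul, map_sum, h4]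
    simp [← Nat.cast_smul_eq_nsmul ℂ, smul_smul, hk']
  have h6 : N' (N f) = N' f := by
    refine tendsto_nhds_unique ((N'.continuous.tendsto _).comp (h f))
      (tendsto_const_nhds.congr' ?_)
    filter_upwards [eventually_ne_atTop 0] with k hk
    exact (h5 k hk).symm
  obtain ⟨g, hg⟩ := (h2 (N f)).2 (DFunLike.congr_fun (h.mul_left_eq hP) f)
  have h7 : N' (N f) = N f := by
    rw [← hg]
    exact DFunLike.congr_fun h1 g
  exact h6.symm.trans h7

end IsErgodicLimit

end Cesaro

/-! ### Operators satisfying a Doeblin–Fortet inequality -/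

/-- `T` and `P` are compatible operators on `B` and on the larger space `E`, the inclusion `j` of
`B` in `E` is dense and compact, `P` is a contraction and a power of `T` satisfies a
Doeblin–Fortet inequality. -/
structure DoeblinFortet {B E : Type*} [NormedAddCommGroup B] [NormedSpace ℂ B]
    [NormedAddCommGroup E] [NormedSpace ℂ E] (j : B →L[ℂ] E) (T : B →L[ℂ] B) (P : E →L[ℂ] E) :
    Prop where
  inj : Function.Injective j
  dense : DenseRange j
  compact : ∀ (f : ℕ → B) (R : ℝ), (∀ i, ‖f i‖ ≤ R) → ∃ (F : B) (φ : ℕ → ℕ), StrictMono φ ∧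
    Tendsto (fun i => j (f (φ i))) atTop (𝓝 (j F))
  intertwine : ∀ f, j (T f) = P (j f)
  contraction : ∀ f, ‖P f‖ ≤ ‖f‖
  ineq : ∃ n₀ : ℕ, 1 ≤ n₀ ∧ ∃ r R : ℝ, 0 ≤ r ∧ r < 1 ∧ 0 ≤ R ∧
    ∀ f, ‖(T ^ n₀) f‖ ≤ r * ‖f‖ + R * ‖j f‖

namespace DoeblinFortet

variable {B E : Type*} [NormedAddCommGroup B] [NormedSpace ℂ B]
    [NormedAddCommGroup E] [NormedSpace ℂ E] {j : B →L[ℂ] E} {T : B →L[ℂ] B} {P : E →L[ℂ] E}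

theorem intertwine_pow (h : DoeblinFortet j T P) (i : ℕ) (f : B) :
    j ((T ^ i) f) = (P ^ i) (j f) := by
  induction i with
  | zero => simp
  | succ i ih =>
    rw [pow_succ', pow_succ', mul_apply_eq_comp, mul_apply_eq_comp,
      h.intertwine, ih]

theorem intertwine_cesaro (h : DoeblinFortet j T P) (k : ℕ) (f : B) :
    j (cesaro T k f) = cesaro P k (j f) := by
  simp only [cesaro_apply, map_smul, map_sum, h.intertwine_pow]

theorem contraction_pow (h : DoeblinFortet j T P) (i : ℕ) (f : E) : ‖(P ^ i) f‖ ≤ 1 * ‖f‖ := by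
  rw [one_mul]
  induction i with
  | zero => simp
  | succ i ih =>
    rw [pow_succ', mul_apply_eq_comp]
    exact (h.contraction _).trans ih

theorem exists_norm_pow_le (h : DoeblinFortet j T P) :
    ∃ C, ∀ i f, ‖(T ^ i) f‖ ≤ C * ‖f‖ := by
  obtain ⟨n₀, hn₀, r, R, hr0, hr1, hR, hT⟩ := h.ineq
  have hr' : 0 < 1 - r := by linarith
  have key : ∀ (q : ℕ) (g : B), ‖(T ^ (n₀ * q)) g‖ ≤ (1 + R * ‖j‖ / (1 - r)) * ‖g‖ := by
    intro q g
    induction q with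
    | zero =>
      have : 0 ≤ R * ‖j‖ / (1 - r) * ‖g‖ := by positivity
      simp only [mul_zero, pow_zero, one_apply_eq_self]
      linarith
    | succ q ih =>
      rw [mul_add, mul_one, add_comm, pow_add, mul_apply_eq_comp]
      refine (hT _).trans ?_
      have h1 : ‖j ((T ^ (n₀ * q)) g)‖ ≤ ‖j‖ * ‖g‖ := by
        rw [h.intertwine_pow]
        refine (h.contraction_pow _ _).trans ?_
        rw [one_mul]
        exact j.le_opNorm g
      have h2 : r * ((1 + R * ‖j‖ / (1 - r)) * ‖g‖) + R * (‖j‖ * ‖g‖) =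
          r * ‖g‖ + R * ‖j‖ / (1 - r) * ‖g‖ := by
        field_simp
        ring
      have h3 : r * ‖g‖ ≤ 1 * ‖g‖ := by gcongr
      calc r * ‖(T ^ (n₀ * q)) g‖ + R * ‖j ((T ^ (n₀ * q)) g)‖
          ≤ r * ((1 + R * ‖j‖ / (1 - r)) * ‖g‖) + R * (‖j‖ * ‖g‖) := by gcongr
        _ ≤ _ := by rw [h2]; linarith
  refine ⟨(1 + R * ‖j‖ / (1 - r)) * ∑ i ∈ Finset.range n₀, ‖T ^ i‖, fun i f => ?_⟩
  have hi : i = n₀ * (i / n₀) + i % n₀ := (Nat.div_add_mod i n₀).symm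
  rw [hi, pow_add, mul_apply_eq_comp, mul_assoc]
  refine (key _ _).trans ?_
  gcongr
  refine ((T ^ (i % n₀)).le_opNorm f).trans ?_
  gcongr
  exact Finset.single_le_sum (f := fun i => ‖T ^ i‖) (fun _ _ => norm_nonneg _)
    (Finset.mem_range.2 (Nat.mod_lt _ hn₀))

/-- If a bounded sequence is asymptotically fixed by `T` and tends to zero in `E`, then it tends
to zero in `B`. -/
theorem tendsto_zero (h : DoeblinFortet j T P) {u : ℕ → B}
    (h1 : Tendsto (fun k => (1 - T) (u k)) atTop (𝓝 0))
    (h2 : Tendsto (fun k => j (u k)) atTop (𝓝 0)) : Tendsto u atTop (𝓝 0) := by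
  obtain ⟨n₀, hn₀, r, R, hr0, hr1, hR, hT⟩ := h.ineq
  have hr' : 0 < 1 - r := by linarith
  have h3 : Tendsto (fun k => (∑ i ∈ Finset.range n₀, T ^ i) ((1 - T) (u k))) atTop (𝓝 0) := by
    have := ((∑ i ∈ Finset.range n₀, T ^ i).continuous.tendsto 0).comp h1
    rwa [map_zero] at this
  have h4 : ∀ k, ‖u k‖ ≤ (1 - r)⁻¹ *
      (R * ‖j (u k)‖ + ‖(∑ i ∈ Finset.range n₀, T ^ i) ((1 - T) (u k))‖) := by
    intro k
    rw [← div_eq_inv_mul, le_div_iff₀ hr']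
    have h5 : (∑ i ∈ Finset.range n₀, T ^ i) ((1 - T) (u k)) = u k - (T ^ n₀) (u k) := by
      rw [← mul_apply_eq_comp, geom_sum_mul_neg]
      simp
    rw [h5]
    have h6 := hT (u k)
    have h7 := norm_sub_norm_le (u k) ((T ^ n₀) (u k))
    linarith
  refine squeeze_zero_norm h4 ?_
  simpa using ((h2.norm.const_mul R).add h3.norm).const_mul (1 - r)⁻¹

theorem exists_tendsto_cesaro (h : DoeblinFortet j T P) (f : B) :
    ∃ F : B, Tendsto (fun k => cesaro P k (j f)) atTop (𝓝 (j F)) := by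
  obtain ⟨C, hC⟩ := h.exists_norm_pow_le
  obtain ⟨F, φ, hφ, hF⟩ := h.compact (fun k => cesaro T k f) _ fun k => norm_cesaro_le hC k f
  simp only [h.intertwine_cesaro] at hF
  refine ⟨F, ?_⟩
  have h1 : P (j F) = j F := by
    have h2 := (tendsto_one_sub_mul_cesaro h.contraction_pow (j f)).comp hφ.tendsto_atTop
    have h3 := ((1 - P).continuous.tendsto (j F)).comp hF
    exact (sub_eq_zero.1 (tendsto_nhds_unique h3 h2)).symm
  have h2 : j f - j F ∈ closure (Set.range (1 - P : E →L[ℂ] E)) := by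
    refine mem_closure_of_tendsto (hF.const_sub (j f)) ?_
    filter_upwards [hφ.tendsto_atTop.eventually (eventually_ne_atTop 0)] with k hk
    obtain ⟨S, hS, -⟩ := exists_one_sub_cesaro_eq P hk
    exact ⟨S (j f), (DFunLike.congr_fun hS (j f)).symm⟩
  have h3 := (tendsto_cesaro_of_mem_closure h.contraction_pow h2).add_const (j F)
  rw [zero_add] at h3
  refine h3.congr' ?_
  filter_upwards [eventually_ne_atTop 0] with k hk
  rw [map_sub, cesaro_apply_of_fixed h1 hk, sub_add_cancel]

variable [CompleteSpace E]

theorem exists_isErgodicLimit (h : DoeblinFortet j T P) : ∃ N : E →L[ℂ] E, IsErgodicLimit P N := by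
  have key : ∀ f, ∃ g, Tendsto (fun k => cesaro P k f) atTop (𝓝 g) := by
    intro f
    refine cauchySeq_tendsto_of_complete (Metric.cauchySeq_iff'.2 fun ε hε => ?_)
    obtain ⟨b, hb⟩ := h.dense.exists_dist_lt f (show 0 < ε / 3 by positivity)
    obtain ⟨F, hF⟩ := h.exists_tendsto_cesaro b
    obtain ⟨n, hn⟩ := Metric.cauchySeq_iff'.1 hF.cauchySeq (ε / 3) (by positivity)
    refine ⟨n, fun k hk => ?_⟩
    have h1 : ∀ k, dist (cesaro P k f) (cesaro P k (j b)) < ε / 3 := fun k => by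
      rw [dist_eq_norm, ← map_sub]
      refine (norm_cesaro_le h.contraction_pow k _).trans_lt ?_
      rwa [one_mul, ← dist_eq_norm]
    have h2 := h1 k
    have h3 := h1 n
    rw [dist_comm] at h3
    have h4 := hn k hk
    linarith [dist_triangle4 (cesaro P k f) (cesaro P k (j b)) (cesaro P n (j b)) (cesaro P n f)]
  choose g hg using key
  exact ⟨continuousLinearMapOfTendsto (fun k => cesaro P k) (f := g) (tendsto_pi_nhds.2 hg), hg⟩

variable [CompleteSpace B]

/-- The ergodic limit acts as a bounded operator `Q` on `B`, and `1 - T + Q` is invertible. -/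
theorem exists_projector (h : DoeblinFortet j T P) {N : E →L[ℂ] E} (hN : IsErgodicLimit P N) :
    ∃ Q : B →L[ℂ] B, (∀ f, j (Q f) = N (j f)) ∧ Q * Q = Q ∧ T * Q = Q ∧ Q * T = Q ∧
      IsUnit (1 - T + Q) := by
  have hN' : ∀ f, ∃ F, j F = N (j f) := fun f => by
    obtain ⟨F, hF⟩ := h.exists_tendsto_cesaro f
    exact ⟨F, tendsto_nhds_unique hF (hN (j f))⟩
  choose q hq using hN'
  let q' : B →ₗ[ℂ] B :=
    { toFun := q
      map_add' := fun f g => h.inj (by simp [hq])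
      map_smul' := fun c f => h.inj (by simp [hq]) }
  have hcl : ∀ (u : ℕ → B) (x y), Tendsto u atTop (𝓝 x) → Tendsto (q' ∘ u) atTop (𝓝 y) →
      y = q' x := by
    intro u x y hx hy
    refine h.inj ?_
    have h1 : Tendsto (fun n => j (q (u n))) atTop (𝓝 (j y)) := (j.continuous.tendsto y).comp hy
    have h2 : Tendsto (fun n => N (j (u n))) atTop (𝓝 (N (j x))) :=
      ((N.comp j).continuous.tendsto x).comp hx
    simp only [hq] at h1
    exact (tendsto_nhds_unique h1 h2).trans (hq x).symm
  let Q : B →L[ℂ] B := ContinuousLinearMap.ofSeqClosedGraph hcl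
  have hQ : ∀ f, j (Q f) = N (j f) := hq
  have hQQ : Q * Q = Q := by
    ext f
    refine h.inj ?_
    rw [mul_apply_eq_comp, hQ, hQ]
    exact DFunLike.congr_fun (hN.mul_self h.contraction_pow) (j f)
  have hTQ : T * Q = Q := by
    ext f
    refine h.inj ?_
    rw [mul_apply_eq_comp, h.intertwine, hQ]
    exact DFunLike.congr_fun (hN.mul_left_eq h.contraction_pow) (j f)
  have hQT : Q * T = Q := by
    ext f
    refine h.inj ?_
    rw [mul_apply_eq_comp, hQ, hQ, h.intertwine]
    exact DFunLike.congr_fun (hN.mul_right_eq h.contraction_pow) (j f)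
  refine ⟨Q, hQ, hQQ, hTQ, hQT, ?_⟩
  have hQL : Q * (1 - T + Q) = Q := by rw [mul_add, mul_sub, mul_one, hQT, hQQ, sub_self, zero_add]
  have hLQ : (1 - T + Q) * Q = Q := by rw [add_mul, sub_mul, one_mul, hTQ, hQQ, sub_self, zero_add]
  -- the operator is bounded below
  obtain ⟨K, hK⟩ : ∃ K : ℝ≥0, ∀ f, ‖f‖ ≤ K * ‖(1 - T + Q) f‖ := by
    by_contra! hcon
    have hcon' : ∀ n : ℕ, ∃ f : B, ‖f‖ = 1 ∧ ‖(1 - T + Q) f‖ ≤ ((n : ℝ) + 1)⁻¹ := by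
      intro n
      obtain ⟨f, hf⟩ := hcon (n + 1)
      have hf0 : 0 < ‖f‖ := lt_of_le_of_lt (by positivity) hf
      refine ⟨((‖f‖⁻¹ : ℝ) : ℂ) • f, ?_, ?_⟩
      · rw [norm_smul, Complex.norm_real, norm_inv, norm_norm, inv_mul_cancel₀ hf0.ne']
      · rw [map_smul, norm_smul, Complex.norm_real, norm_inv, norm_norm]
        rw [inv_mul_le_iff₀ hf0, ← div_eq_mul_inv, le_div_iff₀ (by positivity), mul_comm]
        exact hf.le
    choose f hf1 hf2 using hcon'
    have hL0 : Tendsto (fun n => (1 - T + Q) (f n)) atTop (𝓝 0) :=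
      squeeze_zero_norm hf2 (by simpa using tendsto_one_div_add_atTop_nhds_zero_nat (𝕜 := ℝ))
    have hQ0 : Tendsto (fun n => Q (f n)) atTop (𝓝 0) := by
      have := (Q.continuous.tendsto 0).comp hL0
      rw [map_zero] at this
      refine this.congr fun n => ?_
      exact DFunLike.congr_fun hQL (f n)
    have hT0 : Tendsto (fun n => (1 - T) (f n)) atTop (𝓝 0) := by
      have := hL0.sub hQ0
      rw [sub_zero] at this
      refine this.congr fun n => ?_
      simp
    obtain ⟨F, φ, hφ, hF⟩ := h.compact f 1 fun i => (hf1 i).le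
    have hF1 : P (j F) = j F := by
      have h1 := ((1 - P).continuous.tendsto (j F)).comp hF
      have h2 := ((j.continuous.tendsto 0).comp hT0).comp hφ.tendsto_atTop
      rw [map_zero] at h2
      have h3 : (1 - P) (j F) = 0 := by
        refine tendsto_nhds_unique h1 (h2.congr fun n => ?_)
        simp [h.intertwine]
      exact (sub_eq_zero.1 h3).symm
    have hF2 : N (j F) = 0 := by
      have h1 := (N.continuous.tendsto (j F)).comp hF
      have h2 := ((j.continuous.tendsto 0).comp hQ0).comp hφ.tendsto_atTop
      rw [map_zero] at h2
      refine tendsto_nhds_unique h1 (h2.congr fun n => ?_)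
      simp [hQ]
    have hF3 : j F = 0 := by rw [← hN.apply_eq_self hF1, hF2]
    rw [hF3] at hF
    have h5 := h.tendsto_zero (hT0.comp hφ.tendsto_atTop) hF
    have h6 := h5.norm
    simp only [hf1, norm_zero] at h6
    exact one_ne_zero (tendsto_nhds_unique tendsto_const_nhds h6)
  have hanti := (1 - T + Q).antilipschitz_of_bound hK
  obtain ⟨C, hC⟩ := h.exists_norm_pow_le
  have hclosed : IsClosed (Set.range (1 - T + Q : B →L[ℂ] B)) :=
    hanti.isClosed_range (1 - T + Q).uniformContinuous
  rw [ContinuousLinearMap.isUnit_iff_bijective]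
  refine ⟨hanti.injective, fun f => ?_⟩
  have hu : Tendsto (fun k => cesaro T k (f - Q f)) atTop (𝓝 0) := by
    refine h.tendsto_zero (tendsto_one_sub_mul_cesaro hC _) ?_
    simp only [h.intertwine_cesaro]
    have h1 : N (j (f - Q f)) = 0 := by
      rw [← hQ, map_sub, ← mul_apply_eq_comp, hQQ, sub_self, map_zero]
    have h2 := hN (j (f - Q f))
    rwa [h1] at h2
  have hv := (hu.const_sub (f - Q f)).const_add (Q f)
  rw [sub_zero, add_sub_cancel] at hv
  refine hclosed.mem_of_tendsto hv ?_
  filter_upwards [eventually_ne_atTop 0] with k hk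
  obtain ⟨S, hS1, hS2⟩ := exists_one_sub_cesaro_eq T hk
  refine ⟨Q f + S (f - Q f), ?_⟩
  have e1 : (1 - T + Q) (Q f) = Q f := DFunLike.congr_fun hLQ f
  have e2 : Q (S (f - Q f)) = 0 := by
    have := DFunLike.congr_fun (hS2 Q (hQT.trans hTQ.symm)).eq (f - Q f)
    rw [mul_apply_eq_comp, mul_apply_eq_comp] at this
    rw [this, map_sub, ← mul_apply_eq_comp Q Q, hQQ, sub_self, map_zero]
  have e3 : (1 - T) (S (f - Q f)) = f - Q f - cesaro T k (f - Q f) :=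
    (DFunLike.congr_fun hS1 (f - Q f)).symm
  rw [map_add, e1, add_apply, e2, add_zero, e3]

end DoeblinFortet

/-! ### Analytic functions with values in a Banach space -/

/-- A bounded function with values in a Banach space is analytic if its compositions with the
elements of a norming family of linear forms are holomorphic. -/
theorem analyticAt_of_norming {E : Type*} [NormedAddCommGroup E] [NormedSpace ℂ E]
    [CompleteSpace E] {Λ : Set (E →L[ℂ] ℂ)} (hΛ : ∀ l ∈ Λ, ∀ a, ‖l a‖ ≤ ‖a‖) {K : ℝ}
    (hK : ∀ (a : E) (c : ℝ), 0 ≤ c → (∀ l ∈ Λ, ‖l a‖ ≤ c) → ‖a‖ ≤ K * c)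
    {F : ℂ → E} {z₀ : ℂ} {R C : ℝ} (hR : 0 < R) (hF : ∀ z ∈ Metric.ball z₀ R, ‖F z‖ ≤ C)
    (hd : ∀ l ∈ Λ, DifferentiableOn ℂ (fun z => l (F z)) (Metric.ball z₀ R)) :
    AnalyticAt ℂ F z₀ := by
  have hC : 0 ≤ C := (norm_nonneg _).trans (hF z₀ (Metric.mem_ball_self hR))
  have hsub : ∀ w ∈ Metric.ball z₀ (R / 2), Metric.closedBall w (R / 4) ⊆ Metric.ball z₀ R := by
    intro w hw z hz
    rw [Metric.mem_ball] at hw ⊢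
    rw [Metric.mem_closedBall] at hz
    linarith [dist_triangle z w z₀]
  have hlip : ∀ l ∈ Λ, ∀ w ∈ Metric.ball z₀ (R / 2), ∀ w' ∈ Metric.ball z₀ (R / 2),
      ‖l (F w') - l (F w)‖ ≤ C / (R / 4) * ‖w' - w‖ := by
    intro l hl w hw w' hw'
    refine (convex_ball z₀ (R / 2)).norm_image_sub_le_of_norm_deriv_le
      (f := fun z => l (F z)) (fun z hz => ?_) (fun z hz => ?_) hw hw'
    · exact (hd l hl).differentiableAt (Metric.isOpen_ball.mem_nhds
        (Metric.ball_subset_ball (by linarith) hz))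
    · refine Complex.norm_deriv_le_of_forall_mem_sphere_norm_le (by positivity) ?_ fun v hv => ?_
      · refine DifferentiableOn.diffContOnCl ((hd l hl).mono ?_)
        rw [closure_ball _ (by positivity)]
        exact hsub z hz
      · exact (hΛ l hl _).trans (hF v (hsub z hz (Metric.sphere_subset_closedBall hv)))
  have hcont : ContinuousOn F (Metric.ball z₀ (R / 2)) := by
    refine LipschitzOnWith.continuousOn (K := (K * (C / (R / 4))).toNNReal) ?_
    refine LipschitzOnWith.of_dist_le_mul fun w hw w' hw' => ?_
    rw [dist_eq_norm, dist_eq_norm]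
    refine (hK (F w - F w') (C / (R / 4) * ‖w - w'‖) (by positivity) fun l hl => ?_).trans ?_
    · rw [map_sub]
      exact hlip l hl w' hw' w hw
    · rw [← mul_assoc]
      gcongr
      exact Real.le_coe_toNNReal _
  have hρ : 0 < (R / 4).toNNReal := by simpa using hR
  have hρ' : ((R / 4).toNNReal : ℝ) = R / 4 := Real.coe_toNNReal _ (by positivity)
  have hsub' : Metric.closedBall z₀ (R / 4) ⊆ Metric.ball z₀ (R / 2) :=
    Metric.closedBall_subset_ball (by linarith)
  have hci : CircleIntegrable F z₀ ((R / 4).toNNReal : ℝ) := by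
    refine ContinuousOn.circleIntegrable (by rw [hρ']; positivity) (hcont.mono ?_)
    rw [hρ']
    exact Metric.sphere_subset_closedBall.trans hsub'
  have hps := hasFPowerSeriesOn_cauchy_integral hci hρ
  refine hps.analyticAt.congr ?_
  filter_upwards [Metric.ball_mem_nhds z₀ (show 0 < R / 4 by positivity)] with w hw
  rw [hρ']
  rw [hρ'] at hci
  have hsep : ∀ a : E, (∀ l ∈ Λ, l a = 0) → a = 0 := fun a ha => by
    have := hK a 0 le_rfl fun l hl => by rw [ha l hl, norm_zero]
    rw [mul_zero] at this
    exact norm_le_zero_iff.1 this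
  rw [← sub_eq_zero]
  refine hsep _ fun l hl => ?_
  have hw0 : ∀ z ∈ Metric.sphere z₀ (R / 4), z - w ≠ 0 := by
    rintro z hz h
    rw [sub_eq_zero.1 h] at hz
    rw [Metric.mem_sphere] at hz
    rw [Metric.mem_ball] at hw
    exact hw.ne hz
  have hci' : CircleIntegrable (fun z => (z - w)⁻¹ • F z) z₀ (R / 4) := by
    refine ContinuousOn.circleIntegrable (by positivity) (ContinuousOn.smul ?_
      (hcont.mono (Metric.sphere_subset_closedBall.trans hsub')))
    exact ContinuousOn.inv₀ (by fun_prop) hw0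
  have h1 : l (∮ z in C(z₀, R / 4), (z - w)⁻¹ • F z) =
      ∮ z in C(z₀, R / 4), (z - w)⁻¹ • l (F z) := by
    simp only [circleIntegral]
    rw [← l.intervalIntegral_comp_comm]
    · simp
    · exact hci'.out
  have h2 := DiffContOnCl.two_pi_i_inv_smul_circleIntegral_sub_inv_smul
    (f := fun z => l (F z)) (c := z₀) (R := R / 4) (w := w)
    (DifferentiableOn.diffContOnCl ((hd l hl).mono (by
      rw [closure_ball _ (by positivity)]
      exact hsub'.trans (Metric.ball_subset_ball (by linarith))))) hw
  rw [map_sub, map_smul, h1, h2, sub_self]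

theorem analyticAt_dslope_self {E : Type*} [NormedAddCommGroup E] [NormedSpace ℂ E] {f : ℂ → E}
    {z₀ : ℂ} (hf : AnalyticAt ℂ f z₀) : AnalyticAt ℂ (dslope f z₀) z₀ := by
  obtain ⟨p, hp⟩ := hf
  exact ⟨_, hp.has_fpower_series_dslope_fslope⟩

/-- The inverse of an analytic family `D` with `D 0 = 1 - T`, where `Q` is the spectral projector
of `T` on its fixed space and the first order perturbation acts as the scalar `m` on this space, has
a simple pole with residue `m⁻¹ Q`. -/
theorem exists_regular_part {A : Type*} [NormedRing A] [NormedAlgebra ℂ A] [CompleteSpace A]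
    {D : ℂ → A} (hD : AnalyticAt ℂ D 0) {Q D' T : A} (hD' : HasDerivAt D D' 0)
    (h0 : D 0 = 1 - T) (hQQ : Q * Q = Q) (hTQ : T * Q = Q) (hQT : Q * T = Q)
    (hunit : IsUnit (1 - T + Q)) {m : ℂ} (hm : m ≠ 0) (hQD : Q * D' * Q = m • Q) :
    ∃ V : ℂ → A, AnalyticAt ℂ V 0 ∧
      ∀ᶠ z in 𝓝[≠] 0, V z = Ring.inverse (D z) - (m * z)⁻¹ • Q := by
  have hDQ : AnalyticAt ℂ (fun z => D z * Q) 0 := hD.mul analyticAt_const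
  set M : ℂ → A := fun z => D z * (1 - Q) + dslope (fun z => D z * Q) 0 z with hM
  have hMan : AnalyticAt ℂ M 0 := (hD.mul analyticAt_const).add (analyticAt_dslope_self hDQ)
  have hM0 : M 0 = (1 - T) + D' * Q := by
    have h1 : deriv (fun z => D z * Q) 0 = D' * Q := (hD'.mul_const Q).deriv
    simp only [hM, dslope_same, h1, h0, mul_sub, sub_mul, mul_one, one_mul, hTQ, sub_self, sub_zero]
  have hQL : Q * (1 - T + Q) = Q := by rw [mul_add, mul_sub, mul_one, hQT, hQQ, sub_self, zero_add]
  obtain ⟨L, hL⟩ := hunit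
  have hQZ : Q * (↑L⁻¹ : A) = Q := by
    rw [Units.mul_inv_eq_iff_eq_mul, hL, hQL]
  set W : A := ↑L⁻¹ * (D' - 1) with hW
  have hQWQ : Q * W * Q = (m - 1) • Q := by
    rw [hW, ← mul_assoc, hQZ, mul_sub, mul_one, sub_mul, hQD, hQQ, sub_smul, one_smul]
  have hfac : M 0 = (L : A) * (1 + W * Q) := by
    rw [hM0, mul_add, mul_one, hW, ← mul_assoc, ← mul_assoc, Units.mul_inv, one_mul, hL, sub_mul,
      one_mul]
    abel
  have hWQWQ : W * Q * (W * Q) = (m - 1) • (W * Q) := by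
    rw [mul_assoc, ← mul_assoc Q, hQWQ, mul_smul_comm]
  have hm' : (1 : ℂ) - m⁻¹ - m⁻¹ * (m - 1) = 0 := by field_simp; ring
  have hcancel : W * Q - m⁻¹ • (W * Q) - m⁻¹ • (m - 1) • (W * Q) = 0 := by
    have : ((1 : ℂ) - m⁻¹ - m⁻¹ * (m - 1)) • (W * Q) = 0 := by rw [hm', zero_smul]
    rwa [sub_smul, sub_smul, one_smul, mul_smul] at this
  have hU1 : IsUnit (1 + W * Q) := by
    refine ⟨⟨1 + W * Q, 1 - m⁻¹ • (W * Q), ?_, ?_⟩, rfl⟩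
    · rw [mul_sub, mul_one, mul_smul_comm, add_mul, one_mul, hWQWQ, smul_add]
      have := hcancel
      calc _ = 1 + (W * Q - m⁻¹ • (W * Q) - m⁻¹ • (m - 1) • (W * Q)) := by abel
        _ = 1 := by rw [this, add_zero]
    · rw [sub_mul, one_mul, smul_mul_assoc, mul_add, mul_one, hWQWQ, smul_add]
      have := hcancel
      calc _ = 1 + (W * Q - m⁻¹ • (W * Q) - m⁻¹ • (m - 1) • (W * Q)) := by abel
        _ = 1 := by rw [this, add_zero]
  have hUM : IsUnit (M 0) := hfac ▸ L.isUnit.mul hU1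
  obtain ⟨M₀, hM₀⟩ := hUM
  have hinv : AnalyticAt ℂ (fun z => Ring.inverse (M z)) 0 := by
    have h1 : AnalyticAt ℂ (Ring.inverse : A → A) (M 0) := hM₀ ▸ analyticAt_inverse M₀
    exact h1.comp hMan
  have hQM0 : Q * Ring.inverse (M 0) = m⁻¹ • Q := by
    rw [← hM₀, Ring.inverse_unit, Units.mul_inv_eq_iff_eq_mul, hM₀, hM0, smul_mul_assoc, mul_add,
      mul_sub, mul_one, hQT, sub_self, zero_add, ← mul_assoc, hQD, smul_smul, inv_mul_cancel₀ hm,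
      one_smul]
  refine ⟨fun z => (1 - Q) * Ring.inverse (M z) + dslope (fun z => Q * Ring.inverse (M z)) 0 z,
    (analyticAt_const.mul hinv).add (analyticAt_dslope_self (analyticAt_const.mul hinv)), ?_⟩
  have hnear : ∀ᶠ z in 𝓝[≠] (0 : ℂ), IsUnit (M z) :=
    (hMan.continuousAt.eventually (Units.isOpen.mem_nhds ⟨M₀, hM₀⟩)).filter_mono
      nhdsWithin_le_nhds
  filter_upwards [hnear, self_mem_nhdsWithin] with z hz hz0
  have hz0 : z ≠ 0 := hz0
  have hMz : M z = D z * ((1 - Q) + z⁻¹ • Q) := by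
    simp only [hM]
    rw [dslope_of_ne _ hz0, slope_def_module, h0, sub_mul 1 T Q, one_mul, hTQ, sub_self, sub_zero,
      sub_zero, mul_add, mul_smul_comm]
  have hJ : ∀ a b : ℂ, a * b = 1 → ((1 - Q) + a • Q) * ((1 - Q) + b • Q) = 1 := by
    intro a b hab
    have e1 : (1 - Q) * (1 - Q) = 1 - Q := by
      rw [mul_sub, mul_one, sub_mul, one_mul, hQQ, sub_self, sub_zero]
    have e2 : (1 - Q) * Q = 0 := by rw [sub_mul, one_mul, hQQ, sub_self]
    have e3 : Q * (1 - Q) = 0 := by rw [mul_sub, mul_one, hQQ, sub_self]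
    rw [add_mul, mul_add, mul_add, e1, mul_smul_comm, e2, smul_mul_assoc, e3, smul_mul_smul_comm,
      hQQ, hab, smul_zero, smul_zero, one_smul, add_zero, zero_add, sub_add_cancel]
  have hJ1 := hJ _ _ (inv_mul_cancel₀ hz0)
  have hJ2 := hJ _ _ (mul_inv_cancel₀ hz0)
  obtain ⟨u, hu⟩ := hz
  let J : Aˣ := ⟨(1 - Q) + z⁻¹ • Q, (1 - Q) + z • Q, hJ1, hJ2⟩
  have hDz : D z = ((u * J⁻¹ : Aˣ) : A) := by
    rw [Units.val_mul, Units.eq_mul_inv_iff_mul_eq, hu, hMz]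
  rw [hDz, Ring.inverse_unit, mul_inv_rev, inv_inv, Units.val_mul, dslope_of_ne _ hz0,
    slope_def_module, hQM0, ← hu, Ring.inverse_unit]
  change _ = ((1 - Q) + z⁻¹ • Q) * _ - _
  rw [sub_zero, smul_sub, smul_smul, mul_inv_rev, add_mul, smul_mul_assoc]
  abel

/-! ### The operators `P(z)` near the imaginary axis -/

theorem norm_cexp_sub_cexp_le {z : ℂ} {s u v E γ : ℝ} (hz : |z.re| ≤ s) (hγ0 : 0 < γ) (hγ1 : γ ≤ 1)
    (hu : Real.exp (s * |u|) ≤ E) (hv : Real.exp (s * |v|) ≤ E) :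
    ‖Complex.exp (-(z * u)) - Complex.exp (-(z * v))‖ ≤ 2 * E * (1 + ‖z‖) * |u - v| ^ γ := by
  have hs : 0 ≤ s := (abs_nonneg _).trans hz
  have hE : 0 ≤ E := (Real.exp_pos _).le.trans hu
  have hexp : ∀ w : ℝ, ‖Complex.exp (-(z * w))‖ ≤ Real.exp (s * |w|) := fun w => by
    rw [Complex.norm_exp]
    refine Real.exp_le_exp.2 ?_
    simp only [Complex.neg_re, Complex.mul_re, Complex.ofReal_re, Complex.ofReal_im, mul_zero,
      sub_zero]
    refine (neg_le_abs _).trans ?_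
    rw [abs_mul]
    gcongr
  rcases le_or_gt 1 |u - v| with h | h
  · have h1 : 1 ≤ |u - v| ^ γ := Real.one_le_rpow h hγ0.le
    have h2 : 1 ≤ (1 + ‖z‖) * |u - v| ^ γ := by nlinarith [norm_nonneg z]
    calc _ ≤ ‖Complex.exp (-(z * u))‖ + ‖Complex.exp (-(z * v))‖ := norm_sub_le _ _
      _ ≤ 2 * E := by linarith [hexp u, hexp v]
      _ ≤ 2 * E * ((1 + ‖z‖) * |u - v| ^ γ) := le_mul_of_one_le_right (by positivity) h2
      _ = _ := by ring
  · have hder : ∀ w ∈ Set.uIcc v u, HasDerivWithinAt (fun w : ℝ => Complex.exp (-(z * w)))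
        (Complex.exp (-(z * w)) * -z) (Set.uIcc v u) w := by
      intro w _
      have : HasDerivAt (fun w : ℝ => -(z * (w : ℂ))) (-z) w := by
        have := ((Complex.ofRealCLM.hasDerivAt (x := w)).const_mul (-z))
        simpa only [Complex.ofRealCLM_apply, Complex.ofReal_one, mul_one, neg_mul] using this
      exact this.cexp.hasDerivWithinAt
    have hb : ∀ w ∈ Set.uIcc v u, ‖Complex.exp (-(z * w)) * -z‖ ≤ E * ‖z‖ := by
      intro w hw
      rw [norm_mul, norm_neg]
      gcongr
      refine (hexp w).trans ?_
      have : |w| ≤ max |v| |u| := by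
        rw [Set.mem_uIcc] at hw
        rcases hw with hw | hw
        · exact abs_le_max_abs_abs hw.1 hw.2
        · rw [max_comm]; exact abs_le_max_abs_abs hw.1 hw.2
      rcases le_total |v| |u| with h' | h'
      · rw [max_eq_right h'] at this
        exact (Real.exp_le_exp.2 (by gcongr)).trans hu
      · rw [max_eq_left h'] at this
        exact (Real.exp_le_exp.2 (by gcongr)).trans hv
    have h1 := (convex_uIcc v u).norm_image_sub_le_of_norm_hasDerivWithin_le hder hb
      Set.left_mem_uIcc Set.right_mem_uIcc
    refine h1.trans ?_
    rw [Real.norm_eq_abs]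
    have h2 : |u - v| ≤ |u - v| ^ γ := by
      rcases (abs_nonneg (u - v)).eq_or_lt with h0 | h0
      · rw [← h0]; positivity
      · simpa using Real.rpow_le_rpow_of_exponent_ge h0 h.le hγ1
    calc E * ‖z‖ * |u - v| ≤ E * ‖z‖ * |u - v| ^ γ := by gcongr
      _ ≤ 2 * E * (1 + ‖z‖) * |u - v| ^ γ := by
        gcongr
        · linarith
        · linarith

/-- Moment and regularity estimates for the walk and the cocycle; `n` is a weight that dominates
the Lipschitz constants. -/
structure WalkBounds {G X A : Type*} [Group G] [TopologicalSpace G] [MeasurableSpace G]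
    [MetricSpace X] [MulAction G X] (ρ : Measure G) (σ : Cocycle G X) (q : X → A) (γ : ℝ≥0)
    (s D : ℝ) (n : G → ℝ) : Prop where
  γ_pos : 0 < γ
  γ_le : γ ≤ 1
  s_pos : 0 < s
  D_one : 1 ≤ D
  n_meas : Measurable n
  n_one : ∀ g, 1 ≤ n g
  moment : Integrable (fun g => n g ^ 4) ρ
  exp_le : ∀ g x, Real.exp (s * |σ.toFun g x|) ≤ D * n g
  dist_le : ∀ g (x y : X), dist (g • x) (g • y) ^ (γ : ℝ) ≤ D * n g * dist x y ^ (γ : ℝ)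
  sub_le : ∀ g x y, q x = q y →
    |σ.toFun g x - σ.toFun g y| ^ (γ : ℝ) ≤ D * n g * dist x y ^ (γ : ℝ)
  sep : ∃ δ : ℝ, 0 < δ ∧ ∀ x y, q x ≠ q y → δ ≤ dist x y ^ (γ : ℝ)

/-- The function `P(z) f (x) = ∫ exp(-z σ(g, x)) f(g x) dρ(g)`. -/
noncomputable def twisted {G X : Type*} [Group G] [TopologicalSpace G] [MeasurableSpace G]
    [TopologicalSpace X] [MulAction G X] (ρ : Measure G) (σ : Cocycle G X) (z : ℂ)
    (f : X → ℂ) (x : X) : ℂ :=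
  ∫ g, Complex.exp (-(z * σ.toFun g x)) * f (g • x) ∂ρ

namespace WalkBounds

variable {G X A : Type*} [Group G] [TopologicalSpace G] [SecondCountableTopology G]
  [MeasurableSpace G] [BorelSpace G] [MetricSpace X] [CompactSpace X] [MulAction G X]
  [ContinuousSMul G X] {ρ : Measure G} {σ : Cocycle G X} {q : X → A} {γ : ℝ≥0} {s D : ℝ} {n : G → ℝ}

theorem n_le_pow_four (h : WalkBounds ρ σ q γ s D n) (g : G) : n g ≤ n g ^ 4 :=
  le_self_pow₀ (h.n_one g) (by norm_num)

theorem sq_le_pow_four (h : WalkBounds ρ σ q γ s D n) (g : G) : n g ^ 2 ≤ n g ^ 4 :=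
  pow_le_pow_right₀ (h.n_one g) (by norm_num)

theorem D_pos (h : WalkBounds ρ σ q γ s D n) : 0 < D := one_pos.trans_le h.D_one

theorem n_pos (h : WalkBounds ρ σ q γ s D n) (g : G) : 0 < n g := one_pos.trans_le (h.n_one g)

theorem norm_cexp_le (h : WalkBounds ρ σ q γ s D n) {z : ℂ} (hz : |z.re| ≤ s) (g : G) (x : X) :
    ‖Complex.exp (-(z * σ.toFun g x))‖ ≤ D * n g := by
  rw [Complex.norm_exp]
  refine (Real.exp_le_exp.2 ?_).trans (h.exp_le g x)
  simp only [Complex.neg_re, Complex.mul_re, Complex.ofReal_re, Complex.ofReal_im, mul_zero,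
    sub_zero]
  refine (neg_le_abs _).trans ?_
  rw [abs_mul]
  gcongr

theorem continuous_cocycle_mul (σ : Cocycle G X) (z : ℂ) {f : X → ℂ} (hf : Continuous f) :
    Continuous fun q : G × X => Complex.exp (-(z * σ.toFun q.1 q.2)) * f (q.1 • q.2) := by
  have h := σ.continuous_toFun
  have h' : Continuous fun q : G × X => q.1 • q.2 := continuous_smul
  fun_prop

theorem norm_integrand_le (h : WalkBounds ρ σ q γ s D n) {z : ℂ} (hz : |z.re| ≤ s) (f : C(X, ℂ))
    (g : G) (x : X) :
    ‖Complex.exp (-(z * σ.toFun g x)) * f (g • x)‖ ≤ D * ‖f‖ * n g ^ 4 := by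
  rw [norm_mul]
  have h1 := h.D_pos
  have h2 := h.n_pos g
  calc _ ≤ D * n g * ‖f‖ := by
        gcongr
        exacts [h.norm_cexp_le hz g x, f.norm_coe_le_norm _]
    _ ≤ D * n g ^ 4 * ‖f‖ := by gcongr; exact h.n_le_pow_four g
    _ = _ := by ring

theorem integrable_integrand (h : WalkBounds ρ σ q γ s D n) {z : ℂ} (hz : |z.re| ≤ s)
    (f : C(X, ℂ)) (x : X) :
    Integrable (fun g => Complex.exp (-(z * σ.toFun g x)) * f (g • x)) ρ :=
  (h.moment.const_mul (D * ‖f‖)).mono'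
    ((continuous_cocycle_mul σ z f.continuous).comp (Continuous.prodMk_left x)).aestronglyMeasurable
    (Eventually.of_forall fun g => h.norm_integrand_le hz f g x)

theorem norm_twisted_le (h : WalkBounds ρ σ q γ s D n) {z : ℂ} (hz : |z.re| ≤ s)
    (f : C(X, ℂ)) (x : X) : ‖twisted ρ σ z f x‖ ≤ D * (∫ g, n g ^ 4 ∂ρ) * ‖f‖ := by
  refine (norm_integral_le_of_norm_le (h.moment.const_mul (D * ‖f‖))
    (Eventually.of_forall fun g => h.norm_integrand_le hz f g x)).trans ?_
  rw [integral_const_mul]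
  exact le_of_eq (by ring)

theorem continuous_twisted (h : WalkBounds ρ σ q γ s D n) {z : ℂ} (hz : |z.re| ≤ s)
    (f : C(X, ℂ)) : Continuous (twisted ρ σ z f) :=
  continuous_of_dominated
    (fun x => (h.integrable_integrand hz f x).aestronglyMeasurable)
    (fun x => Eventually.of_forall fun g => h.norm_integrand_le hz f g x)
    (h.moment.const_mul (D * ‖f‖))
    (Eventually.of_forall fun g =>
      (continuous_cocycle_mul σ z f.continuous).comp (Continuous.prodMk_right g))

theorem integral_nonneg (h : WalkBounds ρ σ q γ s D n) : 0 ≤ ∫ g, n g ^ 4 ∂ρ :=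
  MeasureTheory.integral_nonneg fun g => by have := h.n_pos g; positivity

theorem norm_twisted_sub_le_of_eq (h : WalkBounds ρ σ q γ s D n) {z : ℂ} (hz : |z.re| ≤ s)
    (f : HolderSpace X γ) {x y : X} (hxy : q x = q y) :
    ‖twisted ρ σ z f.toC x - twisted ρ σ z f.toC y‖ ≤
      3 * D ^ 2 * (∫ g, n g ^ 4 ∂ρ) * (1 + ‖z‖) * ‖f‖ * dist x y ^ (γ : ℝ) := by
  have hγ : (0 : ℝ) < γ := h.γ_pos
  rw [twisted, twisted, ← integral_sub (h.integrable_integrand hz f.toC x)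
    (h.integrable_integrand hz f.toC y)]
  have key : ∀ g, ‖Complex.exp (-(z * σ.toFun g x)) * f.toC (g • x) -
      Complex.exp (-(z * σ.toFun g y)) * f.toC (g • y)‖ ≤
      3 * D ^ 2 * (1 + ‖z‖) * ‖f‖ * dist x y ^ (γ : ℝ) * n g ^ 4 := by
    intro g
    have h1 := h.D_pos
    have h2 := h.n_pos g
    have h3 := norm_cexp_sub_cexp_le hz hγ (by exact_mod_cast h.γ_le) (h.exp_le g x) (h.exp_le g y)
    have h4 := h.sub_le g x y hxy
    have h5 : Complex.exp (-(z * σ.toFun g x)) * f.toC (g • x) -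
        Complex.exp (-(z * σ.toFun g y)) * f.toC (g • y) =
        (Complex.exp (-(z * σ.toFun g x)) - Complex.exp (-(z * σ.toFun g y))) * f.toC (g • x) +
        Complex.exp (-(z * σ.toFun g y)) * (f.toC (g • x) - f.toC (g • y)) := by ring
    have h6 := (f.norm_sub_le_norm (g • x) (g • y)).trans
      (mul_le_mul_of_nonneg_left (h.dist_le g x y) (norm_nonneg f))
    have h7 : 0 ≤ dist x y ^ (γ : ℝ) := Real.rpow_nonneg dist_nonneg _
    rw [h5]
    refine (norm_add_le _ _).trans ?_
    rw [norm_mul, norm_mul]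
    calc _ ≤ (2 * (D * n g) * (1 + ‖z‖) * (D * n g * dist x y ^ (γ : ℝ))) * ‖f‖ +
          D * n g * (‖f‖ * (D * n g * dist x y ^ (γ : ℝ))) := by
          gcongr
          · exact h3.trans (by gcongr)
          · exact f.norm_apply_le _
          · exact h.norm_cexp_le hz g y
      _ = (2 * (1 + ‖z‖) + 1) * (D ^ 2 * ‖f‖ * dist x y ^ (γ : ℝ)) * n g ^ 2 := by ring
      _ ≤ (3 * (1 + ‖z‖)) * (D ^ 2 * ‖f‖ * dist x y ^ (γ : ℝ)) * n g ^ 4 := by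
          gcongr ?_ * _ * ?_
          · linarith [norm_nonneg z]
          · exact h.sq_le_pow_four g
      _ = _ := by ring
  refine (norm_integral_le_of_norm_le (h.moment.const_mul _) (Eventually.of_forall key)).trans ?_
  rw [integral_const_mul]
  exact le_of_eq (by ring)

/-- Hölder estimates on the fibres of `q` extend to `X`. -/
theorem norm_sub_le_of_fibre (h : WalkBounds ρ σ q γ s D n) :
    ∃ c : ℝ, 0 < c ∧ ∀ (F : X → ℂ) (a b : ℝ), 0 ≤ a → 0 ≤ b → (∀ x, ‖F x‖ ≤ a) →
      (∀ x y, q x = q y → ‖F x - F y‖ ≤ b * dist x y ^ (γ : ℝ)) →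
      ∀ x y, ‖F x - F y‖ ≤ (c * a + b) * dist x y ^ (γ : ℝ) := by
  obtain ⟨δ, hδ, hsep⟩ := h.sep
  refine ⟨2 / δ, by positivity, fun F a b ha hb h1 h2 x y => ?_⟩
  have h3 : 0 ≤ dist x y ^ (γ : ℝ) := Real.rpow_nonneg dist_nonneg _
  rw [add_mul]
  by_cases hxy : q x = q y
  · exact (h2 x y hxy).trans (le_add_of_nonneg_left (by positivity))
  · refine (norm_sub_le _ _).trans (le_trans ?_ (le_add_of_nonneg_right (by positivity)))
    have h4 : 1 ≤ dist x y ^ (γ : ℝ) / δ := (one_le_div hδ).2 (hsep x y hxy)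
    calc ‖F x‖ + ‖F y‖ ≤ 2 * a := by linarith [h1 x, h1 y]
      _ ≤ 2 * a * (dist x y ^ (γ : ℝ) / δ) := le_mul_of_one_le_right (by positivity) h4
      _ = _ := by ring

theorem exists_op (h : WalkBounds ρ σ q γ s D n) :
    ∃ C : ℝ, 0 ≤ C ∧ ∀ z : ℂ, |z.re| ≤ s → ∃ T : HolderSpace X γ →L[ℂ] HolderSpace X γ,
      (∀ f x, (T f).toC x = twisted ρ σ z f.toC x) ∧ ‖T‖ ≤ C * (1 + ‖z‖) := by
  obtain ⟨c, hc, hfib⟩ := h.norm_sub_le_of_fibre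
  have hD := h.D_pos
  have hI := h.integral_nonneg
  set I := ∫ g, n g ^ 4 ∂ρ with hIdef
  refine ⟨D * I + (c * (D * I) + 3 * D ^ 2 * I), by positivity, fun z hz => ?_⟩
  have h1 : ∀ (f : HolderSpace X γ) x, ‖twisted ρ σ z f.toC x‖ ≤ D * I * ‖f‖ := fun f x =>
    (h.norm_twisted_le hz f.toC x).trans (by gcongr; exact f.norm_toC_le)
  have h2 : ∀ (f : HolderSpace X γ) x y, ‖twisted ρ σ z f.toC x - twisted ρ σ z f.toC y‖ ≤
      (c * (D * I * ‖f‖) + 3 * D ^ 2 * I * (1 + ‖z‖) * ‖f‖) * dist x y ^ (γ : ℝ) := fun f =>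
    hfib _ _ _ (by positivity) (by positivity) (h1 f) fun x y hxy =>
      h.norm_twisted_sub_le_of_eq hz f hxy
  have h3 : ∀ f : HolderSpace X γ, ∃ F : HolderSpace X γ,
      F.toC = ⟨twisted ρ σ z f.toC, h.continuous_twisted hz f.toC⟩ := fun f =>
    HolderSpace.exists_toC_eq _ _ (h2 f)
  choose T hT using h3
  have hT' : ∀ f x, (T f).toC x = twisted ρ σ z f.toC x := fun f x => by rw [hT]; rfl
  refine ⟨LinearMap.mkContinuous
    { toFun := T
      map_add' := fun f f' => HolderSpace.ext_toC <| by
        ext x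
        simp only [HolderSpace.toC_add, ContinuousMap.add_apply, hT', twisted, mul_add]
        exact integral_add (h.integrable_integrand hz f.toC x) (h.integrable_integrand hz f'.toC x)
      map_smul' := fun a f => HolderSpace.ext_toC <| by
        ext x
        simp only [HolderSpace.toC_smul, ContinuousMap.smul_apply, hT', twisted, RingHom.id_apply,
          smul_eq_mul, mul_left_comm _ a]
        exact integral_const_mul a _ }
    ((D * I + (c * (D * I) + 3 * D ^ 2 * I)) * (1 + ‖z‖)) fun f => ?_, hT', ?_⟩
  · refine (HolderSpace.norm_le_add (F := T f) (a := D * I * ‖f‖)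
      (b := c * (D * I * ‖f‖) + 3 * D ^ 2 * I * (1 + ‖z‖) * ‖f‖) (by positivity) (by positivity)
      (fun x => ?_) fun x y => ?_).trans ?_
    · rw [hT']; exact h1 f x
    · rw [hT', hT']; exact h2 f x y
    · have : 0 ≤ (D * I + c * (D * I)) * ‖z‖ * ‖f‖ := by positivity
      linarith
  · exact LinearMap.mkContinuous_norm_le _ (by positivity) _

theorem abs_le_exp (h : WalkBounds ρ σ q γ s D n) {ε : ℝ} (hε : 0 < ε) (u : ℝ) :
    |u| ≤ ε⁻¹ * Real.exp (ε * |u|) := by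
  rw [← div_eq_inv_mul, le_div_iff₀ hε, mul_comm]
  linarith [Real.add_one_le_exp (ε * |u|)]

theorem hasDerivAt_twisted (h : WalkBounds ρ σ q γ s D n) {z : ℂ} (hz : |z.re| < s)
    (f : C(X, ℂ)) (x : X) :
    HasDerivAt (fun z => twisted ρ σ z f x)
      (∫ g, -(σ.toFun g x : ℂ) * (Complex.exp (-(z * σ.toFun g x)) * f (g • x)) ∂ρ) z := by
  set ε := (s - |z.re|) / 2 with hε
  have hε0 : 0 < ε := by rw [hε]; linarith
  have hball : ∀ w ∈ Metric.ball z ε, |w.re| + ε ≤ s := by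
    intro w hw
    rw [Metric.mem_ball, dist_eq_norm] at hw
    have h1 := (Complex.abs_re_le_norm (w - z)).trans hw.le
    have h2 := abs_sub_abs_le_abs_sub w.re z.re
    rw [Complex.sub_re] at h1
    have : ε + ε = s - |z.re| := by rw [hε]; ring
    linarith
  have hcont : Continuous fun g => (σ.toFun g x : ℂ) :=
    Complex.continuous_ofReal.comp (σ.continuous_toFun.comp (Continuous.prodMk_left x))
  refine (hasDerivAt_integral_of_dominated_loc_of_deriv_le
    (F := fun z g => Complex.exp (-(z * σ.toFun g x)) * f (g • x))
    (F' := fun z g => -(σ.toFun g x : ℂ) * (Complex.exp (-(z * σ.toFun g x)) * f (g • x)))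
    (bound := fun g => ε⁻¹ * D * ‖f‖ * n g ^ 4) (s := Metric.ball z ε)
    (Metric.ball_mem_nhds z hε0) ?_ ?_ ?_ ?_ ?_ ?_).2
  · exact Eventually.of_forall fun w =>
      ((continuous_cocycle_mul σ w f.continuous).comp
        (Continuous.prodMk_left x)).aestronglyMeasurable
  · exact h.integrable_integrand hz.le f x
  · exact (hcont.neg.mul ((continuous_cocycle_mul σ z f.continuous).comp
        (Continuous.prodMk_left x))).aestronglyMeasurable
  · refine Eventually.of_forall fun g w hw => ?_
    have h1 := h.D_pos
    have h2 := h.n_pos g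
    rw [norm_mul, norm_mul, norm_neg, Complex.norm_real, Real.norm_eq_abs]
    have h3 : |σ.toFun g x| * ‖Complex.exp (-(w * σ.toFun g x))‖ ≤ ε⁻¹ * (D * n g) := by
      rw [Complex.norm_exp]
      simp only [Complex.neg_re, Complex.mul_re, Complex.ofReal_re, Complex.ofReal_im, mul_zero,
        sub_zero]
      calc |σ.toFun g x| * Real.exp (-(w.re * σ.toFun g x))
          ≤ ε⁻¹ * Real.exp (ε * |σ.toFun g x|) * Real.exp (|w.re| * |σ.toFun g x|) := by
            gcongr
            · exact h.abs_le_exp hε0 _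
            · exact (neg_le_abs _).trans (abs_mul _ _).le
        _ = ε⁻¹ * Real.exp ((|w.re| + ε) * |σ.toFun g x|) := by
            rw [mul_assoc, ← Real.exp_add]; ring_nf
        _ ≤ ε⁻¹ * Real.exp (s * |σ.toFun g x|) := by
            gcongr
            exact hball w hw
        _ ≤ _ := by
            gcongr
            exact h.exp_le g x
    calc _ = |σ.toFun g x| * ‖Complex.exp (-(w * σ.toFun g x))‖ * ‖f (g • x)‖ := by ring
      _ ≤ ε⁻¹ * (D * n g) * ‖f‖ := by
          exact mul_le_mul h3 (f.norm_coe_le_norm _) (norm_nonneg _) (by positivity)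
      _ ≤ ε⁻¹ * (D * n g ^ 4) * ‖f‖ := by
          gcongr
          exact h.n_le_pow_four g
      _ = _ := by ring
  · exact h.moment.const_mul _
  · refine Eventually.of_forall fun g w _ => ?_
    have : HasDerivAt (fun w : ℂ => -(w * σ.toFun g x)) (-(σ.toFun g x : ℂ)) w := by
      have := (hasDerivAt_id' w).mul_const (-(σ.toFun g x : ℂ))
      simpa only [mul_neg, one_mul] using this
    have h1 := this.cexp.mul_const (f (g • x))
    exact h1.congr_deriv (by ring)

end WalkBounds

namespace HolderSpace

variable {X : Type*} [MetricSpace X] [CompactSpace X] {γ : ℝ≥0}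

/-- Evaluation at a point as a continuous linear form. -/
noncomputable def evalCLM (x : X) : HolderSpace X γ →L[ℂ] ℂ :=
  (ContinuousMap.evalCLM ℂ x).comp toCL

/-- A family of bounded operators on `C^{0,γ}(X)` is analytic as soon as it is locally bounded and
pointwise holomorphic. -/
theorem analyticAt_op {F : ℂ → HolderSpace X γ →L[ℂ] HolderSpace X γ} {z₀ : ℂ} {R C : ℝ}
    (hR : 0 < R) (hF : ∀ z ∈ Metric.ball z₀ R, ‖F z‖ ≤ C)
    (hd : ∀ f x, DifferentiableOn ℂ (fun z => (F z f).toC x) (Metric.ball z₀ R)) :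
    AnalyticAt ℂ F z₀ := by
  let Λ : Set ((HolderSpace X γ →L[ℂ] HolderSpace X γ) →L[ℂ] ℂ) :=
    {l | ∃ (f : HolderSpace X γ) (x : X), l = ((‖f‖⁻¹ : ℝ) : ℂ) •
      ((evalCLM x).comp (ContinuousLinearMap.apply ℂ _ f))} ∪
    {l | ∃ (f : HolderSpace X γ) (x y : X), l = (((‖f‖ * dist x y ^ (γ : ℝ))⁻¹ : ℝ) : ℂ) •
      ((evalCLM x - evalCLM y).comp (ContinuousLinearMap.apply ℂ _ f))}
  refine analyticAt_of_norming (Λ := Λ) (K := 2) ?_ ?_ hR hF ?_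
  · rintro l (⟨f, x, rfl⟩ | ⟨f, x, y, rfl⟩) a
    · have h1 : ‖((a f).toC x)‖ ≤ ‖a‖ * ‖f‖ := ((a f).norm_apply_le x).trans (a.le_opNorm f)
      change ‖((‖f‖⁻¹ : ℝ) : ℂ) • (a f).toC x‖ ≤ _
      rw [norm_smul, Complex.norm_real, norm_inv, norm_norm]
      exact inv_mul_le_of_le_mul₀ (norm_nonneg _) (norm_nonneg _) (by linarith)
    · have h1 : ‖(a f).toC x - (a f).toC y‖ ≤ ‖f‖ * dist x y ^ (γ : ℝ) * ‖a‖ := by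
        refine ((a f).norm_sub_le_norm x y).trans ?_
        have := a.le_opNorm f
        calc ‖a f‖ * dist x y ^ (γ : ℝ) ≤ ‖a‖ * ‖f‖ * dist x y ^ (γ : ℝ) := by gcongr
          _ = _ := by ring
      have h2 : 0 ≤ ‖f‖ * dist x y ^ (γ : ℝ) := by positivity
      change ‖(((‖f‖ * dist x y ^ (γ : ℝ))⁻¹ : ℝ) : ℂ) • ((a f).toC x - (a f).toC y)‖ ≤ _
      rw [norm_smul, Complex.norm_real, norm_inv, Real.norm_of_nonneg h2]
      exact inv_mul_le_of_le_mul₀ h2 (norm_nonneg _) h1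
  · intro a c hc ha
    refine a.opNorm_le_bound (by positivity) fun f => ?_
    rcases eq_or_ne f 0 with rfl | hf
    · simp
    have hf' : 0 < ‖f‖ := norm_pos_iff.2 hf
    have : 2 * c * ‖f‖ = c * ‖f‖ + c * ‖f‖ := by ring
    rw [this]
    refine norm_le_add (by positivity) (by positivity) (fun x => ?_) fun x y => ?_
    · have h1 : ‖((‖f‖⁻¹ : ℝ) : ℂ) • (a f).toC x‖ ≤ c := ha _ (Or.inl ⟨f, x, rfl⟩)
      rw [norm_smul, Complex.norm_real, norm_inv, norm_norm, inv_mul_le_iff₀ hf'] at h1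
      linarith
    · rcases eq_or_ne x y with rfl | hxy
      · rw [sub_self, norm_zero]; positivity
      have hd' : 0 < ‖f‖ * dist x y ^ (γ : ℝ) :=
        mul_pos hf' (Real.rpow_pos_of_pos (dist_pos.2 hxy) _)
      have h1 : ‖(((‖f‖ * dist x y ^ (γ : ℝ))⁻¹ : ℝ) : ℂ) • ((a f).toC x - (a f).toC y)‖ ≤ c :=
        ha _ (Or.inr ⟨f, x, y, rfl⟩)
      rw [norm_smul, Complex.norm_real, norm_inv, Real.norm_of_nonneg hd'.le,
        inv_mul_le_iff₀ hd'] at h1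
      linarith
  · rintro l (⟨f, x, rfl⟩ | ⟨f, x, y, rfl⟩)
    · exact (hd f x).const_smul (((‖f‖⁻¹ : ℝ) : ℂ))
    · exact ((hd f x).sub (hd f y)).const_smul ((((‖f‖ * dist x y ^ (γ : ℝ))⁻¹ : ℝ) : ℂ))

end HolderSpace

namespace WalkBounds

variable {G X A : Type*} [Group G] [TopologicalSpace G] [SecondCountableTopology G]
  [MeasurableSpace G] [BorelSpace G] [MetricSpace X] [CompactSpace X] [MulAction G X]
  [ContinuousSMul G X] {ρ : Measure G} {σ : Cocycle G X} {q : X → A} {γ : ℝ≥0} {s D : ℝ} {n : G → ℝ}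

/-- The operators `P(z)` on `C^{0,γ}(X)` form an analytic family near the imaginary axis. -/
theorem exists_analytic_family (h : WalkBounds ρ σ q γ s D n) :
    ∃ P : ℂ → HolderSpace X γ →L[ℂ] HolderSpace X γ,
      (∀ z : ℂ, |z.re| < s → ∀ f x, (P z f).toC x = twisted ρ σ z f.toC x) ∧
      (∀ z : ℂ, |z.re| < s → AnalyticAt ℂ P z) ∧
      ∃ D' : HolderSpace X γ →L[ℂ] HolderSpace X γ, HasDerivAt P D' 0 ∧
        ∀ f x, (D' f).toC x = -∫ g, (σ.toFun g x : ℂ) * f.toC (g • x) ∂ρ := by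
  obtain ⟨C, hC, hop⟩ := h.exists_op
  have : ∀ z : ℂ, ∃ T : HolderSpace X γ →L[ℂ] HolderSpace X γ, |z.re| ≤ s →
      (∀ f x, (T f).toC x = twisted ρ σ z f.toC x) ∧ ‖T‖ ≤ C * (1 + ‖z‖) := fun z => by
    by_cases hz : |z.re| ≤ s
    · obtain ⟨T, hT⟩ := hop z hz
      exact ⟨T, fun _ => hT⟩
    · exact ⟨0, fun h' => absurd h' hz⟩
  choose P hP using this
  have hP1 : ∀ z : ℂ, |z.re| < s → ∀ f x, (P z f).toC x = twisted ρ σ z f.toC x :=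
    fun z hz => (hP z hz.le).1
  have hnear : ∀ z : ℂ, |z.re| < s → ∀ w ∈ Metric.ball z (s - |z.re|), |w.re| < s := by
    intro z _ w hw
    rw [Metric.mem_ball, dist_eq_norm] at hw
    have h1 := (Complex.abs_re_le_norm (w - z)).trans_lt hw
    have h2 := abs_sub_abs_le_abs_sub w.re z.re
    rw [Complex.sub_re] at h1
    linarith
  have hder : ∀ z : ℂ, |z.re| < s → ∀ f x, HasDerivAt (fun z => (P z f).toC x)
      (∫ g, -(σ.toFun g x : ℂ) * (Complex.exp (-(z * σ.toFun g x)) * f.toC (g • x)) ∂ρ) z := by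
    intro z hz f x
    refine (h.hasDerivAt_twisted hz f.toC x).congr_of_eventuallyEq ?_
    filter_upwards [Metric.ball_mem_nhds z (sub_pos.2 hz)] with w hw
    exact hP1 w (hnear z hz w hw) f x
  have han : ∀ z : ℂ, |z.re| < s → AnalyticAt ℂ P z := by
    intro z hz
    refine HolderSpace.analyticAt_op (R := s - |z.re|) (C := C * (1 + (‖z‖ + s))) (sub_pos.2 hz)
      (fun w hw => ?_) fun f x w hw => ?_
    · refine (hP w (hnear z hz w hw).le).2.trans ?_
      gcongr
      rw [Metric.mem_ball, dist_eq_norm] at hw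
      have h1 := norm_sub_norm_le w z
      linarith [abs_nonneg z.re]
    · exact (hder w (hnear z hz w hw) f x).differentiableAt.differentiableWithinAt
  refine ⟨P, hP1, han, deriv P 0, ?_, fun f x => ?_⟩
  · exact (han 0 (by simpa using h.s_pos)).differentiableAt.hasDerivAt
  · have h0 : |(0 : ℂ).re| < s := by simpa using h.s_pos
    have h1 := (han 0 h0).differentiableAt.hasDerivAt
    have h2 := (((HolderSpace.evalCLM x).comp
      (ContinuousLinearMap.apply ℂ (HolderSpace X γ) f)).hasFDerivAt.comp_hasDerivAt 0 h1).unique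
      (hder 0 h0 f x)
    have h3 : (deriv P 0 f).toC x = _ := h2
    rw [h3, ← integral_neg]
    simp

end WalkBounds

theorem twisted_eq_perturbedOp {G X : Type*} [Group G] [TopologicalSpace G]
    [SecondCountableTopology G] [MeasurableSpace G] [BorelSpace G] [MetricSpace X] [CompactSpace X]
    [MulAction G X] [ContinuousSMul G X] (ρ : Measure G) [IsProbabilityMeasure ρ]
    (σ : Cocycle G X) (t : ℝ) (f : C(X, ℂ)) (x : X) :
    twisted ρ σ (Complex.I * t) f x = perturbedOp ρ σ t f x := by
  simp only [twisted, perturbedOp_apply, Complex.ofReal_mul, mul_assoc]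

/-! ### Convolution powers -/

section ConvPow

variable {G : Type*} [Group G] [TopologicalSpace G] [IsTopologicalGroup G] [T2Space G]
  [SecondCountableTopology G] [MeasurableSpace G] [BorelSpace G]
  (ρ : Measure G) [IsProbabilityMeasure ρ]

instance isProbabilityMeasure_convPow (n : ℕ) : IsProbabilityMeasure (convPow ρ n) := by
  induction n with
  | zero => exact inferInstanceAs (IsProbabilityMeasure (Measure.dirac 1))
  | succ n ih => exact inferInstanceAs (IsProbabilityMeasure (ρ.mconv (convPow ρ n)))

theorem integrable_convPow {w : G → ℝ} (hw : Measurable w) (h0 : ∀ g, 0 ≤ w g)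
    (hmul : ∀ g g', w (g * g') ≤ w g * w g') (hint : Integrable w ρ) (n : ℕ) :
    Integrable w (convPow ρ n) := by
  induction n with
  | zero =>
    rw [convPow]
    exact integrable_dirac (by simp)
  | succ n ih =>
    rw [convPow, Measure.mconv, integrable_map_measure hw.aestronglyMeasurable (by fun_prop)]
    refine (hint.mul_prod ih).mono' ?_ (Eventually.of_forall fun q => ?_)
    · exact (hw.comp measurable_mul).aestronglyMeasurable
    · simp only [Function.comp]
      rw [Real.norm_of_nonneg (h0 _)]
      exact hmul _ _

variable {X : Type*} [MetricSpace X] [CompactSpace X] [MulAction G X] [ContinuousSMul G X]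

theorem perturbedOp_zero_apply (σ : Cocycle G X) (f : C(X, ℂ)) (x : X) :
    perturbedOp ρ σ 0 f x = ∫ g, f (g • x) ∂ρ := by
  simp [perturbedOp_apply]

theorem integrable_smul (μ : Measure G) [IsProbabilityMeasure μ] (f : C(X, ℂ)) (x : X) :
    Integrable (fun g => f (g • x)) μ :=
  Integrable.of_bound (C := ‖f‖)
    (f.continuous.comp (continuous_id.smul continuous_const)).aestronglyMeasurable
    (Eventually.of_forall fun _ => f.norm_coe_le_norm _)

theorem perturbedOp_zero_pow_apply (σ : Cocycle G X) (n : ℕ) (f : C(X, ℂ)) (x : X) :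
    (perturbedOp ρ σ 0 ^ n) f x = ∫ g, f (g • x) ∂(convPow ρ n) := by
  induction n generalizing f with
  | zero =>
    rw [convPow, integral_dirac]
    simp
  | succ n ih =>
    rw [pow_succ, mul_apply_eq_comp, ih, convPow, integral_mconv (integrable_smul _ f x)]
    simp only [perturbedOp_zero_apply]
    rw [integral_integral_swap]
    · simp only [mul_smul]
    · refine Integrable.of_bound (C := ‖f‖) (Continuous.aestronglyMeasurable ?_)
        (Eventually.of_forall fun _ => f.norm_coe_le_norm _)
      exact f.continuous.comp (continuous_snd.smul (continuous_fst.smul continuous_const))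

theorem norm_perturbedOp_zero_le (σ : Cocycle G X) (f : C(X, ℂ)) :
    ‖perturbedOp ρ σ 0 f‖ ≤ ‖f‖ := by
  have h := LinearMap.mkContinuous_norm_le _ zero_le_one _ |> (perturbedOp ρ σ 0).le_of_opNorm_le
    (c := 1) |> fun h => h f
  rwa [one_mul] at h

end ConvPow

/-! ### The walk on a finite extension of a contracted space -/

section Extension

variable {G H X A : Type*}
  [Group G] [TopologicalSpace G] [IsTopologicalGroup G] [T2Space G]
  [SecondCountableTopology G] [MeasurableSpace G] [BorelSpace G]
  [Group H] [Finite H]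
  [MetricSpace X] [CompactSpace X] [MulAction G X] [ContinuousSMul G X]
  [MulAction H X] [IsIsometricSMul H X] [SMulCommClass G H X]

theorem dist_mk_le_dist (x y : X) : dist (OrbitSpace.mk H x) (OrbitSpace.mk H y) ≤ dist x y := by
  have h := OrbitSpace.dist_mk_le x y (1 : H)
  rwa [one_smul] at h

theorem exists_dist_lt_imp_eq [TopologicalSpace A] [DiscreteTopology A] {q : X → A}
    (hq : Continuous q) : ∃ δ : ℝ, 0 < δ ∧ ∀ x y, dist x y < δ → q x = q y := by
  obtain ⟨δ, hδ, h⟩ := lebesgue_number_lemma_of_metric (s := (Set.univ : Set X)) isCompact_univ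
    (c := fun a : A => q ⁻¹' {a}) (fun a => (isOpen_discrete _).preimage hq)
    (fun x _ => Set.mem_iUnion.2 ⟨q x, rfl⟩)
  refine ⟨δ, hδ, fun x y hxy => ?_⟩
  obtain ⟨a, ha⟩ := h x (Set.mem_univ x)
  have h1 : q x = a := ha (Metric.mem_ball_self hδ)
  have h2 : q y = a := ha (by rwa [Metric.mem_ball, dist_comm])
  rw [h1, h2]

theorem exists_walkBounds [TopologicalSpace A] [DiscreteTopology A] {ρ : Measure G} {N : G → ℝ}
    (hN_meas : Measurable N) (hN_one : ∀ g, 1 ≤ N g) {γ₀ M : ℝ} (hγ₀ : 0 < γ₀) (hM : 0 < M)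
    {p : OrbitSpace H X → A} (hp : Continuous p)
    (hX_lip : ∀ (g : G) (x y : X), dist (g • x) (g • y) ≤ M * N g ^ M * dist x y)
    (hmom : Integrable (fun g => N g ^ (M * γ₀)) ρ)
    {σ : Cocycle G (OrbitSpace H X)} (hσ : σ.IsControlled M N p)
    {γ : ℝ≥0} (hγ : 0 < γ) (hγ1 : γ ≤ 1) (hγγ : (γ : ℝ) ≤ γ₀ / 4) :
    ∃ D : ℝ, WalkBounds ρ σ.lift (fun x => p (OrbitSpace.mk H x)) γ (γ₀ / 4) D
      (fun g => N g ^ (M * γ₀ / 4)) := by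
  obtain ⟨⟨C₁, hC₁⟩, ⟨C₂, hC₂⟩⟩ := hσ
  have hN0 : ∀ g, 0 < N g := fun g => one_pos.trans_le (hN_one g)
  have hγ0 : (0 : ℝ) < γ := hγ
  set D₁ := max C₁ 1 with hD₁
  set D₂ := max C₂ 1 with hD₂
  have hD₁0 : 0 < D₁ := one_pos.trans_le (le_max_right _ _)
  have hD₂0 : 0 < D₂ := one_pos.trans_le (le_max_right _ _)
  have hpow : ∀ g, (N g ^ M) ^ (γ : ℝ) ≤ N g ^ (M * γ₀ / 4) := fun g => by
    rw [← Real.rpow_mul (hN0 g).le]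
    refine Real.rpow_le_rpow_of_exponent_le (hN_one g) ?_
    calc M * γ ≤ M * (γ₀ / 4) := by gcongr
      _ = _ := by ring
  have hn0 : ∀ g, 0 ≤ N g ^ (M * γ₀ / 4) := fun g => (Real.rpow_pos_of_pos (hN0 g) _).le
  refine ⟨1 + D₂ ^ (γ₀ / 4) + M ^ (γ : ℝ) + D₁ ^ (γ : ℝ), hγ, hγ1, by positivity, ?_,
    hN_meas.pow_const _, fun g => Real.one_le_rpow (hN_one g) (by positivity), ?_, ?_, ?_, ?_, ?_⟩
  · have := Real.rpow_nonneg hD₂0.le (γ₀ / 4)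
    have := Real.rpow_nonneg hM.le γ
    have := Real.rpow_nonneg hD₁0.le γ
    linarith
  · refine hmom.congr (Eventually.of_forall fun g => ?_)
    simp only
    rw [← Real.rpow_mul_natCast (hN0 g).le]
    congr 1
    push_cast
    ring
  · intro g x
    have h1 : Real.exp (γ₀ / 4 * |σ.lift.toFun g x|) =
        Real.exp |σ.toFun g (OrbitSpace.mk H x)| ^ (γ₀ / 4) := by
      rw [← Real.exp_mul, mul_comm]; rfl
    have h2 : Real.exp |σ.toFun g (OrbitSpace.mk H x)| ≤ D₂ * N g ^ M :=
      (hC₂ g _).trans (by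
        have := (Real.rpow_pos_of_pos (hN0 g) M).le
        gcongr
        exact le_max_left _ _)
    rw [h1]
    calc _ ≤ (D₂ * N g ^ M) ^ (γ₀ / 4) := by gcongr
      _ = D₂ ^ (γ₀ / 4) * N g ^ (M * γ₀ / 4) := by
        rw [Real.mul_rpow hD₂0.le (Real.rpow_nonneg (hN0 g).le _), ← Real.rpow_mul (hN0 g).le]
        ring_nf
      _ ≤ _ := by
        gcongr
        · exact hn0 g
        have := Real.rpow_nonneg hM.le γ
        have := Real.rpow_nonneg hD₁0.le γ
        linarith
  · intro g x y
    calc _ ≤ (M * N g ^ M * dist x y) ^ (γ : ℝ) := by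
          gcongr
          exact hX_lip g x y
      _ = M ^ (γ : ℝ) * (N g ^ M) ^ (γ : ℝ) * dist x y ^ (γ : ℝ) := by
          have := Real.rpow_nonneg (hN0 g).le M
          rw [Real.mul_rpow (by positivity) dist_nonneg, Real.mul_rpow hM.le this]
      _ ≤ _ := by
          have := Real.rpow_nonneg hM.le γ
          have := Real.rpow_nonneg hD₁0.le γ
          have := Real.rpow_nonneg hD₂0.le (γ₀ / 4)
          have := hn0 g
          have := Real.rpow_nonneg (Real.rpow_nonneg (hN0 g).le M) γ
          gcongr ?_ * ?_ * _
          · linarith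
          · exact hpow g
  · intro g x y hxy
    have hNM := Real.rpow_nonneg (hN0 g).le M
    have h1 : |σ.lift.toFun g x - σ.lift.toFun g y| ≤ D₁ * N g ^ M * dist x y := by
      refine (hC₁ g _ _ hxy).trans ?_
      gcongr
      · exact le_max_left _ _
      · exact dist_mk_le_dist x y
    calc _ ≤ (D₁ * N g ^ M * dist x y) ^ (γ : ℝ) := by gcongr
      _ = D₁ ^ (γ : ℝ) * (N g ^ M) ^ (γ : ℝ) * dist x y ^ (γ : ℝ) := by
          rw [Real.mul_rpow (by positivity) dist_nonneg, Real.mul_rpow hD₁0.le hNM]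
      _ ≤ _ := by
          have := Real.rpow_nonneg hM.le γ
          have := Real.rpow_nonneg hD₁0.le γ
          have := Real.rpow_nonneg hD₂0.le (γ₀ / 4)
          have := hn0 g
          have := Real.rpow_nonneg (Real.rpow_nonneg (hN0 g).le M) γ
          gcongr ?_ * ?_ * _
          · linarith
          · exact hpow g
  · obtain ⟨δ, hδ, h⟩ := exists_dist_lt_imp_eq (X := X) (hp.comp (OrbitSpace.continuous_mk H X))
    refine ⟨δ ^ (γ : ℝ), by positivity, fun x y hxy => ?_⟩
    gcongr
    by_contra! hlt
    exact hxy (h x y hlt)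

theorem continuous_dist_mk_smul (x y : X) : Continuous fun g : G =>
    dist (g • OrbitSpace.mk H x) (g • OrbitSpace.mk H y) := by
  have h : ∀ x : X, Continuous fun g : G => g • OrbitSpace.mk H x := fun x =>
    (OrbitSpace.continuous_mk H X).comp (continuous_id.smul continuous_const)
  exact (h x).dist (h y)

theorem integrable_dist_smul_rpow (μ : Measure G) [IsProbabilityMeasure μ] (x y : X) {a : ℝ}
    (ha : 0 ≤ a) : Integrable (fun g => dist (g • x) (g • y) ^ a) μ := by
  have hc : Continuous fun g : G => dist (g • x) (g • y) ^ a := by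
    have : Continuous fun g : G => dist (g • x) (g • y) :=
      (continuous_id.smul continuous_const).dist (continuous_id.smul continuous_const)
    exact this.rpow_const fun _ => Or.inr ha
  refine Integrable.of_bound (C := Metric.diam (Set.univ : Set X) ^ a) hc.aestronglyMeasurable
    (Eventually.of_forall fun g => ?_)
  rw [Real.norm_of_nonneg (by positivity)]
  gcongr
  exact Metric.dist_le_diam_of_mem isCompact_univ.isBounded (Set.mem_univ _) (Set.mem_univ _)

theorem integrable_dist_mk_smul_rpow (μ : Measure G) [IsProbabilityMeasure μ] (x y : X) {a : ℝ}
    (ha : 0 ≤ a) :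
    Integrable (fun g => dist (g • OrbitSpace.mk H x) (g • OrbitSpace.mk H y) ^ a) μ := by
  refine (integrable_dist_smul_rpow μ x y ha).mono'
    ((continuous_dist_mk_smul (H := H) x y).rpow_const fun _ => Or.inr ha).aestronglyMeasurable
    (Eventually.of_forall fun g => ?_)
  rw [Real.norm_of_nonneg (by positivity)]
  gcongr
  exact dist_mk_le_dist _ _

/-- The contraction property for smaller exponents, by Jensen's inequality. -/
theorem exists_integral_dist_le {ρ : Measure G} [IsProbabilityMeasure ρ] {γ₀ M : ℝ} {N : G → ℝ}
    {p : OrbitSpace H X → A} (hγ₀ : 0 < γ₀) (hcontr : IsContracted ρ γ₀ M N p) {γ : ℝ}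
    (hγ : 0 < γ) (hγγ : γ ≤ γ₀) :
    ∃ n₀ : ℕ, 1 ≤ n₀ ∧ ∃ r : ℝ, 0 ≤ r ∧ r < 1 ∧ ∀ x y : X,
      p (OrbitSpace.mk H x) = p (OrbitSpace.mk H y) →
      ∫ g, dist (g • OrbitSpace.mk H x) (g • OrbitSpace.mk H y) ^ γ ∂(convPow ρ n₀) ≤
        r * dist (OrbitSpace.mk H x) (OrbitSpace.mk H y) ^ γ := by
  obtain ⟨n₀, hn₀, r, hr, h⟩ := hcontr.contraction
  have hθ : 0 < γ / γ₀ := by positivity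
  refine ⟨n₀, hn₀, max r 0 ^ (γ / γ₀), by positivity,
    Real.rpow_lt_one (le_max_right _ _) (max_lt hr one_pos) hθ, fun x y hxy => ?_⟩
  rcases eq_or_ne (OrbitSpace.mk H x) (OrbitSpace.mk H y) with he | hne
  · simp [he, Real.zero_rpow hγ.ne']
  have hd : 0 < dist (OrbitSpace.mk H x) (OrbitSpace.mk H y) := dist_pos.2 hne
  have h1 := h _ _ hne hxy
  set d := dist (OrbitSpace.mk H x) (OrbitSpace.mk H y) with hd_def
  set u : G → ℝ := fun g => dist (g • OrbitSpace.mk H x) (g • OrbitSpace.mk H y) ^ γ₀ / d ^ γ₀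
  have hu : ∀ g, u g ^ (γ / γ₀) =
      dist (g • OrbitSpace.mk H x) (g • OrbitSpace.mk H y) ^ γ / d ^ γ := fun g => by
    simp only [u]
    rw [Real.div_rpow (by positivity) (by positivity), ← Real.rpow_mul dist_nonneg,
      ← Real.rpow_mul hd.le, mul_div_cancel₀ _ hγ₀.ne']
  have h2 : ∫ g, u g ^ (γ / γ₀) ∂(convPow ρ n₀) ≤ (∫ g, u g ∂(convPow ρ n₀)) ^ (γ / γ₀) := by
    refine (Real.concaveOn_rpow hθ.le ((div_le_one hγ₀).2 hγγ)).le_map_integral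
      (Real.continuous_rpow_const hθ.le).continuousOn isClosed_Ici
      (Eventually.of_forall fun g => ?_) ?_ ?_
    · exact div_nonneg (Real.rpow_nonneg dist_nonneg _) (Real.rpow_nonneg hd.le _)
    · exact (integrable_dist_mk_smul_rpow (H := H) _ x y hγ₀.le).div_const _
    · refine ((integrable_dist_mk_smul_rpow (H := H) (convPow ρ n₀) x y hγ.le).div_const (d ^ γ)).congr ?_
      exact Eventually.of_forall fun g => (hu g).symm
  simp only [hu] at h2
  rw [integral_div, div_le_iff₀ (by positivity)] at h2
  refine h2.trans ?_
  have h3 : 0 ≤ ∫ g, u g ∂(convPow ρ n₀) := by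
    refine MeasureTheory.integral_nonneg fun g => ?_
    exact div_nonneg (Real.rpow_nonneg dist_nonneg _) (Real.rpow_nonneg hd.le _)
  gcongr
  · exact h1.trans (le_max_left _ _)

theorem norm_pow_sub_le {ρ : Measure G} [IsProbabilityMeasure ρ] (σ : Cocycle G X) {γ : ℝ≥0}
    (n : ℕ) (f : HolderSpace X γ) (x y : X) :
    ‖(perturbedOp ρ σ 0 ^ n) f.toC x - (perturbedOp ρ σ 0 ^ n) f.toC y‖ ≤
      nnHolderNorm γ f.toC * ∫ g, dist (g • x) (g • y) ^ (γ : ℝ) ∂(convPow ρ n) := by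
  rw [perturbedOp_zero_pow_apply, perturbedOp_zero_pow_apply,
    ← integral_sub (integrable_smul _ _ _) (integrable_smul _ _ _), ← integral_const_mul]
  exact norm_integral_le_of_norm_le
    ((integrable_dist_smul_rpow _ x y γ.coe_nonneg).const_mul _)
    (Eventually.of_forall fun g => f.norm_sub_le_nnHolderNorm _ _)

theorem doeblinFortet [TopologicalSpace A] [DiscreteTopology A] {ρ : Measure G}
    [IsProbabilityMeasure ρ] {N : G → ℝ}
    (hN_meas : Measurable N) (hN_one : ∀ g, 1 ≤ N g) (hN_mul : ∀ g g', N (g * g') ≤ N g * N g')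
    {γ₀ M : ℝ} (hγ₀ : 0 < γ₀) (hM : 0 < M)
    {p : OrbitSpace H X → A} (hp : Continuous p)
    (hX_loc : ∃ d₀ : ℝ, 0 < d₀ ∧ ∀ x y : X, dist x y ≤ d₀ →
      dist (OrbitSpace.mk H x) (OrbitSpace.mk H y) = dist x y)
    (hX_lip : ∀ (g : G) (x y : X), dist (g • x) (g • y) ≤ M * N g ^ M * dist x y)
    (hcontr : IsContracted ρ γ₀ M N p)
    (σ : Cocycle G X) {γ : ℝ≥0} (hγ : 0 < γ) (hγ1 : γ ≤ 1) (hγγ : (γ : ℝ) ≤ γ₀ / 4)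
    {T : HolderSpace X γ →L[ℂ] HolderSpace X γ}
    (hT : ∀ f, (T f).toC = perturbedOp ρ σ 0 f.toC) :
    DoeblinFortet (HolderSpace.toCL (X := X) (γ := γ)) T (perturbedOp ρ σ 0) := by
  refine ⟨HolderSpace.toCL_injective, HolderSpace.denseRange_toCL hγ1,
    fun f R hf => HolderSpace.exists_subseq_tendsto hγ hf, hT, norm_perturbedOp_zero_le ρ σ, ?_⟩
  have hγ0 : (0 : ℝ) < γ := hγ
  have hN0 : ∀ g, 0 < N g := fun g => one_pos.trans_le (hN_one g)
  obtain ⟨n₀, hn₀, r, hr0, hr1, hcon⟩ :=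
    exists_integral_dist_le hγ₀ hcontr hγ0 (by linarith : (γ : ℝ) ≤ γ₀)
  obtain ⟨d₀, hd₀, hloc⟩ := hX_loc
  obtain ⟨δ, hδ, hsep⟩ := exists_dist_lt_imp_eq (X := X) (hp.comp (OrbitSpace.continuous_mk H X))
  have hw : Integrable (fun g => N g ^ (M * γ₀)) (convPow ρ n₀) := by
    refine integrable_convPow ρ (hN_meas.pow_const _)
      (fun g => (Real.rpow_pos_of_pos (hN0 g) _).le) (fun g g' => ?_) hcontr.moment n₀
    rw [← Real.mul_rpow (hN0 g).le (hN0 g').le]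
    have := (hN0 (g * g')).le
    gcongr
    exact hN_mul g g'
  set J := ∫ g, N g ^ (M * γ₀) ∂(convPow ρ n₀) with hJ
  have hJ0 : 0 ≤ J :=
    MeasureTheory.integral_nonneg fun g => (Real.rpow_pos_of_pos (hN0 g) _).le
  set c := d₀ ^ (-(γ : ℝ)) * (M ^ (2 * γ : ℝ) * J) with hc
  have hc0 : 0 ≤ c := by positivity
  -- local contraction on the extension
  have hlocal : ∀ x y : X, dist x y ≤ d₀ → dist x y < δ →
      ∫ g, dist (g • x) (g • y) ^ (γ : ℝ) ∂(convPow ρ n₀) ≤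
        (r + c * dist x y ^ (γ : ℝ)) * dist x y ^ (γ : ℝ) := by
    intro x y h1 h2
    have h3 : ∀ g : G, dist (g • x) (g • y) ^ (γ : ℝ) ≤
        dist (g • OrbitSpace.mk H x) (g • OrbitSpace.mk H y) ^ (γ : ℝ) +
          d₀ ^ (-(γ : ℝ)) * (M ^ (2 * γ : ℝ) * dist x y ^ (2 * γ : ℝ)) * N g ^ (M * γ₀) := by
      intro g
      have hNM := (Real.rpow_pos_of_pos (hN0 g) M).le
      have hNw := (Real.rpow_pos_of_pos (hN0 g) (M * γ₀)).le
      rcases le_or_gt (dist (g • x) (g • y)) d₀ with h4 | h4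
      · have h5 := hloc _ _ h4
        rw [← OrbitSpace.smul_mk, ← OrbitSpace.smul_mk] at h5
        rw [h5]
        exact le_add_of_nonneg_right (by positivity)
      · refine le_trans ?_ (le_add_of_nonneg_left (by positivity))
        have hpos : 0 < dist (g • x) (g • y) := hd₀.trans h4
        have e1 : 1 ≤ d₀ ^ (-(γ : ℝ)) * dist (g • x) (g • y) ^ (γ : ℝ) := by
          rw [Real.rpow_neg hd₀.le, ← div_eq_inv_mul, one_le_div (by positivity)]
          gcongr
        have e2 : dist (g • x) (g • y) ^ (γ : ℝ) * dist (g • x) (g • y) ^ (γ : ℝ) =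
            dist (g • x) (g • y) ^ (2 * γ : ℝ) := by
          rw [← Real.rpow_add hpos]; ring_nf
        have e3 : dist (g • x) (g • y) ^ (2 * γ : ℝ) ≤
            M ^ (2 * γ : ℝ) * dist x y ^ (2 * γ : ℝ) * N g ^ (M * γ₀) := by
          calc _ ≤ (M * N g ^ M * dist x y) ^ (2 * γ : ℝ) := by
                gcongr
                exact hX_lip g x y
            _ = M ^ (2 * γ : ℝ) * dist x y ^ (2 * γ : ℝ) * N g ^ (M * (2 * γ : ℝ)) := by
                rw [Real.mul_rpow (by positivity) dist_nonneg, Real.mul_rpow hM.le hNM,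
                  ← Real.rpow_mul (hN0 g).le]
                ring
            _ ≤ _ := by
                gcongr
                · exact hN_one g
                · linarith
        calc dist (g • x) (g • y) ^ (γ : ℝ)
            ≤ d₀ ^ (-(γ : ℝ)) * dist (g • x) (g • y) ^ (γ : ℝ) * dist (g • x) (g • y) ^ (γ : ℝ) :=
              le_mul_of_one_le_left (by positivity) e1
          _ = d₀ ^ (-(γ : ℝ)) * dist (g • x) (g • y) ^ (2 * γ : ℝ) := by rw [mul_assoc, e2]
          _ ≤ d₀ ^ (-(γ : ℝ)) * (M ^ (2 * γ : ℝ) * dist x y ^ (2 * γ : ℝ) * N g ^ (M * γ₀)) := by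
              gcongr
          _ = _ := by ring
    have hi1 := integrable_dist_mk_smul_rpow (H := H) (convPow ρ n₀) x y hγ0.le
    have hi2 := hw.const_mul (d₀ ^ (-(γ : ℝ)) * (M ^ (2 * γ : ℝ) * dist x y ^ (2 * γ : ℝ)))
    refine (integral_mono (integrable_dist_smul_rpow _ x y hγ0.le) (hi1.add hi2) h3).trans ?_
    rw [Pi.add_def, integral_add hi1 hi2, integral_const_mul]
    have h5 := hcon x y (hsep x y h2)
    rw [hloc x y h1] at h5
    have h6 : dist x y ^ (2 * γ : ℝ) = dist x y ^ (γ : ℝ) * dist x y ^ (γ : ℝ) := by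
      rw [← Real.rpow_add_of_nonneg dist_nonneg hγ0.le hγ0.le]; ring_nf
    rw [h6]
    calc _ ≤ r * dist x y ^ (γ : ℝ) + d₀ ^ (-(γ : ℝ)) * (M ^ (2 * γ : ℝ) *
          (dist x y ^ (γ : ℝ) * dist x y ^ (γ : ℝ))) * J := by gcongr
      _ = _ := by rw [hc]; ring
  set ε := min (min (d₀ ^ (γ : ℝ)) (δ ^ (γ : ℝ))) ((1 - r) / 2 / (c + 1)) with hε
  have hε0 : 0 < ε := by
    have : 0 < 1 - r := by linarith
    exact lt_min (lt_min (by positivity) (by positivity)) (by positivity)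
  have hstep : ∀ x y : X, dist x y ^ (γ : ℝ) < ε →
      ∫ g, dist (g • x) (g • y) ^ (γ : ℝ) ∂(convPow ρ n₀) ≤ (1 + r) / 2 * dist x y ^ (γ : ℝ) := by
    intro x y hxy
    have h1 : dist x y < d₀ := by
      have := hxy.trans_le ((min_le_left _ _).trans (min_le_left _ _))
      exact (Real.rpow_lt_rpow_iff dist_nonneg hd₀.le hγ0).1 this
    have h2 : dist x y < δ := by
      have := hxy.trans_le ((min_le_left _ _).trans (min_le_right _ _))
      exact (Real.rpow_lt_rpow_iff dist_nonneg hδ.le hγ0).1 this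
    have h3 := (hxy.trans_le (min_le_right _ _)).le
    rw [le_div_iff₀ (by positivity)] at h3
    refine (hlocal x y h1.le h2).trans ?_
    have h4 : 0 ≤ dist x y ^ (γ : ℝ) := by positivity
    gcongr
    nlinarith
  refine ⟨n₀, hn₀, (1 + r) / 2, 1 + 2 / ε, by linarith, by linarith, by positivity, fun f => ?_⟩
  have hTn : ((T ^ n₀) f).toC = (perturbedOp ρ σ 0 ^ n₀) f.toC := by
    have : ∀ i, ((T ^ i) f).toC = (perturbedOp ρ σ 0 ^ i) f.toC := fun i => by
      induction i with
      | zero => simp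
      | succ i ih => rw [pow_succ', pow_succ', mul_apply_eq_comp, mul_apply_eq_comp, hT, ih]
    exact this n₀
  have hsup : ∀ x, ‖(perturbedOp ρ σ 0 ^ n₀) f.toC x‖ ≤ ‖f.toC‖ := fun x => by
    rw [perturbedOp_zero_pow_apply]
    refine (norm_integral_le_of_norm_le_const (C := ‖f.toC‖)
      (Eventually.of_forall fun g => f.toC.norm_coe_le_norm _)).trans ?_
    simp
  refine (HolderSpace.norm_le_add (a := ‖f.toC‖)
    (b := (1 + r) / 2 * nnHolderNorm γ f.toC + 2 / ε * ‖f.toC‖) (norm_nonneg _) (by positivity)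
    (fun x => by rw [hTn]; exact hsup x) fun x y => ?_).trans ?_
  · rw [hTn]
    have h0 : 0 ≤ dist x y ^ (γ : ℝ) := by positivity
    rw [add_mul]
    rcases lt_or_ge (dist x y ^ (γ : ℝ)) ε with h1 | h1
    · refine le_trans ?_ (le_add_of_nonneg_right (by positivity))
      refine (norm_pow_sub_le σ n₀ f x y).trans ?_
      calc _ ≤ nnHolderNorm γ f.toC * ((1 + r) / 2 * dist x y ^ (γ : ℝ)) := by
            gcongr
            exact hstep x y h1
        _ = _ := by ring
    · refine le_trans ?_ (le_add_of_nonneg_left (by positivity))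
      refine (norm_sub_le _ _).trans ?_
      have h2 : 1 ≤ dist x y ^ (γ : ℝ) / ε := (one_le_div hε0).2 h1
      calc _ ≤ 2 * ‖f.toC‖ := by linarith [hsup x, hsup y]
        _ ≤ 2 * ‖f.toC‖ * (dist x y ^ (γ : ℝ) / ε) := le_mul_of_one_le_right (by positivity) h2
        _ = _ := by ring
  · rw [HolderSpace.norm_def, HolderSpace.toCL_apply]
    have : 0 ≤ (1 + r) / 2 * ‖f.toC‖ := by positivity
    linarith

end Extension

/-! ### Positivity and the action of the derivative on invariant functions -/

section Positivity

variable {G X : Type*}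
  [Group G] [TopologicalSpace G] [IsTopologicalGroup G] [T2Space G]
  [SecondCountableTopology G] [MeasurableSpace G] [BorelSpace G]
  [MetricSpace X] [CompactSpace X] [MulAction G X] [ContinuousSMul G X]
  {ρ : Measure G} [IsProbabilityMeasure ρ] {σ : Cocycle G X}

theorem norm_perturbedOp_zero_apply_le {f u : C(X, ℂ)} (h : ∀ x, ‖f x‖ ≤ (u x).re) (x : X) :
    ‖perturbedOp ρ σ 0 f x‖ ≤ (perturbedOp ρ σ 0 u x).re := by
  rw [perturbedOp_zero_apply, perturbedOp_zero_apply]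
  have h1 := integral_re (integrable_smul ρ u x)
  simp only [RCLike.re_to_complex] at h1
  rw [← h1]
  exact norm_integral_le_of_norm_le (integrable_smul ρ u x).re (Eventually.of_forall fun g => h _)

/-- The ergodic limit preserves domination. -/
theorem IsErgodicLimit.norm_apply_le {N₀ : C(X, ℂ) →L[ℂ] C(X, ℂ)}
    (hN : IsErgodicLimit (perturbedOp ρ σ 0) N₀) {f u : C(X, ℂ)} (h : ∀ x, ‖f x‖ ≤ (u x).re)
    (x : X) : ‖N₀ f x‖ ≤ (N₀ u x).re := by
  have hpow : ∀ (i : ℕ) x, ‖(perturbedOp ρ σ 0 ^ i) f x‖ ≤ ((perturbedOp ρ σ 0 ^ i) u x).re := by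
    intro i
    induction i with
    | zero => simpa using h
    | succ i ih =>
      intro x
      rw [pow_succ', mul_apply_eq_comp, mul_apply_eq_comp]
      exact norm_perturbedOp_zero_apply_le ih x
  have hk : ∀ k : ℕ, ‖cesaro (perturbedOp ρ σ 0) k f x‖ ≤
      (cesaro (perturbedOp ρ σ 0) k u x).re := by
    intro k
    rw [cesaro_apply, cesaro_apply, ContinuousMap.smul_apply, ContinuousMap.smul_apply,
      ContinuousMap.sum_apply, ContinuousMap.sum_apply, norm_smul, norm_inv, Complex.norm_natCast,
      smul_eq_mul, ← Complex.ofReal_natCast, ← Complex.ofReal_inv, Complex.re_ofReal_mul,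
      Complex.re_sum]
    gcongr
    exact (norm_sum_le _ _).trans (Finset.sum_le_sum fun i _ => hpow i x)
  have hev : ∀ v : C(X, ℂ), Tendsto (fun k => cesaro (perturbedOp ρ σ 0) k v x) atTop
      (𝓝 (N₀ v x)) := fun v => ((continuous_eval_const x).tendsto _).comp (hN v)
  exact le_of_tendsto_of_tendsto' (hev f).norm ((Complex.continuous_re.tendsto _).comp (hev u)) hk

theorem integral_norm_sub_sq {f : C(X, ℂ)} (hf : perturbedOp ρ σ 0 f = f) {a : C(X, ℂ)}
    (ha : ∀ x, a x = ((‖f x‖ ^ 2 : ℝ) : ℂ)) (x : X) :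
    ∫ g, ‖f (g • x) - f x‖ ^ 2 ∂ρ = ((perturbedOp ρ σ 0 a - a) x).re := by
  have h1 : ∀ g : G, ‖f (g • x) - f x‖ ^ 2 =
      (a (g • x)).re + ‖f x‖ ^ 2 - 2 * ((starRingEnd ℂ) (f x) * f (g • x)).re := by
    intro g
    rw [ha, Complex.ofReal_re, ← Complex.normSq_eq_norm_sq, ← Complex.normSq_eq_norm_sq,
      ← Complex.normSq_eq_norm_sq, Complex.normSq_sub]
    rw [mul_comm (f (g • x))]
  have i1 : Integrable (fun g => (a (g • x)).re) ρ := (integrable_smul ρ a x).re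
  have i2 : Integrable (fun g => (starRingEnd ℂ) (f x) * f (g • x)) ρ :=
    (integrable_smul ρ f x).const_mul _
  have i3 : Integrable (fun g => ((starRingEnd ℂ) (f x) * f (g • x)).re) ρ := i2.re
  have e1 : ∫ g, (a (g • x)).re ∂ρ = (perturbedOp ρ σ 0 a x).re := by
    rw [perturbedOp_zero_apply]
    exact integral_re (integrable_smul ρ a x)
  have e2 : ∫ g, ((starRingEnd ℂ) (f x) * f (g • x)).re ∂ρ = ‖f x‖ ^ 2 := by
    refine (integral_re i2).trans ?_
    rw [integral_const_mul, ← perturbedOp_zero_apply ρ σ f x, hf, mul_comm, Complex.mul_conj,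
      Complex.normSq_eq_norm_sq]
    exact Complex.ofReal_re _
  have i4 : Integrable (fun g => (a (g • x)).re + ‖f x‖ ^ 2) ρ := i1.add (integrable_const _)
  simp only [h1]
  rw [integral_sub i4 (i3.const_mul 2),
    integral_add i1 (integrable_const _), integral_const_mul, e1, e2, ContinuousMap.sub_apply,
    Complex.sub_re, ha, Complex.ofReal_re]
  simp
  ring

/-- The increments of an invariant function are invisible to the ergodic limit. -/
theorem IsErgodicLimit.apply_eq_zero {N₀ : C(X, ℂ) →L[ℂ] C(X, ℂ)}
    (hN : IsErgodicLimit (perturbedOp ρ σ 0) N₀) {f : C(X, ℂ)} (hf : perturbedOp ρ σ 0 f = f)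
    {k : G → X → ℂ} {C : ℝ} (hk : ∀ x, Integrable (fun g => ‖k g x‖ ^ 2) ρ)
    (hC : ∀ x, ∫ g, ‖k g x‖ ^ 2 ∂ρ ≤ C) {u : C(X, ℂ)}
    (hu : ∀ x, u x = ∫ g, k g x * (f (g • x) - f x) ∂ρ) : N₀ u = 0 := by
  have hP : ∀ (i : ℕ) (f : C(X, ℂ)), ‖(perturbedOp ρ σ 0 ^ i) f‖ ≤ 1 * ‖f‖ := fun i f => by
    rw [one_mul]
    induction i with
    | zero => simp
    | succ i ih =>
      rw [pow_succ', mul_apply_eq_comp]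
      exact (norm_perturbedOp_zero_le ρ σ _).trans ih
  let a : C(X, ℂ) := ⟨fun x => ((‖f x‖ ^ 2 : ℝ) : ℂ), by fun_prop⟩
  have ha : ∀ x, a x = ((‖f x‖ ^ 2 : ℝ) : ℂ) := fun _ => rfl
  have hNa : N₀ (perturbedOp ρ σ 0 a - a) = 0 := by
    rw [map_sub, ← mul_apply_eq_comp, hN.mul_right_eq hP, sub_self]
  have hint : ∀ x, Integrable (fun g => ‖f (g • x) - f x‖ ^ 2) ρ := fun x => by
    refine Integrable.of_bound (C := (‖f‖ + ‖f‖) ^ 2) (Continuous.aestronglyMeasurable ?_)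
      (Eventually.of_forall fun g => ?_)
    · have : Continuous fun g : G => f (g • x) :=
        f.continuous.comp (continuous_id.smul continuous_const)
      fun_prop
    · rw [Real.norm_of_nonneg (by positivity)]
      gcongr
      exact (norm_sub_le _ _).trans (add_le_add (f.norm_coe_le_norm _) (f.norm_coe_le_norm _))
  have key : ∀ ε : ℝ, 0 < ε → ∀ x, ‖N₀ u x‖ ≤ ε * C := by
    intro ε hε x
    let v : C(X, ℂ) := ContinuousMap.const X ((ε * C : ℝ) : ℂ) +
      ((ε⁻¹ : ℝ) : ℂ) • (perturbedOp ρ σ 0 a - a)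
    have hv : N₀ v = ContinuousMap.const X ((ε * C : ℝ) : ℂ) := by
      have hc : perturbedOp ρ σ 0 (ContinuousMap.const X ((ε * C : ℝ) : ℂ)) =
          ContinuousMap.const X ((ε * C : ℝ) : ℂ) := by
        ext y
        rw [perturbedOp_zero_apply]
        simp
      simp only [v]
      rw [map_add, map_smul, hNa, smul_zero, add_zero, hN.apply_eq_self hc]
    have h1 : ∀ y, ‖u y‖ ≤ (v y).re := by
      intro y
      have h2 : (v y).re = ε * C + ε⁻¹ * ((perturbedOp ρ σ 0 a - a) y).re := by
        simp only [v, ContinuousMap.add_apply, ContinuousMap.const_apply, ContinuousMap.smul_apply,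
          Complex.add_re, Complex.ofReal_re, smul_eq_mul, Complex.re_ofReal_mul]
      rw [h2, ← integral_norm_sub_sq hf ha, hu]
      refine (norm_integral_le_of_norm_le (g := fun g => ε * ‖k g y‖ ^ 2 +
        ε⁻¹ * ‖f (g • y) - f y‖ ^ 2) (((hk y).const_mul ε).add ((hint y).const_mul ε⁻¹))
        (Eventually.of_forall fun g => ?_)).trans ?_
      · rw [norm_mul]
        have h3 : 0 ≤ ε⁻¹ * (ε * ‖k g y‖ - ‖f (g • y) - f y‖) ^ 2 := by positivity
        have h4 : ε⁻¹ * (ε * ‖k g y‖ - ‖f (g • y) - f y‖) ^ 2 = ε * ‖k g y‖ ^ 2 +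
            ε⁻¹ * ‖f (g • y) - f y‖ ^ 2 - 2 * (‖k g y‖ * ‖f (g • y) - f y‖) := by
          field_simp
          ring
        have h5 : 0 ≤ ‖k g y‖ * ‖f (g • y) - f y‖ := by positivity
        linarith
      · rw [integral_add ((hk y).const_mul ε) ((hint y).const_mul ε⁻¹), integral_const_mul,
          integral_const_mul]
        gcongr
        exact hC y
    have h2 := hN.norm_apply_le h1 x
    rwa [hv, ContinuousMap.const_apply, Complex.ofReal_re] at h2
  ext x
  have h1 : Tendsto (fun ε : ℝ => ε * C) (𝓝[>] 0) (𝓝 0) := by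
    have : Tendsto (fun ε : ℝ => ε * C) (𝓝 0) (𝓝 (0 * C)) := tendsto_id.mul_const C
    rw [zero_mul] at this
    exact this.mono_left nhdsWithin_le_nhds
  have h2 : ‖N₀ u x‖ ≤ 0 := by
    refine ge_of_tendsto h1 ?_
    filter_upwards [self_mem_nhdsWithin] with ε hε
    exact key ε hε x
  exact norm_le_zero_iff.1 h2

end Positivity

namespace WalkBounds

variable {G X A : Type*}
  [Group G] [TopologicalSpace G] [IsTopologicalGroup G] [T2Space G]
  [SecondCountableTopology G] [MeasurableSpace G] [BorelSpace G]
  [MetricSpace X] [CompactSpace X] [MulAction G X] [ContinuousSMul G X]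
  {ρ : Measure G} {σ : Cocycle G X} {q : X → A} {γ : ℝ≥0} {s D : ℝ} {n : G → ℝ}

theorem continuous_cocycle (σ : Cocycle G X) (x : X) : Continuous fun g => σ.toFun g x :=
  σ.continuous_toFun.comp (Continuous.prodMk_left x)

theorem sq_le (h : WalkBounds ρ σ q γ s D n) (g : G) (x : X) :
    σ.toFun g x ^ 2 ≤ (s / 2)⁻¹ ^ 2 * D * n g ^ 4 := by
  have hs := h.s_pos
  have h1 := h.abs_le_exp (half_pos hs) (σ.toFun g x)
  have h2 : Real.exp (s / 2 * |σ.toFun g x|) ^ 2 = Real.exp (s * |σ.toFun g x|) := by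
    rw [← Real.exp_nat_mul]; congr 1; push_cast; ring
  have hD := h.D_pos
  calc σ.toFun g x ^ 2 = |σ.toFun g x| ^ 2 := (sq_abs _).symm
    _ ≤ ((s / 2)⁻¹ * Real.exp (s / 2 * |σ.toFun g x|)) ^ 2 := by gcongr
    _ = (s / 2)⁻¹ ^ 2 * Real.exp (s * |σ.toFun g x|) := by rw [mul_pow, h2]
    _ ≤ (s / 2)⁻¹ ^ 2 * (D * n g) := by
        gcongr
        exact h.exp_le g x
    _ ≤ (s / 2)⁻¹ ^ 2 * (D * n g ^ 4) := by
        gcongr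
        exact h.n_le_pow_four g
    _ = _ := by ring

theorem integrable_sq (h : WalkBounds ρ σ q γ s D n) (x : X) :
    Integrable (fun g => σ.toFun g x ^ 2) ρ :=
  (h.moment.const_mul ((s / 2)⁻¹ ^ 2 * D)).mono'
    ((continuous_cocycle σ x).pow 2).aestronglyMeasurable
    (Eventually.of_forall fun g => by
      rw [Real.norm_of_nonneg (by positivity)]
      exact h.sq_le g x)

theorem abs_le (h : WalkBounds ρ σ q γ s D n) (g : G) (x : X) :
    |σ.toFun g x| ≤ s⁻¹ * D * n g ^ 4 := by
  have hs := h.s_pos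
  have hD := h.D_pos
  calc |σ.toFun g x| ≤ s⁻¹ * Real.exp (s * |σ.toFun g x|) := h.abs_le_exp hs _
    _ ≤ s⁻¹ * (D * n g ^ 4) := by
        gcongr
        exact (h.exp_le g x).trans (by gcongr; exact h.n_le_pow_four g)
    _ = _ := by ring

theorem integrable_cocycle (h : WalkBounds ρ σ q γ s D n) (x : X) :
    Integrable (fun g => σ.toFun g x) ρ :=
  (h.moment.const_mul (s⁻¹ * D)).mono' (continuous_cocycle σ x).aestronglyMeasurable
    (Eventually.of_forall fun g => h.abs_le g x)

variable [IsProbabilityMeasure ρ]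

/-- If the drift of the cocycle is cohomologous to the constant `m`, then `N₀ ∘ S = m` on the
space of invariant functions, where `S f (x) = ∫ σ(g, x) f(g x) dρ(g)`. -/
theorem apply_deriv_eq (h : WalkBounds ρ σ q γ s D n) {N₀ : C(X, ℂ) →L[ℂ] C(X, ℂ)}
    (hN : IsErgodicLimit (perturbedOp ρ σ 0) N₀) {m : ℂ} {ψ : C(X, ℂ)}
    (hψ : ∀ x, ∫ g, (σ.toFun g x : ℂ) ∂ρ = m + ψ x - ∫ g, ψ (g • x) ∂ρ)
    {f : C(X, ℂ)} (hf : perturbedOp ρ σ 0 f = f) {u : C(X, ℂ)}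
    (hu : ∀ x, u x = ∫ g, (σ.toFun g x : ℂ) * f (g • x) ∂ρ) : N₀ u = m • f := by
  have hP : ∀ (i : ℕ) (f : C(X, ℂ)), ‖(perturbedOp ρ σ 0 ^ i) f‖ ≤ 1 * ‖f‖ := fun i f => by
    rw [one_mul]
    induction i with
    | zero => simp
    | succ i ih =>
      rw [pow_succ', mul_apply_eq_comp]
      exact (norm_perturbedOp_zero_le ρ σ _).trans ih
  set P := perturbedOp ρ σ 0 with hPdef
  have hNP : ∀ v, N₀ (P v) = N₀ v := fun v => DFunLike.congr_fun (hN.mul_right_eq hP) v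
  have hiσ : ∀ x, Integrable (fun g => (σ.toFun g x : ℂ)) ρ := fun x => (h.integrable_cocycle x).ofReal
  have hiσf : ∀ x, Integrable (fun g => (σ.toFun g x : ℂ) * f (g • x)) ρ := fun x => by
    refine (hiσ x).mul_bdd (c := ‖f‖) ?_ (Eventually.of_forall fun g => f.norm_coe_le_norm _)
    exact (f.continuous.comp (continuous_id.smul continuous_const)).aestronglyMeasurable
  -- replace `f (g x)` by `f x`
  let w : C(X, ℂ) := m • f + ψ * f - P ψ * f
  have hw : ∀ x, w x = ∫ g, (σ.toFun g x : ℂ) * f x ∂ρ := fun x => by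
    rw [integral_mul_const, hψ x]
    simp only [w, ContinuousMap.sub_apply, ContinuousMap.add_apply, ContinuousMap.smul_apply,
      ContinuousMap.mul_apply, smul_eq_mul, hPdef, perturbedOp_zero_apply]
    ring
  have h1 : N₀ (u - w) = 0 := by
    refine hN.apply_eq_zero hf (k := fun g x => (σ.toFun g x : ℂ))
      (C := ∫ g, (s / 2)⁻¹ ^ 2 * D * n g ^ 4 ∂ρ) (fun x => ?_) (fun x => ?_) fun x => ?_
    · simpa only [Complex.norm_real, Real.norm_eq_abs, sq_abs] using h.integrable_sq x
    · simp only [Complex.norm_real, Real.norm_eq_abs, sq_abs]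
      exact integral_mono (h.integrable_sq x) (h.moment.const_mul _) fun g => h.sq_le g x
    · rw [ContinuousMap.sub_apply, hu, hw, ← integral_sub (hiσf x) ((hiσ x).mul_const _)]
      simp only [mul_sub]
  have h2 : N₀ (P (ψ * f) - P ψ * f) = 0 := by
    refine hN.apply_eq_zero hf (k := fun g x => ψ (g • x)) (C := ‖ψ‖ ^ 2) (fun x => ?_)
      (fun x => ?_) fun x => ?_
    · refine Integrable.of_bound (C := ‖ψ‖ ^ 2) (Continuous.aestronglyMeasurable ?_)
        (Eventually.of_forall fun g => ?_)
      · have : Continuous fun g : G => ψ (g • x) :=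
          ψ.continuous.comp (continuous_id.smul continuous_const)
        fun_prop
      · rw [Real.norm_of_nonneg (by positivity)]
        gcongr
        exact ψ.norm_coe_le_norm _
    · refine (integral_mono_of_nonneg (Eventually.of_forall fun g => by positivity)
        (integrable_const (‖ψ‖ ^ 2)) (Eventually.of_forall fun g => ?_)).trans (by simp)
      simp only
      gcongr
      exact ψ.norm_coe_le_norm _
    · have i1 := integrable_smul ρ (ψ * f) x
      have i2 := (integrable_smul ρ ψ x).mul_const (f x)
      simp only [ContinuousMap.mul_apply] at i1
      rw [ContinuousMap.sub_apply, ContinuousMap.mul_apply, hPdef, perturbedOp_zero_apply,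
        perturbedOp_zero_apply, ← integral_mul_const]
      simp only [ContinuousMap.mul_apply, mul_sub]
      rw [← integral_sub i1 i2]
  rw [map_sub, sub_eq_zero] at h1 h2
  rw [h1]
  simp only [w]
  rw [map_sub, map_add, map_smul, hN.apply_eq_self hf, ← h2, hNP, add_sub_cancel_right]

theorem exp_le_one_add_add (y : ℝ) : Real.exp y ≤ 1 + y + y ^ 2 * Real.exp |y| := by
  rcases le_or_gt |y| 1 with h | h
  · have h1 := (_root_.abs_le.1 (Real.abs_exp_sub_one_sub_id_le h)).2
    have h2 : y ^ 2 * 1 ≤ y ^ 2 * Real.exp |y| := by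
      gcongr
      exact Real.one_le_exp (abs_nonneg y)
    linarith
  · have h2 : 1 ≤ y ^ 2 := by
      rw [← sq_abs]
      exact one_le_pow₀ h.le
    rcases le_or_gt 0 y with h0 | h0
    · rw [abs_of_nonneg h0]
      nlinarith [Real.exp_pos y]
    · rw [abs_of_neg h0] at h ⊢
      have h3 : Real.exp y ≤ 1 := Real.exp_le_one_iff.2 h0.le
      have h4 : 1 ≤ Real.exp (-y) := Real.one_le_exp (by linarith)
      nlinarith

/-- A cocycle with positive drift has exponentially small negative exponential moments. -/
theorem exists_integral_exp_le (h : WalkBounds ρ σ q γ s D n) {m : ℝ} (hm : 0 < m) {ψ : C(X, ℝ)}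
    (hψ : ∀ x, ∫ g, σ.toFun g x ∂ρ = m + ψ x - ∫ g, ψ (g • x) ∂ρ) :
    ∃ t κ : ℝ, 0 < t ∧ t ≤ γ ∧ t ≤ s ∧ 0 ≤ κ ∧ κ < 1 ∧ ∀ x,
      ∫ g, Real.exp (-(t * (σ.toFun g x + ψ (g • x)))) ∂ρ ≤ κ * Real.exp (-(t * ψ x)) := by
  have hs := h.s_pos
  have hD := h.D_pos
  have hI := h.integral_nonneg
  set E := (s / 4)⁻¹ ^ 2 * Real.exp (s * (2 * ‖ψ‖)) * D * ∫ g, n g ^ 4 ∂ρ with hE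
  have hE0 : 0 ≤ E := by positivity
  set t := min (min (s / 2) γ) (m / 2 / (E + 1)) with ht
  have hγ : (0 : ℝ) < γ := h.γ_pos
  have ht0 : 0 < t := lt_min (lt_min (by positivity) hγ) (by positivity)
  have hts : t ≤ s / 2 := (min_le_left _ _).trans (min_le_left _ _)
  have htγ : t ≤ γ := (min_le_left _ _).trans (min_le_right _ _)
  have htm : t * (E + 1) ≤ m / 2 := (le_div_iff₀ (by positivity)).1 (min_le_right _ _)
  refine ⟨t, max (1 - t * (m / 2)) 0, ht0, htγ, by linarith, le_max_right _ _,
    max_lt (by nlinarith) one_pos, fun x => ?_⟩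
  set u : G → ℝ := fun g => σ.toFun g x + ψ (g • x) - ψ x with hu
  have hcu : Continuous u := by
    have h1 := continuous_cocycle σ x
    have h2 : Continuous fun g : G => ψ (g • x) :=
      ψ.continuous.comp (continuous_id.smul continuous_const)
    fun_prop
  have hiψ : Integrable (fun g => ψ (g • x)) ρ :=
    Integrable.of_bound (C := ‖ψ‖)
      (ψ.continuous.comp (continuous_id.smul continuous_const)).aestronglyMeasurable
      (Eventually.of_forall fun _ => ψ.norm_coe_le_norm _)
  have hi0 : Integrable (fun g => σ.toFun g x + ψ (g • x)) ρ := (h.integrable_cocycle x).add hiψ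
  have hiu : Integrable u ρ := hi0.sub (integrable_const _)
  have hmean : ∫ g, u g ∂ρ = m := by
    simp only [hu]
    rw [integral_sub hi0 (integrable_const _),
      integral_add (h.integrable_cocycle x) hiψ, hψ x]
    simp
  have habs : ∀ g, |u g| ≤ |σ.toFun g x| + 2 * ‖ψ‖ := fun g => by
    have h1 := ψ.norm_coe_le_norm (g • x)
    have h2 := ψ.norm_coe_le_norm x
    rw [Real.norm_eq_abs] at h1 h2
    have h3 := abs_sub (σ.toFun g x + ψ (g • x)) (ψ x)
    have h4 := abs_add_le (σ.toFun g x) (ψ (g • x))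
    simp only [hu]
    linarith
  have hquad : ∀ g, u g ^ 2 * Real.exp (t * |u g|) ≤
      (s / 4)⁻¹ ^ 2 * Real.exp (s * (2 * ‖ψ‖)) * D * n g ^ 4 := by
    intro g
    have h1 := h.abs_le_exp (show 0 < s / 4 by positivity) (u g)
    have h2 : u g ^ 2 ≤ (s / 4)⁻¹ ^ 2 * Real.exp (s / 2 * |u g|) := by
      have h3 : Real.exp (s / 4 * |u g|) ^ 2 = Real.exp (s / 2 * |u g|) := by
        rw [← Real.exp_nat_mul]; congr 1; push_cast; ring
      rw [← sq_abs, ← h3, ← mul_pow]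
      gcongr
    calc u g ^ 2 * Real.exp (t * |u g|)
        ≤ (s / 4)⁻¹ ^ 2 * Real.exp (s / 2 * |u g|) * Real.exp (s / 2 * |u g|) := by gcongr
      _ = (s / 4)⁻¹ ^ 2 * Real.exp (s * |u g|) := by
          rw [mul_assoc, ← Real.exp_add]; ring_nf
      _ ≤ (s / 4)⁻¹ ^ 2 * Real.exp (s * (|σ.toFun g x| + 2 * ‖ψ‖)) := by
          gcongr
          exact habs g
      _ = (s / 4)⁻¹ ^ 2 * Real.exp (s * (2 * ‖ψ‖)) * Real.exp (s * |σ.toFun g x|) := by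
          rw [mul_add, Real.exp_add]; ring
      _ ≤ (s / 4)⁻¹ ^ 2 * Real.exp (s * (2 * ‖ψ‖)) * (D * n g ^ 4) := by
          gcongr
          exact (h.exp_le g x).trans (by gcongr; exact h.n_le_pow_four g)
      _ = _ := by ring
  set B : G → ℝ := fun g => (s / 4)⁻¹ ^ 2 * Real.exp (s * (2 * ‖ψ‖)) * D * n g ^ 4 with hB
  have hiB : Integrable B ρ := h.moment.const_mul _
  have hexp : ∀ g, Real.exp (-(t * u g)) ≤ 1 + -(t * u g) + t ^ 2 * B g := by
    intro g
    refine (exp_le_one_add_add _).trans ?_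
    rw [abs_neg, abs_mul, abs_of_pos ht0, neg_sq, mul_pow, mul_assoc]
    gcongr
    exact hquad g
  have hi2 : Integrable (fun g => -(t * u g)) ρ := (hiu.const_mul t).neg
  have hi1 : Integrable (fun g => 1 + -(t * u g)) ρ := (integrable_const 1).add hi2
  have hbound : ∫ g, Real.exp (-(t * u g)) ∂ρ ≤ 1 - t * (m / 2) := by
    refine (integral_mono_of_nonneg (Eventually.of_forall fun g => (Real.exp_pos _).le)
      (hi1.add (hiB.const_mul (t ^ 2))) (Eventually.of_forall hexp)).trans ?_
    simp only [Pi.add_apply]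
    rw [integral_add hi1 (hiB.const_mul _), integral_add (integrable_const _) hi2,
      integral_neg, integral_const_mul, integral_const_mul, hmean]
    have : ∫ g, B g ∂ρ = E := by rw [hB, integral_const_mul]
    rw [this]
    have h1 : ∫ _ : G, (1 : ℝ) ∂ρ = 1 := by simp
    rw [h1]
    nlinarith [mul_le_mul_of_nonneg_left htm ht0.le, sq_nonneg t]
  have hsplit : ∀ g, Real.exp (-(t * (σ.toFun g x + ψ (g • x)))) =
      Real.exp (-(t * u g)) * Real.exp (-(t * ψ x)) := fun g => by
    rw [← Real.exp_add]
    simp only [hu]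
    ring_nf
  simp only [hsplit]
  rw [integral_mul_const]
  gcongr
  exact hbound.trans (le_max_left _ _)

end WalkBounds

/-! ### The drift is cohomologous to its mean -/

section Drift

variable {G H X A : Type*}
  [Group G] [TopologicalSpace G] [IsTopologicalGroup G] [T2Space G]
  [SecondCountableTopology G] [MeasurableSpace G] [BorelSpace G]
  [Group H] [Finite H]
  [MetricSpace X] [CompactSpace X] [MulAction G X] [ContinuousSMul G X]
  [MulAction H X] [IsIsometricSMul H X] [SMulCommClass G H X]
  {ρ : Measure G} [IsProbabilityMeasure ρ]

/-- Continuous harmonic functions that factor through an irreducible finite `G`-set are constant. -/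
theorem eq_of_harmonic [MulAction G A] {q : X → A} (hq_smul : ∀ (g : G) x, q (g • x) = g • q x)
    (hirr : IsIrreducibleWalk ρ A) {v : X → ℝ} (hv : Continuous v)
    (hvq : ∀ x y, q x = q y → v x = v y)
    (hharm : ∀ n x, ∫ g, v (g • x) ∂(convPow ρ n) = v x) (x y : X) : v x = v y := by
  obtain ⟨x₀, -, hmax⟩ := isCompact_univ.exists_isMaxOn ⟨x, Set.mem_univ x⟩ hv.continuousOn
  have hmax' : ∀ z, v z ≤ v x₀ := fun z => hmax (Set.mem_univ z)
  have key : ∀ z, v z = v x₀ := by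
    intro z
    obtain ⟨n, hn⟩ := hirr (q x₀) (q z)
    have hint : Integrable (fun g => v (g • x₀)) (convPow ρ n) := by
      obtain ⟨C, hC⟩ := (isCompact_range hv).isBounded.exists_norm_le
      exact Integrable.of_bound (C := C)
        (hv.comp (continuous_id.smul continuous_const)).aestronglyMeasurable
        (Eventually.of_forall fun g => hC _ ⟨_, rfl⟩)
    have h0 : ∫ g, (v x₀ - v (g • x₀)) ∂(convPow ρ n) = 0 := by
      rw [integral_sub (integrable_const _) hint, hharm]
      simp
    have hae := (integral_eq_zero_iff_of_nonneg (fun g => sub_nonneg.2 (hmax' (g • x₀)))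
      ((integrable_const _).sub hint)).1 h0
    obtain ⟨g, hg1, hg2⟩ := ((frequently_ae_mem_iff.2 hn.ne').and_eventually hae).exists
    have h1 : q (g • x₀) = q z := by rw [hq_smul]; exact hg1
    have h2 : v x₀ - v (g • x₀) = 0 := hg2
    rw [← hvq _ _ h1]
    linarith
  rw [key x, key y]

theorem exists_smul_eq_of_mk_eq {x y : X} (h : OrbitSpace.mk H x = OrbitSpace.mk H y) :
    ∃ k : H, k • y = x := Quotient.exact h

/-- `H`-invariant Hölder functions that are invariant under the walk are constant. -/
theorem eq_of_invariant [MulAction G A] {p : OrbitSpace H X → A}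
    (hp_smul : ∀ (g : G) (y : OrbitSpace H X), p (g • y) = g • p y)
    {γ₀ M : ℝ} {N : G → ℝ} (hγ₀ : 0 < γ₀) (hcontr : IsContracted ρ γ₀ M N p)
    (hirr : IsIrreducibleWalk ρ A) {γ : ℝ≥0} (hγ : 0 < γ) (hγγ : (γ : ℝ) ≤ γ₀) (σ : Cocycle G X)
    {u : HolderSpace X γ} (hu : perturbedOp ρ σ 0 u.toC = u.toC)
    (huH : ∀ (h : H) x, u.toC (h • x) = u.toC x) (x y : X) : u.toC x = u.toC y := by
  have hγ0 : (0 : ℝ) < γ := hγ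
  have hpow : ∀ n, (perturbedOp ρ σ 0 ^ n) u.toC = u.toC := fun n => by
    induction n with
    | zero => simp
    | succ n ih => rw [pow_succ', mul_apply_eq_comp, ih, hu]
  have hharm : ∀ n x, ∫ g, u.toC (g • x) ∂(convPow ρ n) = u.toC x := fun n x => by
    rw [← perturbedOp_zero_pow_apply ρ σ, hpow]
  obtain ⟨n₀, -, r, hr0, hr1, hcon⟩ := exists_integral_dist_le (X := X) hγ₀ hcontr hγ0 hγγ
  set L : ℝ := NNReal.toReal (nnHolderNorm γ u.toC) with hL
  have hL0 : 0 ≤ L := (nnHolderNorm γ u.toC).coe_nonneg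
  have hiter : ∀ (k : ℕ) (x y : X), p (OrbitSpace.mk H x) = p (OrbitSpace.mk H y) →
      ‖u.toC x - u.toC y‖ ≤
        L * r ^ k * dist (OrbitSpace.mk H x) (OrbitSpace.mk H y) ^ (γ : ℝ) := by
    intro k
    induction k with
    | zero =>
      intro x y _
      obtain ⟨h, hh⟩ := OrbitSpace.exists_dist_mk_eq (H := H) x y
      rw [← huH h y, ← hh, pow_zero, mul_one]
      exact u.norm_sub_le_nnHolderNorm _ _
    | succ k ih =>
      intro x y hxy
      rw [← hharm n₀ x, ← hharm n₀ y, ← integral_sub (integrable_smul _ _ _) (integrable_smul _ _ _)]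
      refine (norm_integral_le_of_norm_le ((integrable_dist_mk_smul_rpow (H := H) (convPow ρ n₀) x y
        hγ0.le).const_mul (L * r ^ k)) (Eventually.of_forall fun g => ?_)).trans ?_
      · refine ih (g • x) (g • y) ?_
        rw [← OrbitSpace.smul_mk, ← OrbitSpace.smul_mk, hp_smul, hp_smul, hxy]
      · rw [integral_const_mul, pow_succ]
        calc _ ≤ L * r ^ k *
              (r * dist (OrbitSpace.mk H x) (OrbitSpace.mk H y) ^ (γ : ℝ)) := by
              gcongr
              exact hcon x y hxy
          _ = _ := by ring
  have hfib : ∀ x y : X, p (OrbitSpace.mk H x) = p (OrbitSpace.mk H y) → u.toC x = u.toC y := by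
    intro x y hxy
    have h1 : Tendsto (fun k : ℕ => L * r ^ k *
        dist (OrbitSpace.mk H x) (OrbitSpace.mk H y) ^ (γ : ℝ)) atTop (𝓝 0) := by
      simpa using ((tendsto_pow_atTop_nhds_zero_of_lt_one hr0 hr1).const_mul L).mul_const
        (dist (OrbitSpace.mk H x) (OrbitSpace.mk H y) ^ (γ : ℝ))
    have h2 := ge_of_tendsto' h1 fun k => hiter k x y hxy
    exact sub_eq_zero.1 (norm_le_zero_iff.1 h2)
  have hq : ∀ (g : G) (x : X), p (OrbitSpace.mk H (g • x)) = g • p (OrbitSpace.mk H x) :=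
    fun g x => by rw [← OrbitSpace.smul_mk, hp_smul]
  refine Complex.ext ?_ ?_
  · refine eq_of_harmonic (q := fun x => p (OrbitSpace.mk H x)) (v := fun x => (u.toC x).re) hq hirr
      (Complex.continuous_re.comp u.toC.continuous) (fun x y hxy => by rw [hfib x y hxy])
      (fun n x => ?_) x y
    exact (integral_re (integrable_smul _ u.toC x)).trans (congrArg Complex.re (hharm n x))
  · refine eq_of_harmonic (q := fun x => p (OrbitSpace.mk H x)) (v := fun x => (u.toC x).im) hq hirr
      (Complex.continuous_im.comp u.toC.continuous) (fun x y hxy => by rw [hfib x y hxy])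
      (fun n x => ?_) x y
    exact (integral_im (integrable_smul _ u.toC x)).trans (congrArg Complex.im (hharm n x))

instance : CompactSpace (OrbitSpace H X) :=
  (OrbitSpace.mk_surjective H).compactSpace (OrbitSpace.continuous_mk H X)

/-- A function on `X / H` that is cohomologous on `X` to a constant has this constant as mean. -/
theorem integral_eq_of_cohomologous {ν : Measure (OrbitSpace H X)} [IsProbabilityMeasure ν]
    (hν : IsStationary ρ ν) {η : OrbitSpace H X → ℝ} {χ : C(X, ℝ)} {b : ℝ}
    (h : ∀ x, η (OrbitSpace.mk H x) = b + χ x - ∫ g, χ (g • x) ∂ρ) : ∫ y, η y ∂ν = b := by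
  have := Fintype.ofFinite H
  have hcard : (Fintype.card H : ℝ) ≠ 0 := by exact_mod_cast Fintype.card_ne_zero
  have hquot : IsQuotientMap (OrbitSpace.mk H : X → OrbitSpace H X) :=
    (OrbitSpace.continuous_mk H X).isClosedMap.isQuotientMap (OrbitSpace.continuous_mk H X)
      (OrbitSpace.mk_surjective H)
  have hsmul : ∀ k : H, Continuous fun x : X => k • x := fun k => (isometry_smul X k).continuous
  set χ' : X → ℝ := fun x => (Fintype.card H : ℝ)⁻¹ * ∑ k : H, χ (k • x) with hχ'
  have hχ'c : Continuous χ' :=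
    continuous_const.mul (continuous_finsetSum _ fun k _ => χ.continuous.comp (hsmul k))
  have hχ'H : ∀ (k : H) x, χ' (k • x) = χ' x := by
    intro k x
    simp only [hχ', smul_smul]
    congr 1
    exact Fintype.sum_equiv (Equiv.mulRight k) _ _ fun l => rfl
  let ψ : C(OrbitSpace H X, ℝ) :=
    ⟨fun y => χ' (Function.surjInv (OrbitSpace.mk_surjective H) y), by
      refine hquot.continuous_iff.2 (hχ'c.congr fun x => ?_)
      obtain ⟨k, hk⟩ := exists_smul_eq_of_mk_eq (H := H)
        (Function.surjInv_eq (OrbitSpace.mk_surjective H) (OrbitSpace.mk H x))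
      simp only [Function.comp]
      rw [← hk, hχ'H]⟩
  have hψ : ∀ x, ψ (OrbitSpace.mk H x) = χ' x := fun x => by
    obtain ⟨k, hk⟩ := exists_smul_eq_of_mk_eq (H := H)
      (Function.surjInv_eq (OrbitSpace.mk_surjective H) (OrbitSpace.mk H x))
    change χ' (Function.surjInv (OrbitSpace.mk_surjective H) (OrbitSpace.mk H x)) = χ' x
    rw [← hk, hχ'H]
  have hiχ : ∀ x, Integrable (fun g => χ (g • x)) ρ := fun x =>
    Integrable.of_bound (C := ‖χ‖)
      (χ.continuous.comp (continuous_id.smul continuous_const)).aestronglyMeasurable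
      (Eventually.of_forall fun _ => χ.norm_coe_le_norm _)
  have hη : ∀ y, η y = b + ψ y - ∫ g, ψ (g • y) ∂ρ := by
    intro y
    obtain ⟨x, rfl⟩ := OrbitSpace.mk_surjective H y
    simp only [OrbitSpace.smul_mk, hψ, hχ']
    rw [integral_const_mul, integral_finsetSum _ fun k _ => by
      simpa only [smul_comm] using hiχ (k • x)]
    have h1 : ∀ k : H, ∫ g, χ (k • g • x) ∂ρ = b + χ (k • x) - η (OrbitSpace.mk H x) := by
      intro k
      have := h (k • x)
      rw [OrbitSpace.mk_smul] at this
      simp only [smul_comm _ k] at this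
      linarith
    simp only [h1]
    rw [Finset.sum_sub_distrib, Finset.sum_add_distrib]
    simp only [Finset.sum_const, Finset.card_univ, nsmul_eq_mul]
    field_simp
    ring
  have hgc : ∀ g : G, Continuous fun y : OrbitSpace H X => g • y := fun g => by
    refine hquot.continuous_iff.2 ?_
    exact (OrbitSpace.continuous_mk H X).comp (continuous_const_smul g)
  have hgc' : ∀ y : OrbitSpace H X, Continuous fun g : G => g • y := fun y => by
    obtain ⟨x, rfl⟩ := OrbitSpace.mk_surjective H y
    exact (OrbitSpace.continuous_mk H X).comp (continuous_id.smul continuous_const)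
  have hΦc : Continuous fun y => ∫ g, ψ (g • y) ∂ρ :=
    continuous_of_dominated (bound := fun _ => ‖ψ‖)
      (fun y => (ψ.continuous.comp (hgc' y)).aestronglyMeasurable)
      (fun y => Eventually.of_forall fun g => ψ.norm_coe_le_norm _) (integrable_const _)
      (Eventually.of_forall fun g => ψ.continuous.comp (hgc g))
  have hiψ : Integrable ψ ν := Integrable.of_bound (C := ‖ψ‖) ψ.continuous.aestronglyMeasurable
    (Eventually.of_forall fun y => ψ.norm_coe_le_norm y)
  have hiΦ : Integrable (fun y => ∫ g, ψ (g • y) ∂ρ) ν := by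
    refine Integrable.of_bound (C := ‖ψ‖) hΦc.aestronglyMeasurable
      (Eventually.of_forall fun y => ?_)
    refine (norm_integral_le_of_norm_le_const (C := ‖ψ‖)
      (Eventually.of_forall fun g => ψ.norm_coe_le_norm _)).trans ?_
    simp
  have hibψ : Integrable (fun y => b + ψ y) ν := (integrable_const b).add hiψ
  simp only [hη]
  rw [integral_sub hibψ hiΦ, integral_add (integrable_const b) hiψ, hν ψ]
  simp

theorem mean_eq_integral {σ : Cocycle G (OrbitSpace H X)} {ν : Measure (OrbitSpace H X)}
    [IsProbabilityMeasure ν] {q : X → A} {γ : ℝ≥0} {s D : ℝ} {n : G → ℝ}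
    (hW : WalkBounds ρ σ.lift q γ s D n) :
    σ.mean ρ ν = ∫ y, ∫ g, σ.toFun g y ∂ρ ∂ν := by
  rw [Cocycle.mean]
  refine integral_integral_swap (f := fun g y => σ.toFun g y) ?_
  refine ((hW.moment.const_mul (s⁻¹ * D)).comp_fst ν).mono' ?_ (Eventually.of_forall fun z => ?_)
  · exact σ.continuous_toFun.aestronglyMeasurable
  · obtain ⟨g, y⟩ := z
    obtain ⟨x, rfl⟩ := OrbitSpace.mk_surjective H y
    exact hW.abs_le g x

/-- The drift `∫ σ(g, x) dρ(g)` is cohomologous to the mean of the cocycle. -/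
theorem exists_corrector [MulAction G A] {p : OrbitSpace H X → A}
    (hp_smul : ∀ (g : G) (y : OrbitSpace H X), p (g • y) = g • p y)
    {γ₀ M : ℝ} {N : G → ℝ} (hγ₀ : 0 < γ₀) (hcontr : IsContracted ρ γ₀ M N p)
    (hirr : IsIrreducibleWalk ρ A) {γ : ℝ≥0} (hγ : 0 < γ) (hγγ : (γ : ℝ) ≤ γ₀)
    {σ : Cocycle G (OrbitSpace H X)} {ν : Measure (OrbitSpace H X)} [IsProbabilityMeasure ν]
    (hν : IsStationary ρ ν) {q : X → A} {s D : ℝ} {n : G → ℝ}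
    (hW : WalkBounds ρ σ.lift q γ s D n)
    {T : HolderSpace X γ →L[ℂ] HolderSpace X γ}
    (hDF : DoeblinFortet (HolderSpace.toCL (X := X) (γ := γ)) T (perturbedOp ρ σ.lift 0))
    {φ : HolderSpace X γ} (hφ : ∀ x, φ.toC x = ∫ g, (σ.lift.toFun g x : ℂ) ∂ρ) :
    ∃ ψ : HolderSpace X γ, ∀ x, φ.toC x =
      (σ.mean ρ ν : ℂ) + ψ.toC x - ∫ g, ψ.toC (g • x) ∂ρ := by
  set P := perturbedOp ρ σ.lift 0 with hP
  obtain ⟨N₀, hN⟩ := hDF.exists_isErgodicLimit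
  obtain ⟨Q, hQ, hQQ, hTQ, hQT, hunit⟩ := hDF.exists_projector hN
  have hX : Nonempty X := by
    obtain ⟨y⟩ := ν.nonempty_of_neZero
    obtain ⟨x, -⟩ := OrbitSpace.mk_surjective H y
    exact ⟨x⟩
  obtain ⟨x₀⟩ := hX
  -- the projection of the drift is constant
  have hconst : ∀ x, (Q φ).toC x = (Q φ).toC x₀ := by
    intro x
    refine eq_of_invariant hp_smul hγ₀ hcontr hirr hγ hγγ σ.lift ?_ (fun k => ?_) x x₀
    · have := hDF.intertwine (Q φ)
      rw [← mul_apply_eq_comp, hTQ] at this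
      exact this.symm
    · let S : Submodule ℂ C(X, ℂ) :=
        { carrier := {f | ∀ x, f (k • x) = f x}
          add_mem' := fun {f g} hf hg x => by
            rw [ContinuousMap.add_apply, ContinuousMap.add_apply, hf x, hg x]
          zero_mem' := fun x => rfl
          smul_mem' := fun c f hf x => by
            rw [ContinuousMap.smul_apply, ContinuousMap.smul_apply, hf x] }
      have hS : IsClosed (S : Set C(X, ℂ)) := by
        have : (S : Set C(X, ℂ)) = ⋂ x, {f : C(X, ℂ) | f (k • x) = f x} := by
          ext f
          simp only [Set.mem_iInter]
          rfl
        rw [this]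
        exact isClosed_iInter fun x =>
          isClosed_eq (continuous_eval_const _) (continuous_eval_const _)
      have hmem : N₀ φ.toC ∈ S := by
        refine hN.mem_of_stable S hS (fun f hf x => ?_) fun x => ?_
        · rw [hP, perturbedOp_zero_apply, perturbedOp_zero_apply]
          have hf' : ∀ x, f (k • x) = f x := hf
          simp only [smul_comm _ k, hf']
        · rw [hφ, hφ]
          have : ∀ g, σ.lift.toFun g (k • x) = σ.lift.toFun g x := fun g => by
            simp only [Cocycle.lift, OrbitSpace.mk_smul]
          simp only [this]
      intro x
      have h1 : (Q φ).toC = N₀ φ.toC := hQ φ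
      rw [h1]
      exact hmem x
  obtain ⟨ψ, hψ⟩ := (ContinuousLinearMap.isUnit_iff_bijective.1 hunit).2 (φ - Q φ)
  have hQL : Q * (1 - T + Q) = Q := by rw [mul_add, mul_sub, mul_one, hQT, hQQ, sub_self, zero_add]
  have hQψ : Q ψ = 0 := by
    have h1 : Q ((1 - T + Q) ψ) = Q ψ := DFunLike.congr_fun hQL ψ
    rw [← h1, hψ, map_sub, ← mul_apply_eq_comp Q Q, hQQ, sub_self]
  have hψ' : ψ - T ψ = φ - Q φ := by
    rw [← hψ, add_apply, hQψ, add_zero]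
    rfl
  have hTψ : ∀ x, (T ψ).toC x = ∫ g, ψ.toC (g • x) ∂ρ := fun x => by
    have : (T ψ).toC = P ψ.toC := hDF.intertwine ψ
    rw [this, hP, perturbedOp_zero_apply]
  set c := (Q φ).toC x₀ with hc
  have heq : ∀ x, φ.toC x = c + ψ.toC x - ∫ g, ψ.toC (g • x) ∂ρ := fun x => by
    have h1 := congrArg (fun f : HolderSpace X γ => f.toC x) hψ'
    simp only [HolderSpace.toC_sub, ContinuousMap.sub_apply, hTψ, hconst x] at h1
    linear_combination -h1
  have hre : c.re = σ.mean ρ ν := by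
    rw [mean_eq_integral hW]
    symm
    refine integral_eq_of_cohomologous hν (η := fun y => ∫ g, σ.toFun g y ∂ρ)
      (χ := ⟨fun x => (ψ.toC x).re, Complex.continuous_re.comp ψ.toC.continuous⟩) fun x => ?_
    have h1 := congrArg Complex.re (heq x)
    have h2 : ∫ g, (ψ.toC (g • x)).re ∂ρ = (∫ g, ψ.toC (g • x) ∂ρ).re :=
      integral_re (integrable_smul ρ ψ.toC x)
    rw [hφ, integral_complex_ofReal, Complex.ofReal_re, Complex.sub_re, Complex.add_re, ← h2] at h1
    exact h1
  have him : c.im = 0 := by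
    have h0 : ∫ y : OrbitSpace H X, (0 : ℝ) ∂ν = c.im := by
      refine integral_eq_of_cohomologous hν (η := fun _ => 0)
        (χ := ⟨fun x => (ψ.toC x).im, Complex.continuous_im.comp ψ.toC.continuous⟩) fun x => ?_
      have h1 := congrArg Complex.im (heq x)
      have h2 : ∫ g, (ψ.toC (g • x)).im ∂ρ = (∫ g, ψ.toC (g • x) ∂ρ).im :=
        integral_im (integrable_smul ρ ψ.toC x)
      rw [hφ, integral_complex_ofReal, Complex.ofReal_im, Complex.sub_im, Complex.add_im,
        ← h2] at h1
      exact h1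
    rw [← h0, integral_zero]
  refine ⟨ψ, fun x => ?_⟩
  rw [heq x, ← hre]
  congr 2
  exact Complex.ext (by simp) (by simp [him])

end Drift

/-! ### The regular part of the resolvent -/

section RegularPart

variable {G X A : Type*} [Group G] [TopologicalSpace G] [SecondCountableTopology G]
  [MeasurableSpace G] [BorelSpace G] [IsTopologicalGroup G] [T2Space G] [MetricSpace X]
  [CompactSpace X] [MulAction G X] [ContinuousSMul G X] {ρ : Measure G} [IsProbabilityMeasure ρ]
  {σ : Cocycle G X} {γ : ℝ≥0}

theorem IsResolvent.unique {t : ℝ} {S S' : HolderSpace X γ →L[ℂ] HolderSpace X γ}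
    (h : IsResolvent ρ σ t S) (h' : IsResolvent ρ σ t S') : S = S' := by
  obtain ⟨T, hT, -, h2⟩ := h
  obtain ⟨T', hT', h1', -⟩ := h'
  have : T = T' := by
    ext1 f
    exact HolderSpace.ext_toC (by rw [hT, hT'])
  subst this
  calc S = S * ((1 - T) * S') := by rw [h1', mul_one]
    _ = S' := by rw [← mul_assoc, h2, one_mul]

theorem norm_pow_perturbedOp_zero_le (i : ℕ) (f : C(X, ℂ)) :
    ‖(perturbedOp ρ σ 0 ^ i) f‖ ≤ 1 * ‖f‖ := by
  rw [one_mul]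
  induction i with
  | zero => simp
  | succ i ih =>
    rw [pow_succ', mul_apply_eq_comp]
    exact (norm_perturbedOp_zero_le ρ σ _).trans ih

theorem IsErgodicLimit.isInvariantProjector {N₀ : C(X, ℂ) →L[ℂ] C(X, ℂ)}
    (hN : IsErgodicLimit (perturbedOp ρ σ 0) N₀) :
    IsInvariantProjector (perturbedOp ρ σ 0) N₀ where
  idempotent := hN.mul_self norm_pow_perturbedOp_zero_le
  range_eq _ := hN.apply_eq_self_iff norm_pow_perturbedOp_zero_le
  commute := by
    rw [hN.mul_left_eq norm_pow_perturbedOp_zero_le, hN.mul_right_eq norm_pow_perturbedOp_zero_le]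

variable {q : X → A} {s D : ℝ} {n : G → ℝ}

theorem WalkBounds.exists_isRegularPart (h : WalkBounds ρ σ q γ s D n)
    {P : ℂ → HolderSpace X γ →L[ℂ] HolderSpace X γ}
    (hP : ∀ z : ℂ, |z.re| < s → ∀ f x, (P z f).toC x = twisted ρ σ z f.toC x)
    (hPan : ∀ z : ℂ, |z.re| < s → AnalyticAt ℂ P z)
    {D' : HolderSpace X γ →L[ℂ] HolderSpace X γ} (hD' : HasDerivAt P D' 0)
    (hD'_apply : ∀ f x, (D' f).toC x = -∫ g, (σ.toFun g x : ℂ) * f.toC (g • x) ∂ρ)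
    (hDF : DoeblinFortet (HolderSpace.toCL (X := X) (γ := γ)) (P 0) (perturbedOp ρ σ 0))
    {N₀ : C(X, ℂ) →L[ℂ] C(X, ℂ)} (hN : IsErgodicLimit (perturbedOp ρ σ 0) N₀)
    {m : ℝ} (hm : m ≠ 0) {ψ : C(X, ℂ)}
    (hψ : ∀ x, ∫ g, (σ.toFun g x : ℂ) ∂ρ = m + ψ x - ∫ g, ψ (g • x) ∂ρ)
    (hres : ∀ t : ℝ, t ≠ 0 →
      ∃ S : HolderSpace X γ →L[ℂ] HolderSpace X γ, IsResolvent ρ σ t S) :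
    ∃ U : ℂ → HolderSpace X γ →L[ℂ] HolderSpace X γ, IsRegularPart ρ σ m N₀ U := by
  have hm' : (m : ℂ) ≠ 0 := by exact_mod_cast hm
  obtain ⟨Q, hQ, hQQ, hTQ, hQT, hunit⟩ := hDF.exists_projector hN
  have hQN : ∀ f, (Q f).toC = N₀ f.toC := hQ
  have hPt : ∀ (t : ℝ) f, (P (Complex.I * t) f).toC = perturbedOp ρ σ t f.toC := fun t f => by
    ext x
    rw [hP _ (by simpa using h.s_pos), twisted_eq_perturbedOp]
  have hder : HasDerivAt (fun z => 1 - P z) (-D') 0 := by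
    simpa using hD'.const_sub 1
  have hQD : Q * -D' * Q = (m : ℂ) • Q := by
    ext1 f
    refine HolderSpace.ext_toC ?_
    rw [mul_apply_eq_comp, mul_apply_eq_comp, hQN]
    have hfix : perturbedOp ρ σ 0 (Q f).toC = (Q f).toC := by
      have := hDF.intertwine (Q f)
      rw [← mul_apply_eq_comp, hTQ] at this
      exact this.symm
    rw [h.apply_deriv_eq hN hψ hfix fun x => ?_]
    · rfl
    · have h1 : ((-D') (Q f)).toC = -(D' (Q f)).toC := by
        rw [neg_apply, HolderSpace.toC_neg]
      rw [h1, ContinuousMap.neg_apply, hD'_apply, neg_neg]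
  have h0 : AnalyticAt ℂ (fun z => 1 - P z) 0 := analyticAt_const.sub (hPan 0 (by simpa using h.s_pos))
  obtain ⟨V, hV, hVeq⟩ := exists_regular_part h0 hder rfl hQQ hTQ hQT hunit hm' hQD
  set R : ℂ → HolderSpace X γ →L[ℂ] HolderSpace X γ :=
    fun z => Ring.inverse (1 - P z) - (m * z)⁻¹ • Q with hR
  have hRes : ∀ t : ℝ, t ≠ 0 → ∃ u : (HolderSpace X γ →L[ℂ] HolderSpace X γ)ˣ,
      (u : HolderSpace X γ →L[ℂ] HolderSpace X γ) = 1 - P (Complex.I * t) := fun t ht => by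
    obtain ⟨S, T, hT, h1, h2⟩ := hres t ht
    have hTP : T = P (Complex.I * t) := by
      ext1 f
      exact HolderSpace.ext_toC (by rw [hT, hPt])
    rw [hTP] at h1 h2
    exact ⟨⟨1 - P (Complex.I * t), S, h1, h2⟩, rfl⟩
  refine ⟨fun z => if z = 0 then V 0 else R z, fun z hz => ?_, fun t ht => ?_⟩
  · have hz' : z.re = 0 := hz
    rcases eq_or_ne z 0 with rfl | hz0
    · refine hV.congr ?_
      rw [eventually_nhdsWithin_iff] at hVeq
      filter_upwards [hVeq] with w hw
      rcases eq_or_ne w 0 with rfl | hw0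
      · simp
      · rw [if_neg hw0, hw hw0]
    · have hzt : z = Complex.I * (z.im : ℝ) := by
        apply Complex.ext <;> simp [hz']
      have ht : z.im ≠ 0 := fun h' => hz0 (by rw [hzt, h']; simp)
      obtain ⟨u, hu⟩ := hRes z.im ht
      rw [← hzt] at hu
      have h1 : AnalyticAt ℂ (fun w => 1 - P w) z :=
        analyticAt_const.sub (hPan z (by simpa [hz'] using h.s_pos))
      have h2 : AnalyticAt ℂ Ring.inverse (1 - P z) := by
        rw [← hu]
        exact analyticAt_inverse u
      have h3 : AnalyticAt ℂ (fun w => Ring.inverse (1 - P w)) z :=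
        AnalyticAt.comp (g := Ring.inverse) (f := fun w => 1 - P w) h2 h1
      have h4 : AnalyticAt ℂ (fun w : ℂ => ((m : ℂ) * w)⁻¹) z :=
        (analyticAt_const.mul analyticAt_id).inv (mul_ne_zero hm' hz0)
      refine (h3.sub (h4.smul (analyticAt_const (v := Q)))).congr ?_
      filter_upwards [isOpen_ne.mem_nhds hz0] with w hw
      rw [if_neg hw]
      rfl
  · obtain ⟨u, hu⟩ := hRes t ht
    have ht' : Complex.I * t ≠ 0 := mul_ne_zero Complex.I_ne_zero (by exact_mod_cast ht)
    refine ⟨(u⁻¹ : (HolderSpace X γ →L[ℂ] HolderSpace X γ)ˣ),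
      ⟨P (Complex.I * t), hPt t, by rw [← hu, Units.mul_inv], by rw [← hu, Units.inv_mul]⟩,
      fun f => ?_⟩
    simp only [if_neg ht', hR]
    rw [← hu, Ring.inverse_unit, sub_apply, smul_apply, HolderSpace.toC_sub, HolderSpace.toC_smul,
      hQN]

end RegularPart

/-! ### Summation of the iterates of the walk on `X × ℝ` -/

section Iterates

variable {G X : Type*} [Group G] [TopologicalSpace G] [SecondCountableTopology G]
  [MeasurableSpace G] [BorelSpace G] [MetricSpace X] [MulAction G X] [ContinuousSMul G X]
  {ρ : Measure G} [IsProbabilityMeasure ρ] {σ : Cocycle G X}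

theorem continuous_walk (σ : Cocycle G X) {f : X × ℝ → ℂ} (hf : Continuous f) :
    Continuous fun w : G × (X × ℝ) => f (w.1 • w.2.1, w.2.2 + σ.toFun w.1 w.2.1) := by
  refine hf.comp (Continuous.prodMk ?_ ?_)
  · exact continuous_fst.smul (continuous_fst.comp continuous_snd)
  · exact (continuous_snd.comp continuous_snd).add
      (σ.continuous_toFun.comp (continuous_fst.prodMk (continuous_fst.comp continuous_snd)))

theorem integrable_walk {f : X × ℝ → ℂ} (hf : Continuous f) {C : ℝ} (hC : ∀ q, ‖f q‖ ≤ C)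
    (q : X × ℝ) : Integrable (fun g => f (g • q.1, q.2 + σ.toFun g q.1)) ρ :=
  Integrable.of_bound (C := C)
    ((continuous_walk σ hf).comp (Continuous.prodMk_left q)).aestronglyMeasurable
    (Eventually.of_forall fun _ => hC _)

theorem norm_walkOp_le {f : X × ℝ → ℂ} {C : ℝ} (hC : ∀ q, ‖f q‖ ≤ C) (q : X × ℝ) :
    ‖walkOp ρ σ f q‖ ≤ C := by
  refine (norm_integral_le_of_norm_le_const (C := C) (Eventually.of_forall fun g => hC _)).trans ?_
  simp

theorem continuous_walkOp {f : X × ℝ → ℂ} (hf : Continuous f) {C : ℝ} (hC : ∀ q, ‖f q‖ ≤ C) :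
    Continuous (walkOp ρ σ f) :=
  continuous_of_dominated (bound := fun _ => C)
    (fun q => (integrable_walk hf hC q).aestronglyMeasurable)
    (fun q => Eventually.of_forall fun g => hC _) (integrable_const _)
    (Eventually.of_forall fun g => (continuous_walk σ hf).comp (Continuous.prodMk_right g))

theorem continuous_iterate_walkOp {f : X × ℝ → ℂ} (hf : Continuous f) {C : ℝ}
    (hC : ∀ q, ‖f q‖ ≤ C) (k : ℕ) :
    Continuous ((walkOp ρ σ)^[k] f) ∧ ∀ q, ‖(walkOp ρ σ)^[k] f q‖ ≤ C := by
  induction k with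
  | zero => exact ⟨hf, hC⟩
  | succ k ih =>
    rw [Function.iterate_succ_apply']
    exact ⟨continuous_walkOp ih.1 ih.2, norm_walkOp_le ih.2⟩

theorem iterate_walkOp_sub {f v : X × ℝ → ℂ} (hf : Continuous f) {C : ℝ} (hC : ∀ q, ‖f q‖ ≤ C)
    (hv : Continuous v) {C' : ℝ} (hC' : ∀ q, ‖v q‖ ≤ C') (k : ℕ) (q : X × ℝ) :
    (walkOp ρ σ)^[k] (fun q => v q - f q) q =
      (walkOp ρ σ)^[k] v q - (walkOp ρ σ)^[k] f q := by
  induction k generalizing q with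
  | zero => rfl
  | succ k ih =>
    simp only [Function.iterate_succ_apply']
    obtain ⟨h1, h2⟩ := continuous_iterate_walkOp (ρ := ρ) (σ := σ) hf hC k
    obtain ⟨h3, h4⟩ := continuous_iterate_walkOp (ρ := ρ) (σ := σ) hv hC' k
    rw [walkOp, walkOp, walkOp, ← integral_sub (integrable_walk h3 h4 q) (integrable_walk h1 h2 q)]
    simp only [ih]

theorem norm_iterate_walkOp_le {h : X × ℝ → ℝ} {κ : ℝ} (hκ : 0 ≤ κ)
    (hint : ∀ q : X × ℝ, Integrable (fun g => h (g • q.1, q.2 + σ.toFun g q.1)) ρ)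
    (hh : ∀ q : X × ℝ, ∫ g, h (g • q.1, q.2 + σ.toFun g q.1) ∂ρ ≤ κ * h q)
    {u : X × ℝ → ℂ} {ε C : ℝ} (hC : 0 ≤ C) (hu : ∀ q, ‖u q‖ ≤ ε + C * h q) (k : ℕ) (q : X × ℝ) :
    ‖(walkOp ρ σ)^[k] u q‖ ≤ ε + C * κ ^ k * h q := by
  induction k generalizing q with
  | zero => simpa using hu q
  | succ k ih =>
    rw [Function.iterate_succ_apply']
    have hi : Integrable (fun g => C * κ ^ k * h (g • q.1, q.2 + σ.toFun g q.1)) ρ :=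
      (hint q).const_mul _
    refine (norm_integral_le_of_norm_le ((integrable_const ε).add hi)
      (Eventually.of_forall fun g => ih _)).trans ?_
    rw [integral_add' (integrable_const ε) hi, integral_const_mul, integral_const, probReal_univ,
      one_smul, pow_succ]
    have : C * κ ^ k * ∫ g, h (g • q.1, q.2 + σ.toFun g q.1) ∂ρ ≤ C * κ ^ k * (κ * h q) := by
      gcongr
      exact hh q
    linarith

/-- If `v - P v = f` and `v` is small where the strict supersolution `h` is small, then
`v = ∑ P^n f`. -/
theorem hasSum_iterate_walkOp {f v : X × ℝ → ℂ} (hf : Continuous f) {B : ℝ} (hB : ∀ q, ‖f q‖ ≤ B)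
    (hv : Continuous v) {B' : ℝ} (hB' : ∀ q, ‖v q‖ ≤ B')
    (hvf : ∀ q, walkOp ρ σ v q = v q - f q) {h : X × ℝ → ℝ} {κ : ℝ} (hκ : 0 ≤ κ) (hκ1 : κ < 1)
    (hint : ∀ q : X × ℝ, Integrable (fun g => h (g • q.1, q.2 + σ.toFun g q.1)) ρ)
    (hh : ∀ q : X × ℝ, ∫ g, h (g • q.1, q.2 + σ.toFun g q.1) ∂ρ ≤ κ * h q)
    {C : ℝ} (hC : 0 ≤ C) (hfh : ∀ q, ‖f q‖ ≤ C * h q)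
    (hvh : ∀ ε : ℝ, 0 < ε → ∃ C : ℝ, 0 ≤ C ∧ ∀ q, ‖v q‖ ≤ ε + C * h q) (q : X × ℝ) :
    HasSum (fun k => (walkOp ρ σ)^[k] f q) (v q) := by
  have hlim : ∀ c : ℝ, Tendsto (fun k : ℕ => c * κ ^ k * h q) atTop (𝓝 0) := fun c => by
    simpa using ((tendsto_pow_atTop_nhds_zero_of_lt_one hκ hκ1).const_mul c).mul_const (h q)
  have hsum : Summable fun k => (walkOp ρ σ)^[k] f q := by
    refine Summable.of_norm_bounded (g := fun k => C * κ ^ k * h q)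
      (((summable_geometric_of_lt_one hκ hκ1).mul_left C).mul_right (h q)) fun k => ?_
    simpa using norm_iterate_walkOp_le hκ hint hh (ε := 0) hC (fun q => by simpa using hfh q) k q
  have hv0 : Tendsto (fun k => (walkOp ρ σ)^[k] v q) atTop (𝓝 0) := by
    rw [Metric.tendsto_atTop]
    intro ε hε
    obtain ⟨c, hc, hvc⟩ := hvh (ε / 2) (by positivity)
    obtain ⟨k₀, hk₀⟩ := Metric.tendsto_atTop.1 (hlim c) (ε / 2) (by positivity)
    refine ⟨k₀, fun k hk => ?_⟩
    have h1 := norm_iterate_walkOp_le hκ hint hh hc hvc k q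
    have h2 := hk₀ k hk
    rw [Real.dist_eq, sub_zero] at h2
    rw [dist_zero_right]
    linarith [le_abs_self (c * κ ^ k * h q)]
  have hpart : ∀ k, ∑ i ∈ Finset.range k, (walkOp ρ σ)^[i] f q = v q - (walkOp ρ σ)^[k] v q := by
    intro k
    induction k with
    | zero => simp
    | succ k ih =>
      have h1 : walkOp ρ σ v = fun q => v q - f q := funext hvf
      rw [Finset.sum_range_succ, ih, Function.iterate_succ_apply, h1,
        iterate_walkOp_sub hf hB hv hB']
      ring
  rw [hsum.hasSum_iff_tendsto_nat]
  simp only [hpart]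
  simpa using hv0.const_sub (v q)

end Iterates

/-! ### Fourier integrals on the line -/

section Fourier

open scoped FourierTransform

variable {E : Type*} [NormedAddCommGroup E] [NormedSpace ℂ E]

theorem norm_exp_I_mul (ξ t : ℝ) : ‖Complex.exp (Complex.I * ξ * t)‖ = 1 := by
  rw [Complex.norm_exp]
  simp

theorem norm_exp_neg_I_mul (ξ t : ℝ) : ‖Complex.exp (-(Complex.I * ξ * t))‖ = 1 := by
  rw [Complex.norm_exp]
  simp

theorem integrable_exp_smul {φ : ℝ → E} (hφ : Integrable φ) (t : ℝ) :
    Integrable fun ξ : ℝ => Complex.exp (Complex.I * ξ * t) • φ ξ := by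
  refine hφ.norm.mono' (AEStronglyMeasurable.smul ?_ hφ.aestronglyMeasurable)
    (Eventually.of_forall fun ξ => ?_)
  · exact (by fun_prop : Continuous fun ξ : ℝ => Complex.exp (Complex.I * ξ * t)).aestronglyMeasurable
  · rw [norm_smul, norm_exp_I_mul, one_mul]

theorem fourier_div_two_pi (f : ℝ → E) (ξ : ℝ) :
    𝓕 f (ξ / (2 * Real.pi)) = ∫ t : ℝ, Complex.exp (-(Complex.I * ξ * t)) • f t := by
  rw [Real.fourier_real_eq_integral_exp_smul]
  congr 1
  ext t
  congr 2
  push_cast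
  field_simp

theorem fourier_eq_integral (f : ℝ → E) (w : ℝ) :
    𝓕 f w = ∫ t : ℝ, Complex.exp (-(Complex.I * ((2 * Real.pi * w : ℝ) : ℂ) * t)) • f t := by
  rw [← fourier_div_two_pi]
  field_simp

theorem eq_integral_fourier [CompleteSpace E] {f : ℝ → E} (hf : Continuous f) (hfi : Integrable f)
    {a : ℝ → E} (ha : ∀ ξ, a ξ = ∫ t : ℝ, Complex.exp (-(Complex.I * ξ * t)) • f t)
    (hai : Integrable a) (t : ℝ) :
    f t = (2 * Real.pi : ℂ)⁻¹ • ∫ ξ : ℝ, Complex.exp (Complex.I * ξ * t) • a ξ := by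
  have hFa : 𝓕 f = fun w => a (2 * Real.pi * w) := by
    ext w
    rw [fourier_eq_integral, ha]
  have hFi : Integrable (𝓕 f) := by
    rw [hFa]
    exact hai.comp_mul_left' (by positivity)
  have h1 := congrFun (hf.fourierInv_fourier_eq hfi hFi) t
  rw [← h1, Real.fourierInv_eq', hFa]
  have h2 := Measure.integral_comp_mul_left
    (fun ξ : ℝ => Complex.exp (Complex.I * ξ * t) • a ξ) (2 * Real.pi)
  have h3 : |(2 * Real.pi)⁻¹| = (2 * Real.pi)⁻¹ := abs_of_pos (by positivity)
  rw [h3] at h2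
  have h4 : (2 * Real.pi : ℂ)⁻¹ = (((2 * Real.pi)⁻¹ : ℝ) : ℂ) := by push_cast; rfl
  rw [h4, Complex.coe_smul, ← h2]
  congr 1
  ext w
  congr 2
  simp only [RCLike.inner_apply, conj_trivial]
  push_cast
  ring

theorem integral_exp_smul_iteratedDeriv {f : ℝ → E} {k : ℕ} (hf : ContDiff ℝ k f)
    (hfi : ∀ m ≤ k, Integrable (iteratedDeriv m f)) (ξ : ℝ) :
    ∫ t : ℝ, Complex.exp (-(Complex.I * ξ * t)) • iteratedDeriv k f t =
      (Complex.I * ξ) ^ k • ∫ t : ℝ, Complex.exp (-(Complex.I * ξ * t)) • f t := by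
  rw [← fourier_div_two_pi, ← fourier_div_two_pi]
  have h := congrFun (Real.fourier_iteratedDeriv (N := k) (n := k) (by exact_mod_cast hf)
    (fun m hm => hfi m (by exact_mod_cast hm)) le_rfl) (ξ / (2 * Real.pi))
  rw [h]
  congr 2
  push_cast
  field_simp

theorem tendsto_integral_exp_smul (φ : ℝ → E) :
    Tendsto (fun t : ℝ => ∫ ξ : ℝ, Complex.exp (Complex.I * ξ * t) • φ ξ) atTop (𝓝 0) := by
  have h := Real.zero_at_infty_fourier φ
  have h1 : Tendsto (fun t : ℝ => (-t) / (2 * Real.pi)) atTop (cocompact ℝ) := by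
    refine Tendsto.mono_right ?_ atBot_le_cocompact
    exact tendsto_neg_atTop_atBot.atBot_div_const (by positivity)
  refine (h.comp h1).congr fun t => ?_
  rw [Function.comp, fourier_div_two_pi]
  congr 1
  ext ξ
  congr 2
  push_cast
  ring

/-- Integration of a Fourier integral over an interval. -/
theorem intervalIntegral_integral_exp {b : ℝ → ℂ} (hb : Integrable b) (t t' : ℝ) :
    ∫ u in t..t', ∫ ξ : ℝ, Complex.exp (Complex.I * ξ * u) * b ξ =
      ∫ ξ : ℝ, (Complex.exp (Complex.I * ξ * t') - Complex.exp (Complex.I * ξ * t)) /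
        (Complex.I * ξ) * b ξ := by
  rw [intervalIntegral_integral_swap]
  · refine integral_congr_ae ?_
    have h0 : ∀ᵐ ξ : ℝ, ξ ≠ 0 := by simp [ae_iff]
    filter_upwards [h0] with ξ hξ
    have hξ' : Complex.I * ξ ≠ 0 := mul_ne_zero Complex.I_ne_zero (by exact_mod_cast hξ)
    rw [intervalIntegral.integral_mul_const, integral_exp_mul_complex hξ']
  · have : IsFiniteMeasure (volume.restrict (Set.uIoc t t')) := ⟨by simp [Set.uIoc]⟩
    have h1 : Integrable (fun z : ℝ × ℝ => (1 : ℝ) * ‖b z.2‖)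
        ((volume.restrict (Set.uIoc t t')).prod volume) :=
      (integrable_const (1 : ℝ)).mul_prod hb.norm
    refine h1.mono' ?_ (Eventually.of_forall fun z => ?_)
    · refine AEStronglyMeasurable.mul ?_ hb.aestronglyMeasurable.comp_snd
      exact (by fun_prop : Continuous fun z : ℝ × ℝ =>
        Complex.exp (Complex.I * z.2 * z.1)).aestronglyMeasurable
    · simp only [Function.uncurry]
      rw [norm_mul, norm_exp_I_mul]

theorem norm_exp_sub_exp_div_le (ξ t s : ℝ) :
    ‖(Complex.exp (Complex.I * ξ * ((t + s : ℝ) : ℂ)) - Complex.exp (Complex.I * ξ * t)) /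
      (Complex.I * ξ)‖ ≤ |s| := by
  have h1 : Complex.exp (Complex.I * ξ * ((t + s : ℝ) : ℂ)) - Complex.exp (Complex.I * ξ * t) =
      Complex.exp (Complex.I * ξ * t) * (Complex.exp (Complex.I * ((ξ * s : ℝ) : ℂ)) - 1) := by
    rw [mul_sub, ← Complex.exp_add, mul_one]
    congr 2
    push_cast
    ring
  rw [h1, norm_div, norm_mul, norm_exp_I_mul, one_mul, norm_mul, Complex.norm_I, one_mul,
    Complex.norm_real]
  refine div_le_of_le_mul₀ (norm_nonneg _) (abs_nonneg _)
    (Real.norm_exp_I_mul_ofReal_sub_one_le.trans ?_)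
  rw [norm_mul, mul_comm]
  rfl

end Fourier

/-! ### Fourier transforms of functions with exponential decay -/

theorem integrable_one_add_abs_mul_exp {γ : ℝ} (hγ : 0 < γ) :
    Integrable fun t : ℝ => (1 + |t|) * Real.exp (-(γ * |t|)) := by
  refine (integrable_inv_one_add_sq.const_mul (6 / γ ^ 3 * Real.exp γ)).mono'
    (by fun_prop : Continuous fun t : ℝ => (1 + |t|) * Real.exp (-(γ * |t|))).aestronglyMeasurable
    (Eventually.of_forall fun t => ?_)
  rw [Real.norm_of_nonneg (by positivity), ← div_eq_mul_inv, le_div_iff₀ (by positivity),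
    Real.exp_neg, mul_right_comm, ← div_eq_mul_inv, div_le_iff₀ (Real.exp_pos _), mul_assoc,
    ← Real.exp_add]
  have h1 := Real.pow_div_factorial_le_exp (γ * (1 + |t|)) (by positivity) 3
  have h2 : ((Nat.factorial 3 : ℕ) : ℝ) = 6 := by norm_num [Nat.factorial]
  rw [h2, mul_add, mul_one, ← mul_one_add, mul_pow] at h1
  have h3 : (1 + |t|) * (1 + t ^ 2) ≤ (1 + |t|) ^ 3 := by
    rw [← sq_abs t]
    nlinarith [abs_nonneg t, mul_nonneg (abs_nonneg t) (abs_nonneg t)]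
  refine h3.trans ?_
  have h4 : (1 + |t|) ^ 3 = 6 / γ ^ 3 * (γ ^ 3 * (1 + |t|) ^ 3 / 6) := by field_simp
  rw [h4]
  have h5 : γ * (1 + |t|) = γ + γ * |t| := by ring
  rw [h5] at h1
  gcongr

theorem integrable_of_sq_decay {E : Type*} [NormedAddCommGroup E] {φ : ℝ → E} (hφ : Continuous φ)
    {C : ℝ} (hC : ∀ ξ : ℝ, 1 ≤ |ξ| → |ξ| ^ 2 * ‖φ ξ‖ ≤ C) : Integrable φ := by
  obtain ⟨B, hB⟩ := (isCompact_Icc (a := (-1 : ℝ)) (b := 1)).exists_bound_of_continuousOn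
    hφ.continuousOn
  refine (integrable_inv_one_add_sq.const_mul (2 * max B C)).mono' hφ.aestronglyMeasurable
    (Eventually.of_forall fun ξ => ?_)
  rw [← div_eq_mul_inv, le_div_iff₀ (by positivity), ← sq_abs]
  rcases le_total 1 |ξ| with h | h
  · have h1 := hC ξ h
    have h2 : 1 ≤ |ξ| ^ 2 := one_le_pow₀ h
    nlinarith [norm_nonneg (φ ξ), le_max_right B C]
  · have h1 := hB ξ (abs_le.1 h)
    have h2 : |ξ| ^ 2 ≤ 1 := pow_le_one₀ (abs_nonneg _) h
    nlinarith [norm_nonneg (φ ξ), le_max_left B C]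

namespace WalkBounds

variable {G X A : Type*} [Group G] [TopologicalSpace G] [SecondCountableTopology G]
  [MeasurableSpace G] [BorelSpace G] [MetricSpace X] [CompactSpace X] [MulAction G X]
  [ContinuousSMul G X] {ρ : Measure G} {σ : Cocycle G X} {q : X → A} {γ : ℝ≥0} {s D : ℝ} {n : G → ℝ}

theorem exists_integral_smul (h : WalkBounds ρ σ q γ s D n) :
    ∃ C₁ : ℝ, 0 ≤ C₁ ∧ ∀ (F : ℝ → C(X, ℂ)) (C : ℝ), Continuous F →
      (∀ t x, Real.exp (γ * |t|) * ‖F t x‖ ≤ C) →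
      (∀ t x x', q x = q x' → Real.exp (γ * |t|) * ‖F t x - F t x'‖ ≤ C * dist x x' ^ (γ : ℝ)) →
      ∀ (ω : ℝ → ℂ) (κ : ℝ), 0 ≤ κ → Continuous ω → (∀ t, ‖ω t‖ ≤ κ * (1 + |t|)) →
        ∃ Φ : HolderSpace X γ, Φ.toC = ∫ t, ω t • F t ∧ Integrable (fun t => ω t • F t) ∧
          ‖Φ‖ ≤ C₁ * |C| * κ := by
  obtain ⟨c, hc, hfib⟩ := h.norm_sub_le_of_fibre
  have hγ : (0 : ℝ) < γ := h.γ_pos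
  have hI := integrable_one_add_abs_mul_exp hγ
  set I := ∫ t : ℝ, (1 + |t|) * Real.exp (-(γ * |t|)) with hIdef
  have hI0 : 0 ≤ I := MeasureTheory.integral_nonneg fun t => by positivity
  refine ⟨(2 + c) * I, by positivity, fun F C hF h1 h2 ω κ hκ hω hωκ => ?_⟩
  have hC : C ≤ |C| := le_abs_self C
  have hF1 : ∀ t x, ‖F t x‖ ≤ |C| * Real.exp (-(γ * |t|)) := fun t x => by
    rw [Real.exp_neg, ← div_eq_mul_inv, le_div_iff₀ (Real.exp_pos _), mul_comm]
    exact (h1 t x).trans hC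
  have hF2 : ∀ t x x', q x = q x' →
      ‖F t x - F t x'‖ ≤ |C| * dist x x' ^ (γ : ℝ) * Real.exp (-(γ * |t|)) := fun t x x' hx => by
    rw [Real.exp_neg, ← div_eq_mul_inv, le_div_iff₀ (Real.exp_pos _), mul_comm]
    exact (h2 t x x' hx).trans (by gcongr)
  have hFn : ∀ t, ‖F t‖ ≤ |C| * Real.exp (-(γ * |t|)) := fun t =>
    (ContinuousMap.norm_le _ (by positivity)).2 (hF1 t)
  have hint : Integrable fun t => ω t • F t := by
    refine (hI.const_mul (κ * |C|)).mono' (hω.smul hF).aestronglyMeasurable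
      (Eventually.of_forall fun t => ?_)
    rw [norm_smul]
    calc _ ≤ κ * (1 + |t|) * (|C| * Real.exp (-(γ * |t|))) := by
          gcongr
          · exact hωκ t
          · exact hFn t
      _ = _ := by ring
  have happ : ∀ x, (∫ t, ω t • F t) x = ∫ t, ω t * F t x := fun x =>
    ContinuousMap.integral_apply hint x
  have hintx : ∀ x, Integrable fun t => ω t * F t x := fun x =>
    (ContinuousMap.evalCLM ℂ x).integrable_comp hint
  have hb1 : ∀ x, ‖(∫ t, ω t • F t) x‖ ≤ κ * |C| * I := fun x => by
    rw [happ, hIdef, ← integral_const_mul]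
    refine norm_integral_le_of_norm_le (hI.const_mul _) (Eventually.of_forall fun t => ?_)
    rw [norm_mul]
    calc _ ≤ κ * (1 + |t|) * (|C| * Real.exp (-(γ * |t|))) := by
          gcongr
          · exact hωκ t
          · exact hF1 t x
      _ = _ := by ring
  have hb2 : ∀ x x', q x = q x' → ‖(∫ t, ω t • F t) x - (∫ t, ω t • F t) x'‖ ≤
      κ * |C| * I * dist x x' ^ (γ : ℝ) := fun x x' hx => by
    rw [happ, happ, ← integral_sub (hintx x) (hintx x')]
    have h3 : κ * |C| * I * dist x x' ^ (γ : ℝ) =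
        ∫ t : ℝ, κ * |C| * dist x x' ^ (γ : ℝ) * ((1 + |t|) * Real.exp (-(γ * |t|))) := by
      rw [integral_const_mul]
      ring
    rw [h3]
    refine norm_integral_le_of_norm_le (hI.const_mul _) (Eventually.of_forall fun t => ?_)
    rw [← mul_sub, norm_mul]
    calc _ ≤ κ * (1 + |t|) * (|C| * dist x x' ^ (γ : ℝ) * Real.exp (-(γ * |t|))) := by
          gcongr
          · exact hωκ t
          · exact hF2 t x x' hx
      _ = _ := by ring
  have hb3 := hfib _ (κ * |C| * I) (κ * |C| * I) (by positivity) (by positivity) hb1 hb2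
  obtain ⟨Φ, hΦ⟩ := HolderSpace.exists_toC_eq (∫ t, ω t • F t) _ hb3
  refine ⟨Φ, hΦ, hint, ?_⟩
  rw [← hΦ] at hb1 hb3
  refine (HolderSpace.norm_le_add (by positivity) (by positivity) hb1 hb3).trans_eq ?_
  ring

/-- The Fourier transform of an element of `ℰ^{γ,k}(X × ℝ)`. -/
theorem exists_fourier (h : WalkBounds ρ σ q γ s D n) {k : ℕ} {F : ℝ → C(X, ℂ)}
    (hF : MemE q γ k F) :
    Integrable F ∧ ∃ Fhat : ℝ → HolderSpace X γ,
      (∀ ξ, (Fhat ξ).toC = ∫ t : ℝ, Complex.exp (-(Complex.I * ξ * t)) • F t) ∧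
      (∀ ξ x, (Fhat ξ).toC x = ∫ t : ℝ, Complex.exp (-(Complex.I * ξ * t)) * F t x) ∧
      Continuous Fhat ∧ ∃ C : ℝ, ∀ ξ, |ξ| ^ k * ‖Fhat ξ‖ ≤ C := by
  obtain ⟨C₁, hC₁, hop⟩ := h.exists_integral_smul
  obtain ⟨hFk, hFb⟩ := hF
  have hω : ∀ ξ : ℝ, Continuous fun t : ℝ => Complex.exp (-(Complex.I * ξ * t)) := fun ξ => by
    fun_prop
  have hωb : ∀ ξ t : ℝ, ‖Complex.exp (-(Complex.I * ξ * t))‖ ≤ 1 * (1 + |t|) := fun ξ t => by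
    rw [norm_exp_neg_I_mul, one_mul]
    linarith [abs_nonneg t]
  have hFc : ∀ m ≤ k, Continuous (iteratedDeriv m F) := fun m hm =>
    hFk.continuous_iteratedDeriv m (by exact_mod_cast hm)
  have hex : ∀ m ≤ k, ∃ C : ℝ, ∀ ξ : ℝ, ∃ Φ : HolderSpace X γ,
      Φ.toC = ∫ t : ℝ, Complex.exp (-(Complex.I * ξ * t)) • iteratedDeriv m F t ∧
      Integrable (fun t : ℝ => Complex.exp (-(Complex.I * ξ * t)) • iteratedDeriv m F t) ∧
      ‖Φ‖ ≤ C := fun m hm => by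
    obtain ⟨C, h1, h2⟩ := hFb m hm
    exact ⟨_, fun ξ => hop _ C (hFc m hm) h1 h2 _ 1 zero_le_one (hω ξ) (hωb ξ)⟩
  have hint : ∀ m ≤ k, Integrable (iteratedDeriv m F) := fun m hm => by
    obtain ⟨C, hC⟩ := hex m hm
    obtain ⟨Φ, -, h1, -⟩ := hC 0
    simpa using h1
  obtain ⟨C', hC'⟩ := hex 0 (Nat.zero_le k)
  simp only [iteratedDeriv_zero] at hC'
  choose Fhat hFhat hFint hFnorm using hC'
  refine ⟨by simpa using hint 0 (Nat.zero_le k), Fhat, hFhat, fun ξ x => ?_, ?_, ?_⟩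
  · rw [hFhat]
    exact ContinuousMap.integral_apply (hFint ξ) x
  · obtain ⟨C, h1, h2⟩ := hFb 0 (Nat.zero_le k)
    have hlip : ∀ ξ ξ' : ℝ, ‖Fhat ξ - Fhat ξ'‖ ≤ C₁ * |C| * |ξ - ξ'| := fun ξ ξ' => by
      obtain ⟨Φ, hΦ, -, hΦn⟩ := hop _ C (hFc 0 (Nat.zero_le k)) h1 h2
        (fun t => Complex.exp (-(Complex.I * ξ * t)) - Complex.exp (-(Complex.I * ξ' * t)))
        |ξ - ξ'| (abs_nonneg _) ((hω ξ).sub (hω ξ')) fun t => by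
          have h3 : Complex.exp (-(Complex.I * ξ * t)) - Complex.exp (-(Complex.I * ξ' * t)) =
              Complex.exp (-(Complex.I * ξ * t)) *
                -(Complex.exp (Complex.I * (((ξ - ξ') * t : ℝ) : ℂ)) - 1) := by
            rw [mul_neg, mul_sub, mul_one, ← Complex.exp_add, neg_sub]
            congr 2
            push_cast
            ring
          rw [h3, norm_mul, norm_exp_neg_I_mul, one_mul, norm_neg]
          refine Real.norm_exp_I_mul_ofReal_sub_one_le.trans ?_
          rw [norm_mul, Real.norm_eq_abs, Real.norm_eq_abs]
          gcongr
          linarith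
      have : Fhat ξ - Fhat ξ' = Φ := by
        refine HolderSpace.ext_toC ?_
        rw [HolderSpace.toC_sub, hΦ, hFhat, hFhat, ← integral_sub (hFint ξ) (hFint ξ')]
        simp only [sub_smul, iteratedDeriv_zero]
      rw [this]
      exact hΦn
    refine (LipschitzWith.of_dist_le_mul (K := ⟨C₁ * |C|, by positivity⟩) fun ξ ξ' => ?_).continuous
    rw [dist_eq_norm, Real.dist_eq]
    exact hlip ξ ξ'
  · obtain ⟨C, hC⟩ := hex k le_rfl
    refine ⟨C, fun ξ => ?_⟩
    obtain ⟨Φ, hΦ, -, hΦn⟩ := hC ξ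
    have : Φ = (Complex.I * ξ) ^ k • Fhat ξ := by
      refine HolderSpace.ext_toC ?_
      rw [HolderSpace.toC_smul, hΦ, hFhat, integral_exp_smul_iteratedDeriv hFk hint]
    rw [this, norm_smul, norm_pow, norm_mul, Complex.norm_I, one_mul, Complex.norm_real] at hΦn
    exact hΦn

end WalkBounds

section Decay

variable {G X : Type*} [Group G] [TopologicalSpace G] [SecondCountableTopology G]
  [MeasurableSpace G] [BorelSpace G] [IsTopologicalGroup G] [T2Space G] [MetricSpace X] [CompactSpace X] [MulAction G X]
  [ContinuousSMul G X] {ρ : Measure G} [IsProbabilityMeasure ρ] {σ : Cocycle G X} {γ : ℝ≥0}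

theorem IsRegularPart.continuous_apply {m : ℝ} {N₀ : C(X, ℂ) →L[ℂ] C(X, ℂ)}
    {U : ℂ → HolderSpace X γ →L[ℂ] HolderSpace X γ} (hU : IsRegularPart ρ σ m N₀ U)
    {Fhat : ℝ → HolderSpace X γ} (hF : Continuous Fhat) :
    Continuous fun ξ : ℝ => (U (-(Complex.I * ξ)) (Fhat ξ)).toC := by
  have h1 : Continuous fun ξ : ℝ => U (-(Complex.I * ξ)) := by
    refine continuous_iff_continuousAt.2 fun ξ => ?_
    have h2 : ContinuousAt U (-(Complex.I * ξ)) := (hU.1 _ (by simp)).continuousAt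
    exact ContinuousAt.comp (f := fun ξ : ℝ => -(Complex.I * (ξ : ℂ))) h2
      (by fun_prop : Continuous fun ξ : ℝ => -(Complex.I * (ξ : ℂ))).continuousAt
  exact HolderSpace.toCL.continuous.comp (h1.clm_apply hF)

theorem IsRegularPart.integrable_apply {m : ℝ} {N₀ : C(X, ℂ) →L[ℂ] C(X, ℂ)}
    {U : ℂ → HolderSpace X γ →L[ℂ] HolderSpace X γ} (hU : IsRegularPart ρ σ m N₀ U)
    {C₀ L : ℝ} (hres : ∀ t : ℝ, 1 ≤ |t| →
      ∃ S : HolderSpace X γ →L[ℂ] HolderSpace X γ, IsResolvent ρ σ t S ∧ ‖S‖ ≤ C₀ * |t| ^ L)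
    {Fhat : ℝ → HolderSpace X γ} (hF : Continuous Fhat) {C : ℝ}
    (hC : ∀ ξ, |ξ| ^ (⌈L⌉₊ + 2) * ‖Fhat ξ‖ ≤ C) :
    Integrable fun ξ : ℝ => (U (-(Complex.I * ξ)) (Fhat ξ)).toC := by
  refine integrable_of_sq_decay (hU.continuous_apply hF) (C := (|C₀| + |m|⁻¹ * ‖N₀‖) * C)
    fun ξ hξ => ?_
  have hξ0 : ξ ≠ 0 := fun h0 => by norm_num [h0] at hξ
  obtain ⟨S, hS, hSn⟩ := hres (-ξ) (by rwa [abs_neg])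
  obtain ⟨S', hS', hUS⟩ := hU.2 (-ξ) (neg_ne_zero.2 hξ0)
  rw [hS'.unique hS] at hUS
  have h1 := hUS (Fhat ξ)
  have h2 : Complex.I * ((-ξ : ℝ) : ℂ) = -(Complex.I * ξ) := by push_cast; ring
  rw [h2] at h1
  rw [h1]
  have h3 : ‖S‖ ≤ |C₀| * |ξ| ^ ⌈L⌉₊ := by
    rw [abs_neg] at hSn
    refine hSn.trans ?_
    have h4 : |ξ| ^ L ≤ |ξ| ^ ⌈L⌉₊ := by
      rw [← Real.rpow_natCast]
      exact Real.rpow_le_rpow_of_exponent_le hξ (Nat.le_ceil L)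
    have h5 : 0 ≤ |ξ| ^ L := by positivity
    calc C₀ * |ξ| ^ L ≤ |C₀| * |ξ| ^ L := by gcongr; exact le_abs_self _
      _ ≤ _ := by gcongr
  have h4 : ‖((m : ℂ) * -(Complex.I * ξ))⁻¹‖ ≤ |m|⁻¹ := by
    rw [norm_inv, norm_mul, norm_neg, norm_mul, Complex.norm_I, one_mul, Complex.norm_real,
      Complex.norm_real, Real.norm_eq_abs, Real.norm_eq_abs, mul_inv]
    exact mul_le_of_le_one_right (by positivity) (inv_le_one_of_one_le₀ hξ)
  have h5 : ‖(S (Fhat ξ)).toC‖ ≤ |C₀| * |ξ| ^ ⌈L⌉₊ * ‖Fhat ξ‖ :=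
    (HolderSpace.norm_toC_le _).trans ((S.le_opNorm _).trans (by gcongr))
  have h6 : ‖((m : ℂ) * -(Complex.I * ξ))⁻¹ • N₀ (Fhat ξ).toC‖ ≤
      |m|⁻¹ * (‖N₀‖ * (|ξ| ^ ⌈L⌉₊ * ‖Fhat ξ‖)) := by
    rw [norm_smul]
    gcongr
    refine (N₀.le_opNorm _).trans ?_
    gcongr
    exact (HolderSpace.norm_toC_le _).trans
      (le_mul_of_one_le_left (norm_nonneg _) (one_le_pow₀ hξ))
  have hCξ := hC ξ
  rw [pow_add] at hCξ
  calc |ξ| ^ 2 * ‖(S (Fhat ξ)).toC - ((m : ℂ) * -(Complex.I * ξ))⁻¹ • N₀ (Fhat ξ).toC‖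
      ≤ |ξ| ^ 2 * (|C₀| * |ξ| ^ ⌈L⌉₊ * ‖Fhat ξ‖ +
          |m|⁻¹ * (‖N₀‖ * (|ξ| ^ ⌈L⌉₊ * ‖Fhat ξ‖))) := by
        gcongr
        exact (norm_sub_le _ _).trans (add_le_add h5 h6)
    _ = (|C₀| + |m|⁻¹ * ‖N₀‖) * (|ξ| ^ ⌈L⌉₊ * |ξ| ^ 2 * ‖Fhat ξ‖) := by ring
    _ ≤ _ := by gcongr

end Decay

/-! ### The renewal theorem -/

section Tail

variable {E : Type*} [NormedAddCommGroup E] [NormedSpace ℝ E]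

theorem integral_Ioi_eq_sub {f : ℝ → E} (hf : Integrable f) (t t' : ℝ) :
    ∫ u in Set.Ioi t', f u = (∫ u in Set.Ioi t, f u) - ∫ u in t..t', f u := by
  rw [eq_sub_iff_add_eq, add_comm]
  exact intervalIntegral.integral_interval_add_Ioi hf.integrableOn hf.integrableOn

theorem continuous_integral_Ioi {f : ℝ → E} (hf : Integrable f) :
    Continuous fun t => ∫ u in Set.Ioi t, f u := by
  have h : Continuous fun t => (∫ u in Set.Ioi (0 : ℝ), f u) - ∫ u in (0 : ℝ)..t, f u :=
    continuous_const.sub (intervalIntegral.continuous_primitive (fun _ _ =>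
      hf.intervalIntegrable) 0)
  exact h.congr fun t => (integral_Ioi_eq_sub hf 0 t).symm

theorem tendsto_integral_Ioi {f : ℝ → E} (hf : Integrable f) :
    Tendsto (fun t => ∫ u in Set.Ioi t, f u) atTop (𝓝 0) := by
  have h := (intervalIntegral_tendsto_integral_Ioi 0 hf.integrableOn tendsto_id).const_sub
    (∫ u in Set.Ioi (0 : ℝ), f u)
  rw [sub_self] at h
  exact h.congr fun t => (integral_Ioi_eq_sub hf 0 t).symm

end Tail

section Renewal

variable {G X A : Type*} [Group G] [TopologicalSpace G] [IsTopologicalGroup G] [T2Space G]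
  [SecondCountableTopology G] [MeasurableSpace G] [BorelSpace G] [MetricSpace X] [CompactSpace X]
  [MulAction G X] [ContinuousSMul G X] {ρ : Measure G} [IsProbabilityMeasure ρ] {σ : Cocycle G X}
  {q : X → A} {γ : ℝ≥0} {s D : ℝ} {n : G → ℝ}

/-- The kernel whose `ρ`-integral expresses `I - P` in Fourier variables. -/
noncomputable def renewalKernel (σ : Cocycle G X) (m : ℝ) (φ b : ℝ → C(X, ℂ)) (x : X) (t : ℝ)
    (g : G) (ξ : ℝ) : ℂ :=
  Complex.exp (Complex.I * ξ * ((t + σ.toFun g x : ℝ) : ℂ)) * φ ξ (g • x) -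
    (m : ℂ)⁻¹ * ((Complex.exp (Complex.I * ξ * ((t + σ.toFun g x : ℝ) : ℂ)) -
      Complex.exp (Complex.I * ξ * t)) / (Complex.I * ξ) * b ξ (g • x))

theorem perturbedOp_neg_apply (ξ : ℝ) (f : C(X, ℂ)) (x : X) :
    perturbedOp ρ σ (-ξ) f x =
      ∫ g, Complex.exp (Complex.I * ξ * σ.toFun g x) * f (g • x) ∂ρ := by
  rw [perturbedOp_apply]
  congr 1
  ext g
  congr 2
  push_cast
  ring

theorem integrable_perturbedOp_neg (ξ : ℝ) (f : C(X, ℂ)) (x : X) :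
    Integrable (fun g => Complex.exp (Complex.I * ξ * σ.toFun g x) * f (g • x)) ρ := by
  refine (integrable_integrand ρ σ (-ξ) f x).congr (Eventually.of_forall fun g => ?_)
  simp only
  congr 2
  push_cast
  ring

theorem IsRegularPart.integral_renewalKernel {m : ℝ} (hm : m ≠ 0) {N₀ : C(X, ℂ) →L[ℂ] C(X, ℂ)}
    (hPN : perturbedOp ρ σ 0 * N₀ = N₀)
    {U : ℂ → HolderSpace X γ →L[ℂ] HolderSpace X γ} (hU : IsRegularPart ρ σ m N₀ U)
    (Fhat : ℝ → HolderSpace X γ) (x : X) (t : ℝ) {ξ : ℝ} (hξ : ξ ≠ 0) :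
    ∫ g, renewalKernel σ m (fun ξ => (U (-(Complex.I * ξ)) (Fhat ξ)).toC)
        (fun ξ => N₀ (Fhat ξ).toC) x t g ξ ∂ρ =
      Complex.exp (Complex.I * ξ * t) *
        ((U (-(Complex.I * ξ)) (Fhat ξ)).toC x - (Fhat ξ).toC x) := by
  have hm' : (m : ℂ) ≠ 0 := by exact_mod_cast hm
  have hξ' : (ξ : ℂ) ≠ 0 := by exact_mod_cast hξ
  obtain ⟨S, ⟨T, hT, hTS, -⟩, hUS⟩ := hU.2 (-ξ) (neg_ne_zero.2 hξ)
  have h1 := hUS (Fhat ξ)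
  have h2 : Complex.I * ((-ξ : ℝ) : ℂ) = -(Complex.I * ξ) := by push_cast; ring
  rw [h2] at h1
  set u := (U (-(Complex.I * ξ)) (Fhat ξ)).toC with hu
  set y := N₀ (Fhat ξ).toC with hy
  have hPy : ∫ g, y (g • x) ∂ρ = y x := by
    rw [← perturbedOp_zero_apply ρ σ, hy, ← mul_apply_eq_comp, hPN]
  have hSx : (S (Fhat ξ)).toC x - perturbedOp ρ σ (-ξ) (S (Fhat ξ)).toC x = (Fhat ξ).toC x := by
    have h3 := congrArg (fun f : HolderSpace X γ => f.toC x) (DFunLike.congr_fun hTS (Fhat ξ))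
    simp only [mul_apply_eq_comp, sub_apply, one_apply_eq_self, HolderSpace.toC_sub,
      ContinuousMap.sub_apply, hT] at h3
    exact h3
  have hux : u x = (S (Fhat ξ)).toC x - ((m : ℂ) * -(Complex.I * ξ))⁻¹ * y x := by
    rw [h1]
    rfl
  have hPu : perturbedOp ρ σ (-ξ) u x = perturbedOp ρ σ (-ξ) (S (Fhat ξ)).toC x -
      ((m : ℂ) * -(Complex.I * ξ))⁻¹ * perturbedOp ρ σ (-ξ) y x := by
    rw [h1, map_sub, map_smul]
    rfl
  have hk : ∀ g, renewalKernel σ m (fun ξ => (U (-(Complex.I * ξ)) (Fhat ξ)).toC)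
        (fun ξ => N₀ (Fhat ξ).toC) x t g ξ =
      Complex.exp (Complex.I * ξ * t) * (Complex.exp (Complex.I * ξ * σ.toFun g x) * u (g • x)) -
      Complex.exp (Complex.I * ξ * t) * (m * (Complex.I * ξ))⁻¹ *
        (Complex.exp (Complex.I * ξ * σ.toFun g x) * y (g • x) - y (g • x)) := fun g => by
    have h4 : Complex.exp (Complex.I * ξ * ((t + σ.toFun g x : ℝ) : ℂ)) =
        Complex.exp (Complex.I * ξ * t) * Complex.exp (Complex.I * ξ * σ.toFun g x) := by
      rw [← Complex.exp_add]
      congr 1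
      push_cast
      ring
    simp only [renewalKernel]
    rw [h4, ← hu, ← hy]
    field_simp
  have hi1 := integrable_perturbedOp_neg (ρ := ρ) (σ := σ) ξ u x
  have hi2 := integrable_perturbedOp_neg (ρ := ρ) (σ := σ) ξ y x
  have hi3 := integrable_smul ρ y x
  have hi4 : Integrable (fun g => Complex.exp (Complex.I * ξ * σ.toFun g x) * y (g • x) -
      y (g • x)) ρ := hi2.sub hi3
  simp only [hk]
  rw [integral_sub (hi1.const_mul _) (hi4.const_mul _), integral_const_mul, integral_const_mul,
    integral_sub hi2 hi3, ← perturbedOp_neg_apply, ← perturbedOp_neg_apply, hPy, hPu, hux, ← hSx]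
  have hI := Complex.I_ne_zero
  field_simp
  ring

theorem WalkBounds.integrable_renewalKernel (h : WalkBounds ρ σ q γ s D n) (m : ℝ)
    {φ b : ℝ → C(X, ℂ)} (hφ : Continuous φ) (hφi : Integrable φ) (hb : Continuous b)
    (hbi : Integrable b) (x : X) (t : ℝ) :
    Integrable (Function.uncurry (renewalKernel σ m φ b x t)) (ρ.prod volume) := by
  have hσ : Continuous fun z : G × ℝ => σ.toFun z.1 x :=
    (continuous_cocycle σ x).comp continuous_fst
  have hsm : Continuous fun z : G × ℝ => z.1 • x := continuous_fst.smul continuous_const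
  have hφz : Continuous fun z : G × ℝ => φ z.2 (z.1 • x) :=
    (hφ.comp continuous_snd).eval hsm
  have hbz : Continuous fun z : G × ℝ => b z.2 (z.1 • x) :=
    (hb.comp continuous_snd).eval hsm
  have hbound : Integrable (fun z : G × ℝ => 1 * ‖φ z.2‖ + |m|⁻¹ * (|σ.toFun z.1 x| * ‖b z.2‖))
      (ρ.prod volume) :=
    ((integrable_const (1 : ℝ)).mul_prod hφi.norm).add
      (((h.integrable_cocycle x).abs.mul_prod hbi.norm).const_mul _)
  refine hbound.mono' ?_ (Eventually.of_forall fun z => ?_)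
  · have h1 : Continuous fun z : G × ℝ =>
        Complex.exp (Complex.I * z.2 * ((t + σ.toFun z.1 x : ℝ) : ℂ)) := by fun_prop
    have h2 : Continuous fun z : G × ℝ => Complex.exp (Complex.I * z.2 * t) := by fun_prop
    have h3 : Continuous fun z : G × ℝ => Complex.I * (z.2 : ℂ) := by fun_prop
    refine Measurable.aestronglyMeasurable ?_
    exact (h1.mul hφz).measurable.sub
      ((((h1.sub h2).measurable.div h3.measurable).mul hbz.measurable).const_mul _)
  · simp only [Function.uncurry, renewalKernel]
    refine (norm_sub_le _ _).trans ?_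
    rw [norm_mul, norm_mul, norm_mul, norm_exp_I_mul, norm_inv, Complex.norm_real, Real.norm_eq_abs]
    gcongr
    · exact (φ z.2).norm_coe_le_norm _
    · exact norm_exp_sub_exp_div_le _ _ _
    · exact (b z.2).norm_coe_le_norm _

/-- The renewal function solves the equation `V - P V = F`. -/
theorem WalkBounds.walkOp_renewal (h : WalkBounds ρ σ q γ s D n) {m : ℝ} (hm : m ≠ 0)
    {N₀ : C(X, ℂ) →L[ℂ] C(X, ℂ)} (hPN : perturbedOp ρ σ 0 * N₀ = N₀)
    {U : ℂ → HolderSpace X γ →L[ℂ] HolderSpace X γ} (hU : IsRegularPart ρ σ m N₀ U)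
    {F : ℝ → C(X, ℂ)} (hF : Continuous F) (hFi : Integrable F) {Fhat : ℝ → HolderSpace X γ}
    (hFhat : ∀ ξ, (Fhat ξ).toC = ∫ t : ℝ, Complex.exp (-(Complex.I * ξ * t)) • F t)
    (hFc : Continuous Fhat) (hai : Integrable fun ξ => (Fhat ξ).toC)
    (hφi : Integrable fun ξ : ℝ => (U (-(Complex.I * ξ)) (Fhat ξ)).toC)
    {V : ℝ → C(X, ℂ)} (hV : ∀ t, V t = (m : ℂ)⁻¹ • (∫ u in Set.Ioi t, N₀ (F u)) +
      (2 * Real.pi : ℂ)⁻¹ • ∫ ξ : ℝ, Complex.exp (Complex.I * ξ * t) •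
        (U (-(Complex.I * ξ)) (Fhat ξ)).toC) (z : X × ℝ) :
    walkOp ρ σ (fun z => V z.2 z.1) z = V z.2 z.1 - F z.2 z.1 := by
  obtain ⟨x, t⟩ := z
  set φ : ℝ → C(X, ℂ) := fun ξ => (U (-(Complex.I * ξ)) (Fhat ξ)).toC with hφ
  set b : ℝ → C(X, ℂ) := fun ξ => N₀ (Fhat ξ).toC with hb
  have hφc : Continuous φ := hU.continuous_apply hFc
  have hbc : Continuous b := N₀.continuous.comp (HolderSpace.toCL.continuous.comp hFc)
  have hbi : Integrable b := N₀.integrable_comp hai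
  have hNF : Integrable fun u => N₀ (F u) := N₀.integrable_comp hFi
  set R : ℝ → C(X, ℂ) := fun t => ∫ u in Set.Ioi t, N₀ (F u) with hR
  have heval : ∀ (f : ℝ → C(X, ℂ)), Integrable f → ∀ y, (∫ ξ, f ξ) y = ∫ ξ, f ξ y :=
    fun f hf y => ContinuousMap.integral_apply hf y
  have hNFu : ∀ u y, N₀ (F u) y = (2 * Real.pi : ℂ)⁻¹ *
      ∫ ξ : ℝ, Complex.exp (Complex.I * ξ * u) * b ξ y := fun u y => by
    have h1 := eq_integral_fourier hF hFi hFhat hai u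
    have h2 : N₀ (∫ ξ : ℝ, Complex.exp (Complex.I * ξ * u) • (Fhat ξ).toC) =
        ∫ ξ : ℝ, Complex.exp (Complex.I * ξ * u) • b ξ := by
      rw [← N₀.integral_comp_comm (integrable_exp_smul hai u)]
      simp only [map_smul, hb]
    rw [h1, map_smul, h2, ContinuousMap.smul_apply, heval _ (integrable_exp_smul hbi u)]
    rfl
  have hFx : F t x = (2 * Real.pi : ℂ)⁻¹ *
      ∫ ξ : ℝ, Complex.exp (Complex.I * ξ * t) * (Fhat ξ).toC x := by
    have h1 := eq_integral_fourier hF hFi hFhat hai t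
    rw [h1, ContinuousMap.smul_apply, heval _ (integrable_exp_smul hai t)]
    rfl
  have hVx : ∀ t y, V t y = (m : ℂ)⁻¹ * R t y + (2 * Real.pi : ℂ)⁻¹ *
      ∫ ξ : ℝ, Complex.exp (Complex.I * ξ * t) * φ ξ y := fun t y => by
    rw [hV, ContinuousMap.add_apply, ContinuousMap.smul_apply, ContinuousMap.smul_apply,
      heval _ (integrable_exp_smul hφi t)]
    rfl
  have hexpi : ∀ (f : ℝ → C(X, ℂ)), Integrable f → ∀ (t : ℝ) y,
      Integrable fun ξ : ℝ => Complex.exp (Complex.I * ξ * t) * f ξ y := fun f hf t y =>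
    (ContinuousMap.evalCLM ℂ y).integrable_comp (integrable_exp_smul hf t)
  have hRdiff : ∀ (t t' : ℝ) y, R t' y = R t y - (2 * Real.pi : ℂ)⁻¹ *
      ∫ ξ : ℝ, (Complex.exp (Complex.I * ξ * t') - Complex.exp (Complex.I * ξ * t)) /
        (Complex.I * ξ) * b ξ y := fun t t' y => by
    have hby : Integrable fun ξ => b ξ y := (ContinuousMap.evalCLM ℂ y).integrable_comp hbi
    have h1 : (∫ u in t..t', N₀ (F u)) y = ∫ u in t..t', N₀ (F u) y :=
      ((ContinuousMap.evalCLM ℂ y).intervalIntegral_comp_comm hNF.intervalIntegrable).symm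
    rw [hR]
    simp only
    rw [integral_Ioi_eq_sub hNF t t', ContinuousMap.sub_apply, h1]
    simp only [hNFu]
    rw [intervalIntegral.integral_const_mul, intervalIntegral_integral_exp hby]
  have hVg : ∀ g, V (t + σ.toFun g x) (g • x) = (m : ℂ)⁻¹ * R t (g • x) +
      (2 * Real.pi : ℂ)⁻¹ * ∫ ξ : ℝ, renewalKernel σ m φ b x t g ξ := fun g => by
    have hi : Integrable fun ξ : ℝ => (Complex.exp (Complex.I * ξ * ((t + σ.toFun g x : ℝ) : ℂ)) -
        Complex.exp (Complex.I * ξ * t)) / (Complex.I * ξ) * b ξ (g • x) := by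
      have hby : Integrable fun ξ => b ξ (g • x) :=
        (ContinuousMap.evalCLM ℂ (g • x)).integrable_comp hbi
      refine hby.bdd_mul (c := |σ.toFun g x|) ?_
        (Eventually.of_forall fun ξ => norm_exp_sub_exp_div_le _ _ _)
      refine Measurable.aestronglyMeasurable ?_
      exact (by fun_prop : Continuous fun ξ : ℝ =>
        Complex.exp (Complex.I * ξ * ((t + σ.toFun g x : ℝ) : ℂ)) -
        Complex.exp (Complex.I * ξ * t)).measurable.div
        (by fun_prop : Continuous fun ξ : ℝ => Complex.I * (ξ : ℂ)).measurable
    simp only [renewalKernel]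
    rw [hVx, hRdiff t (t + σ.toFun g x), integral_sub (hexpi φ hφi _ _) (hi.const_mul _),
      integral_const_mul]
    ring
  have hker := h.integrable_renewalKernel m hφc hφi hbc hbi x t
  have hRP : ∫ g, R t (g • x) ∂ρ = R t x := by
    rw [← perturbedOp_zero_apply ρ σ, hR]
    simp only
    rw [← (perturbedOp ρ σ 0).integral_comp_comm hNF.integrableOn]
    simp only [← mul_apply_eq_comp, hPN]
  have h0 : ∀ᵐ ξ : ℝ, ξ ≠ 0 := by simp [ae_iff]
  have hswap : ∫ g, (∫ ξ : ℝ, renewalKernel σ m φ b x t g ξ) ∂ρ =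
      ∫ ξ : ℝ, Complex.exp (Complex.I * ξ * t) * (φ ξ x - (Fhat ξ).toC x) := by
    rw [integral_integral_swap hker]
    refine integral_congr_ae ?_
    filter_upwards [h0] with ξ hξ
    exact hU.integral_renewalKernel hm hPN Fhat x t hξ
  have hi1 : Integrable (fun g => (m : ℂ)⁻¹ * R t (g • x)) ρ := (integrable_smul ρ (R t) x).const_mul _
  have hi2 : Integrable (fun g => (2 * Real.pi : ℂ)⁻¹ *
      ∫ ξ : ℝ, renewalKernel σ m φ b x t g ξ) ρ := hker.integral_prod_left.const_mul _
  change ∫ g, V (t + σ.toFun g x) (g • x) ∂ρ = V t x - F t x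
  simp only [hVg]
  rw [integral_add hi1 hi2, integral_const_mul, integral_const_mul, hRP, hswap]
  simp only [mul_sub]
  rw [integral_sub (hexpi φ hφi t x) (hexpi _ hai t x), hVx, hFx]
  ring

end Renewal

section Convergence

variable {G X A : Type*} [Group G] [TopologicalSpace G] [IsTopologicalGroup G] [T2Space G]
  [SecondCountableTopology G] [MeasurableSpace G] [BorelSpace G] [MetricSpace X] [CompactSpace X]
  [MulAction G X] [ContinuousSMul G X] {ρ : Measure G} [IsProbabilityMeasure ρ] {σ : Cocycle G X}
  {q : X → A} {γ : ℝ≥0} {s D : ℝ} {n : G → ℝ}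

/-- There is a strict supersolution of the form `exp(-r (t + ψ x))`. -/
theorem WalkBounds.exists_supersolution (h : WalkBounds ρ σ q γ s D n) {m : ℝ} (hm : 0 < m)
    {ψ : C(X, ℂ)} (hψ : ∀ x, ∫ g, (σ.toFun g x : ℂ) ∂ρ = m + ψ x - ∫ g, ψ (g • x) ∂ρ) :
    ∃ r κ : ℝ, ∃ χ : C(X, ℝ), 0 < r ∧ r ≤ γ ∧ 0 ≤ κ ∧ κ < 1 ∧ ∀ z : X × ℝ,
      Integrable (fun g => Real.exp (-(r * (z.2 + σ.toFun g z.1 + χ (g • z.1))))) ρ ∧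
      ∫ g, Real.exp (-(r * (z.2 + σ.toFun g z.1 + χ (g • z.1)))) ∂ρ ≤
        κ * Real.exp (-(r * (z.2 + χ z.1))) := by
  set χ : C(X, ℝ) := ⟨fun x => (ψ x).re, Complex.continuous_re.comp ψ.continuous⟩ with hχ
  have hχψ : ∀ x, ∫ g, σ.toFun g x ∂ρ = m + χ x - ∫ g, χ (g • x) ∂ρ := fun x => by
    have h1 := congrArg Complex.re (hψ x)
    have h2 : ∫ g, (ψ (g • x)).re ∂ρ = (∫ g, ψ (g • x) ∂ρ).re :=
      integral_re (integrable_smul ρ ψ x)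
    rw [integral_complex_ofReal, Complex.ofReal_re, Complex.sub_re, Complex.add_re,
      Complex.ofReal_re, ← h2] at h1
    exact h1
  obtain ⟨r, κ, hr, hrγ, hrs, hκ, hκ1, hle⟩ := h.exists_integral_exp_le hm hχψ
  refine ⟨r, κ, χ, hr, hrγ, hκ, hκ1, fun z => ?_⟩
  have hfac : ∀ g, Real.exp (-(r * (z.2 + σ.toFun g z.1 + χ (g • z.1)))) =
      Real.exp (-(r * z.2)) * Real.exp (-(r * (σ.toFun g z.1 + χ (g • z.1)))) := fun g => by
    rw [← Real.exp_add]
    congr 1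
    ring
  constructor
  · have hn : Integrable n ρ := h.moment.mono' h.n_meas.aestronglyMeasurable
      (Eventually.of_forall fun g => by
        rw [Real.norm_of_nonneg (h.n_pos g).le]
        exact h.n_le_pow_four g)
    refine (hn.const_mul (Real.exp (-(r * z.2)) * (Real.exp (r * ‖χ‖) * D))).mono' ?_
      (Eventually.of_forall fun g => ?_)
    · have h1 : Continuous fun g => σ.toFun g z.1 := continuous_cocycle σ z.1
      have h2 : Continuous fun g : G => χ (g • z.1) :=
        χ.continuous.comp (continuous_id.smul continuous_const)
      exact (by fun_prop : Continuous fun g =>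
        Real.exp (-(r * (z.2 + σ.toFun g z.1 + χ (g • z.1))))).aestronglyMeasurable
    · rw [Real.norm_of_nonneg (Real.exp_pos _).le, hfac, mul_assoc, mul_assoc]
      gcongr
      calc Real.exp (-(r * (σ.toFun g z.1 + χ (g • z.1))))
          ≤ Real.exp (r * ‖χ‖ + s * |σ.toFun g z.1|) := by
            refine Real.exp_le_exp.2 ?_
            have h1 : -χ (g • z.1) ≤ ‖χ‖ := (neg_le_abs _).trans (χ.norm_coe_le_norm _)
            have h2 : r * -σ.toFun g z.1 ≤ s * |σ.toFun g z.1| := by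
              calc r * -σ.toFun g z.1 ≤ r * |σ.toFun g z.1| := by gcongr; exact neg_le_abs _
                _ ≤ _ := by gcongr
            have h3 : r * -χ (g • z.1) ≤ r * ‖χ‖ := by gcongr
            linarith
        _ = Real.exp (r * ‖χ‖) * Real.exp (s * |σ.toFun g z.1|) := Real.exp_add _ _
        _ ≤ _ := by
            gcongr
            exact h.exp_le g z.1
  · simp only [hfac]
    rw [integral_const_mul]
    calc _ ≤ Real.exp (-(r * z.2)) * (κ * Real.exp (-(r * χ z.1))) := by
          gcongr
          exact hle z.1
      _ = _ := by
          rw [mul_left_comm, ← Real.exp_add]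
          congr 2
          ring

/-- The renewal theorem in Fourier form. -/
theorem WalkBounds.hasSum_renewal (h : WalkBounds ρ σ q γ s D n) {m : ℝ} (hm : 0 < m)
    {N₀ : C(X, ℂ) →L[ℂ] C(X, ℂ)} (hPN : perturbedOp ρ σ 0 * N₀ = N₀) {ψ : C(X, ℂ)}
    (hψ : ∀ x, ∫ g, (σ.toFun g x : ℂ) ∂ρ = m + ψ x - ∫ g, ψ (g • x) ∂ρ)
    {U : ℂ → HolderSpace X γ →L[ℂ] HolderSpace X γ} (hU : IsRegularPart ρ σ m N₀ U)
    {C₀ L : ℝ} (hres : ∀ t : ℝ, 1 ≤ |t| →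
      ∃ S : HolderSpace X γ →L[ℂ] HolderSpace X γ, IsResolvent ρ σ t S ∧ ‖S‖ ≤ C₀ * |t| ^ L)
    {F : ℝ → C(X, ℂ)} (hF : MemE q γ (⌈L⌉₊ + 2) F) :
    ∃ Fhat : ℝ → HolderSpace X γ,
      (∀ (ξ : ℝ) (x : X),
        (Fhat ξ).toC x = ∫ t : ℝ, Complex.exp (-(Complex.I * ξ * t)) * F t x) ∧
      ∀ (x : X) (t : ℝ),
        IntegrableOn (fun u : ℝ => N₀ (F u) x) (Set.Ioi t) ∧
        Integrable (fun ξ : ℝ => Complex.exp (Complex.I * ξ * t) *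
          (U (-(Complex.I * ξ)) (Fhat ξ)).toC x) ∧
        HasSum (fun k : ℕ => ((walkOp ρ σ)^[k] (fun z : X × ℝ => F z.2 z.1)) (x, t))
          ((m : ℂ)⁻¹ * (∫ u in Set.Ioi t, N₀ (F u) x) +
            (2 * (Real.pi : ℂ))⁻¹ * ∫ ξ : ℝ, Complex.exp (Complex.I * ξ * t) *
              (U (-(Complex.I * ξ)) (Fhat ξ)).toC x) := by
  obtain ⟨hFi, Fhat, hFhat, hFhat', hFc, C, hC⟩ := h.exists_fourier hF
  refine ⟨Fhat, hFhat', ?_⟩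
  have hFcont : Continuous F := hF.1.continuous
  have hφc := hU.continuous_apply hFc
  have hφi := hU.integrable_apply hres hFc hC
  have hai : Integrable fun ξ => (Fhat ξ).toC := by
    refine integrable_of_sq_decay (HolderSpace.toCL.continuous.comp hFc) (C := C) fun ξ hξ => ?_
    refine le_trans ?_ (hC ξ)
    exact mul_le_mul (pow_le_pow_right₀ hξ (by omega)) (HolderSpace.norm_toC_le _) (norm_nonneg _)
      (by positivity)
  set φ : ℝ → C(X, ℂ) := fun ξ => (U (-(Complex.I * ξ)) (Fhat ξ)).toC with hφ
  have hNF : Integrable fun u => N₀ (F u) := N₀.integrable_comp hFi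
  have hexp : ∀ t : ℝ, Integrable fun ξ : ℝ => Complex.exp (Complex.I * ξ * t) • φ ξ :=
    integrable_exp_smul hφi
  set V : ℝ → C(X, ℂ) := fun t => (m : ℂ)⁻¹ • (∫ u in Set.Ioi t, N₀ (F u)) +
      (2 * Real.pi : ℂ)⁻¹ • ∫ ξ : ℝ, Complex.exp (Complex.I * ξ * t) • φ ξ with hV
  have hVc : Continuous V := by
    suffices hW : Continuous fun t : ℝ => ∫ ξ : ℝ, Complex.exp (Complex.I * ξ * t) • φ ξ by
      exact ((continuous_integral_Ioi hNF).const_smul (m : ℂ)⁻¹).add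
        (hW.const_smul (2 * Real.pi : ℂ)⁻¹)
    refine continuous_of_dominated (bound := fun ξ => ‖φ ξ‖)
      (fun t => (hexp t).aestronglyMeasurable) (fun t => Eventually.of_forall fun ξ => ?_)
      hφi.norm (Eventually.of_forall fun ξ => by fun_prop)
    rw [norm_smul, norm_exp_I_mul, one_mul]
  have hV0 : Tendsto V atTop (𝓝 0) := by
    have h1 := ((tendsto_integral_Ioi hNF).const_smul (m : ℂ)⁻¹).add
      ((tendsto_integral_exp_smul φ).const_smul (2 * Real.pi : ℂ)⁻¹)
    rwa [smul_zero, smul_zero, add_zero] at h1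
  obtain ⟨B, hB⟩ : ∃ B, ∀ t, ‖V t‖ ≤ B := by
    refine ⟨‖(m : ℂ)⁻¹‖ * (∫ u, ‖N₀ (F u)‖) + ‖(2 * Real.pi : ℂ)⁻¹‖ * ∫ ξ, ‖φ ξ‖, fun t => ?_⟩
    refine (norm_add_le _ _).trans ?_
    rw [norm_smul, norm_smul]
    gcongr
    · exact (norm_integral_le_integral_norm _).trans
        (setIntegral_le_integral hNF.norm (Eventually.of_forall fun _ => norm_nonneg _))
    · refine (norm_integral_le_integral_norm _).trans_eq ?_
      simp only [norm_smul, norm_exp_I_mul, one_mul]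
  have hB0 : 0 ≤ B := (norm_nonneg _).trans (hB 0)
  have heq := h.walkOp_renewal hm.ne' hPN hU hFcont hFi hFhat hFc hai hφi (V := V) fun t => rfl
  obtain ⟨r, κ, χ, hr, hrγ, hκ, hκ1, hsup⟩ := h.exists_supersolution hm hψ
  have hχ : ∀ x, χ x ≤ ‖χ‖ := fun x => (le_abs_self _).trans (χ.norm_coe_le_norm x)
  obtain ⟨CF, hCF, -⟩ := hF.2 0 (Nat.zero_le _)
  simp only [iteratedDeriv_zero] at hCF
  have hFh : ∀ z : X × ℝ, ‖F z.2 z.1‖ ≤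
      |CF| * Real.exp (r * ‖χ‖) * Real.exp (-(r * (z.2 + χ z.1))) := fun z => by
    have h1 : ‖F z.2 z.1‖ ≤ |CF| * Real.exp (-(γ * |z.2|)) := by
      rw [Real.exp_neg, ← div_eq_mul_inv, le_div_iff₀ (Real.exp_pos _), mul_comm]
      exact (hCF z.2 z.1).trans (le_abs_self _)
    refine h1.trans ?_
    rw [mul_assoc, ← Real.exp_add]
    gcongr
    have h2 : r * z.2 ≤ γ * |z.2| := by
      calc r * z.2 ≤ r * |z.2| := by gcongr; exact le_abs_self _
        _ ≤ _ := by gcongr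
    have h3 : r * χ z.1 ≤ r * ‖χ‖ := by gcongr; exact hχ _
    linarith
  have hFb : ∀ z : X × ℝ, ‖F z.2 z.1‖ ≤ |CF| := fun z => by
    refine le_trans ?_ ((hCF z.2 z.1).trans (le_abs_self _))
    exact le_mul_of_one_le_left (norm_nonneg _) (Real.one_le_exp (by positivity))
  have hVh : ∀ ε : ℝ, 0 < ε → ∃ c : ℝ, 0 ≤ c ∧ ∀ z : X × ℝ,
      ‖V z.2 z.1‖ ≤ ε + c * Real.exp (-(r * (z.2 + χ z.1))) := fun ε hε => by
    obtain ⟨t₁, ht₁⟩ := Metric.tendsto_atTop.1 hV0 ε hε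
    refine ⟨B * Real.exp (r * (t₁ + ‖χ‖)), by positivity, fun z => ?_⟩
    refine ((V z.2).norm_coe_le_norm z.1).trans ?_
    rcases le_total t₁ z.2 with hz | hz
    · have h1 := ht₁ z.2 hz
      rw [dist_zero_right] at h1
      have : 0 ≤ B * Real.exp (r * (t₁ + ‖χ‖)) * Real.exp (-(r * (z.2 + χ z.1))) := by positivity
      linarith
    · rw [mul_assoc, ← Real.exp_add]
      have h1 : 1 ≤ Real.exp (r * (t₁ + ‖χ‖) + -(r * (z.2 + χ z.1))) := by
        refine Real.one_le_exp ?_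
        have : r * (z.2 + χ z.1) ≤ r * (t₁ + ‖χ‖) := by
          gcongr
          exact hχ _
        linarith
      have h2 := le_mul_of_one_le_right hB0 h1
      linarith [hB z.2]
  have hsum := hasSum_iterate_walkOp (ρ := ρ) (σ := σ) (f := fun z : X × ℝ => F z.2 z.1)
    (v := fun z : X × ℝ => V z.2 z.1)
    ((hFcont.comp continuous_snd).eval continuous_fst) hFb
    ((hVc.comp continuous_snd).eval continuous_fst)
    (fun z => ((V z.2).norm_coe_le_norm z.1).trans (hB z.2)) heq
    (h := fun z => Real.exp (-(r * (z.2 + χ z.1)))) hκ hκ1 (fun z => (hsup z).1)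
    (fun z => (hsup z).2) (by positivity) hFh hVh
  intro x t
  refine ⟨((ContinuousMap.evalCLM ℂ x).integrable_comp hNF).integrableOn,
    (ContinuousMap.evalCLM ℂ x).integrable_comp (hexp t), ?_⟩
  convert hsum (x, t) using 1
  simp only [hV]
  rw [ContinuousMap.add_apply, ContinuousMap.smul_apply, ContinuousMap.smul_apply,
    ContinuousMap.integral_apply hNF.integrableOn, ContinuousMap.integral_apply (hexp t)]
  rfl

end Convergence

section Family

variable {G H X A : Type*}
  [Group G] [TopologicalSpace G] [IsTopologicalGroup G] [T2Space G]
  [SecondCountableTopology G] [MeasurableSpace G] [BorelSpace G]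
  [Group H] [Finite H]
  [MetricSpace X] [CompactSpace X] [MulAction G X] [ContinuousSMul G X]
  [MulAction H X] [IsIsometricSMul H X] [SMulCommClass G H X]

/-- The analytic family `P(z)` on `C^{0,γ}(X)` for a contracted walk. -/
theorem exists_family [TopologicalSpace A] [DiscreteTopology A] {ρ : Measure G}
    [IsProbabilityMeasure ρ] {N : G → ℝ}
    (hN_meas : Measurable N) (hN_one : ∀ g, 1 ≤ N g) (hN_mul : ∀ g g', N (g * g') ≤ N g * N g')
    {γ₀ M : ℝ} (hγ₀ : 0 < γ₀) (hM : 0 < M)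
    {p : OrbitSpace H X → A} (hp : Continuous p)
    (hX_loc : ∃ d₀ : ℝ, 0 < d₀ ∧ ∀ x y : X, dist x y ≤ d₀ →
      dist (OrbitSpace.mk H x) (OrbitSpace.mk H y) = dist x y)
    (hX_lip : ∀ (g : G) (x y : X), dist (g • x) (g • y) ≤ M * N g ^ M * dist x y)
    (hcontr : IsContracted ρ γ₀ M N p)
    {σ : Cocycle G (OrbitSpace H X)} (hσ : σ.IsControlled M N p) {γ : ℝ≥0} (hγ : 0 < γ)
    (hγ1 : γ ≤ 1) (hγγ : (γ : ℝ) ≤ γ₀ / 4) :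
    ∃ (D : ℝ) (P : ℂ → HolderSpace X γ →L[ℂ] HolderSpace X γ)
      (D' : HolderSpace X γ →L[ℂ] HolderSpace X γ),
      WalkBounds ρ σ.lift (fun x => p (OrbitSpace.mk H x)) γ (γ₀ / 4) D
        (fun g => N g ^ (M * γ₀ / 4)) ∧
      (∀ z : ℂ, |z.re| < γ₀ / 4 → ∀ f x, (P z f).toC x = twisted ρ σ.lift z f.toC x) ∧
      (∀ z : ℂ, |z.re| < γ₀ / 4 → AnalyticAt ℂ P z) ∧
      HasDerivAt P D' 0 ∧
      (∀ f x, (D' f).toC x = -∫ g, (σ.lift.toFun g x : ℂ) * f.toC (g • x) ∂ρ) ∧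
      DoeblinFortet (HolderSpace.toCL (X := X) (γ := γ)) (P 0) (perturbedOp ρ σ.lift 0) := by
  obtain ⟨D, hW⟩ :=
    exists_walkBounds hN_meas hN_one hγ₀ hM hp hX_lip hcontr.moment hσ hγ hγ1 hγγ
  obtain ⟨P, hP, hPan, D', hD', hD'_apply⟩ := hW.exists_analytic_family
  refine ⟨D, P, D', hW, hP, hPan, hD', hD'_apply, doeblinFortet hN_meas hN_one hN_mul hγ₀ hM hp
    hX_loc hX_lip hcontr σ.lift hγ hγ1 hγγ fun f => ?_⟩
  ext x
  rw [hP 0 (by simpa using hW.s_pos), ← twisted_eq_perturbedOp]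
  simp

end Family

end Renewal

theorem mainTheorem9
    {G H X A : Type*}
    [Group G] [TopologicalSpace G] [IsTopologicalGroup G] [LocallyCompactSpace G] [T2Space G]
    [SecondCountableTopology G] [MeasurableSpace G] [BorelSpace G]
    [Group H] [Finite H]
    [MetricSpace X] [CompactSpace X] [MulAction G X] [ContinuousSMul G X]
    [MulAction H X] [IsIsometricSMul H X] [SMulCommClass G H X]
    [Finite A] [TopologicalSpace A] [DiscreteTopology A] [MulAction G A]
    (ρ : Measure G) [IsProbabilityMeasure ρ]
    (N : G → ℝ) (hN_meas : Measurable N) (hN_one : ∀ g, 1 ≤ N g)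
    (hN_mul : ∀ g g', N (g * g') ≤ N g * N g')
    (γ₀ M : ℝ) (hγ₀ : 0 < γ₀) (hM : 0 < M)
    (p : Renewal.OrbitSpace H X → A) (hp : Continuous p)
    (hp_smul : ∀ (g : G) (y : Renewal.OrbitSpace H X), p (g • y) = g • p y)
    (hX_loc : ∃ d₀ : ℝ, 0 < d₀ ∧ ∀ x y : X, dist x y ≤ d₀ →
      dist (Renewal.OrbitSpace.mk H x) (Renewal.OrbitSpace.mk H y) = dist x y)
    (hX_lip : ∀ (g : G) (x y : X), dist (g • x) (g • y) ≤ M * N g ^ M * dist x y)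
    (hcontr : Renewal.IsContracted ρ γ₀ M N p)
    (hirr : Renewal.IsIrreducibleWalk ρ A) (haper : Renewal.IsAperiodicWalk ρ A)
    (σ : Renewal.Cocycle G (Renewal.OrbitSpace H X)) (hσ : σ.IsControlled M N p)
    (ν : Measure (Renewal.OrbitSpace H X)) [IsProbabilityMeasure ν]
    (hν : Renewal.IsStationary ρ ν)
    (hσ_pos : 0 < σ.mean ρ ν)
    (hres : ∃ γ₁ : ℝ≥0, 0 < γ₁ ∧ γ₁ ≤ 1 ∧ ∀ γ : ℝ≥0, 0 < γ → γ ≤ γ₁ → ∀ t₀ : ℝ, 0 < t₀ →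
      ∃ C₀ L : ℝ, ∀ t : ℝ, t₀ ≤ |t| →
        ∃ S : Renewal.HolderSpace X γ →L[ℂ] Renewal.HolderSpace X γ,
          Renewal.IsResolvent ρ σ.lift t S ∧ ‖S‖ ≤ C₀ * |t| ^ L) :
    ∃ N₀ : C(X, ℂ) →L[ℂ] C(X, ℂ),
      (Renewal.IsInvariantProjector (Renewal.perturbedOp ρ σ.lift 0) N₀ ∧
        ∀ N₀', Renewal.IsInvariantProjector (Renewal.perturbedOp ρ σ.lift 0) N₀' → N₀' = N₀) ∧
      ∃ γ₂ : ℝ≥0, 0 < γ₂ ∧ ∀ γ : ℝ≥0, 0 < γ → γ ≤ γ₂ →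
        ∃ U : ℂ → Renewal.HolderSpace X γ →L[ℂ] Renewal.HolderSpace X γ,
          Renewal.IsRegularPart ρ σ.lift (σ.mean ρ ν) N₀ U ∧
          ∃ K : ℕ, ∀ F : ℝ → C(X, ℂ),
            Renewal.MemE (fun x => p (Renewal.OrbitSpace.mk H x)) γ K F →
            ∃ Fhat : ℝ → Renewal.HolderSpace X γ,
              (∀ (ξ : ℝ) (x : X),
                (Fhat ξ).toC x = ∫ t : ℝ, Complex.exp (-(Complex.I * ξ * t)) * F t x) ∧
              ∀ (x : X) (t : ℝ),
                IntegrableOn (fun u : ℝ => N₀ (F u) x) (Set.Ioi t) ∧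
                Integrable (fun ξ : ℝ => Complex.exp (Complex.I * ξ * t) *
                  (U (-(Complex.I * ξ)) (Fhat ξ)).toC x) ∧
                HasSum
                  (fun n : ℕ =>
                    ((Renewal.walkOp ρ σ.lift)^[n] (fun q : X × ℝ => F q.2 q.1)) (x, t))
                  (((σ.mean ρ ν : ℝ) : ℂ)⁻¹ * (∫ u in Set.Ioi t, N₀ (F u) x) +
                    (2 * (Real.pi : ℂ))⁻¹ * ∫ ξ : ℝ, Complex.exp (Complex.I * ξ * t) *
                      (U (-(Complex.I * ξ)) (Fhat ξ)).toC x) := by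
  obtain ⟨γ₁, hγ₁0, hγ₁1, hres⟩ := hres
  set γ₂ : ℝ≥0 := min γ₁ (γ₀ / 4).toNNReal with hγ₂
  have hγ₂0 : 0 < γ₂ := lt_min hγ₁0 (Real.toNNReal_pos.2 (by positivity))
  have hle : ∀ γ : ℝ≥0, γ ≤ γ₂ → γ ≤ γ₁ ∧ γ ≤ 1 ∧ (γ : ℝ) ≤ γ₀ / 4 := fun γ h => by
    have h1 : γ ≤ γ₁ := h.trans (min_le_left _ _)
    refine ⟨h1, h1.trans hγ₁1, ?_⟩
    have h2 : γ ≤ (γ₀ / 4).toNNReal := h.trans (min_le_right _ _)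
    rwa [Real.le_toNNReal_iff_coe_le (by positivity)] at h2
  obtain ⟨N₀, hN⟩ : ∃ N₀, Renewal.IsErgodicLimit (Renewal.perturbedOp ρ σ.lift 0) N₀ := by
    obtain ⟨-, h1, h2⟩ := hle γ₂ le_rfl
    obtain ⟨D, P, D', hW, hP, hPan, hD', hD'_apply, hDF⟩ := Renewal.exists_family hN_meas hN_one
      hN_mul hγ₀ hM hp hX_loc hX_lip hcontr hσ hγ₂0 h1 h2
    exact hDF.exists_isErgodicLimit
  have hPN := hN.mul_left_eq Renewal.norm_pow_perturbedOp_zero_le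
  refine ⟨N₀, ⟨hN.isInvariantProjector, fun N₀' h => ?_⟩, γ₂, hγ₂0, fun γ hγ hγγ => ?_⟩
  · exact hN.eq_of_projector Renewal.norm_pow_perturbedOp_zero_le h.idempotent h.range_eq h.commute
  obtain ⟨h1, h2, h3⟩ := hle γ hγγ
  obtain ⟨D, P, D', hW, hP, hPan, hD', hD'_apply, hDF⟩ := Renewal.exists_family hN_meas hN_one
    hN_mul hγ₀ hM hp hX_loc hX_lip hcontr hσ hγ h2 h3
  obtain ⟨e, he⟩ := Renewal.HolderSpace.exists_toC_eq_const (X := X) (γ := γ) 1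
  obtain ⟨ψ, hψ⟩ := Renewal.exists_corrector (φ := -(D' e)) hp_smul hγ₀ hcontr hirr hγ
    (by linarith) hν hW hDF fun x => by
      rw [Renewal.HolderSpace.toC_neg, ContinuousMap.neg_apply, hD'_apply, neg_neg]
      simp [he]
  have hψ' : ∀ x, ∫ g, (σ.lift.toFun g x : ℂ) ∂ρ =
      (σ.mean ρ ν : ℂ) + ψ.toC x - ∫ g, ψ.toC (g • x) ∂ρ := fun x => by
    rw [← hψ, Renewal.HolderSpace.toC_neg, ContinuousMap.neg_apply, hD'_apply, neg_neg]
    simp [he]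
  have hres' := hres γ hγ h1
  obtain ⟨U, hU⟩ := hW.exists_isRegularPart hP hPan hD' hD'_apply hDF hN hσ_pos.ne' hψ'
    fun t ht => by
      obtain ⟨C₀, L, h⟩ := hres' |t| (abs_pos.2 ht)
      obtain ⟨S, hS, -⟩ := h t le_rfl
      exact ⟨S, hS⟩
  obtain ⟨C₀, L, hCL⟩ := hres' 1 one_pos
  exact ⟨U, hU, ⌈L⌉₊ + 2, fun F hF => hW.hasSum_renewal hσ_pos hPN hψ' hU hCL hF⟩
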